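/- Let $d\ge 3$, $T\ge 1$, $p,q\in[1,\infty]$ (with $1/\infty=0$), and $R,L>0$. Let $\Theta\subset\mathbb{R}^d$ be compact and convex, and let $V:\Theta\to\mathbb{R}$ be convex, lower semicontinuous, $1$-strongly convex with respect to the $\ell_p$-norm, i.e. $V(x')\ge V(x)+\langle w,x'-x\rangle+\frac12\|x-x'\|_p^2$ for all $x,x'\in\Theta$ and all $w\in\partial V(x)$, and such that $\sup_\Theta V-\inf_\Theta V\le R^2$. Let $f_1,f_2,\ldots:\mathbb{R}^d\to\mathbb{R}$ be a fixed sequence of convex functions with $|f_t(x)-f_t(x')|\le L\|x-x'\|_q$ for all $x,x'\in\mathbb{R}^d$. Let $\zeta_1,\zeta_2,\ldots$ be independent random vectors, each uniformly distributed on the $\ell_1$-sphere $\{x\in\mathbb{R}^d:\|x\|_1=1\}$ (that is, with respect to the normalized surface measure), and let the noises $\xi'_t,\xi''_t$ satisfy $\xi'_t=\xi''_t$ almost surely for every $t$. For $\eta,h>0$ consider the following algorithm: set $z_1=0$ and, for $t=1,2,\ldots$, $$x_t=\operatorname*{arg\,max}_{x\in\Theta}\{\eta\langle z_t,x\rangle-V(x)\},\qquad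 y'_t=f_t(x_t+h\zeta_t)+\xi'_t,\qquad y''_t=f_t(x_t-h\zeta_t)+\xi''_t,$$ $$g_t=\frac{d}{2h}(y'_t-y''_t)\,\mathrm{sign}(\zeta_t),\qquad z_{t+1}=z_t-g_t,$$ where $\mathrm{sign}$ is taken componentwise with $\mathrm{sign}(0)=1$. Write $q\wedge2=\min(q,2)$, and let $\mathrm{b}_q(d)=\frac{q\,d^{1/q}}{d+1}$ if $q<\log d$ and $\mathrm{b}_q(d)=\frac{e\log d}{d+1}$ if $q\ge\log d$. If $$\eta=\frac{1}{\sqrt6+\sqrt{12}}\cdot\frac{R}{L}\sqrt{\frac{d^{-1-\frac{2}{q\wedge2}+\frac2p}}{T}}\qquad\text{and}\qquad 0<h\le\frac{7R}{100\,\mathrm{b}_q(d)\sqrt T}\,d^{\frac12+\frac1{q\wedge2}-\frac1p},$$ then, for every $x\in\Theta$, $$\mathbb{E}\Big[\sum_{t=1}^T\big(f_t(x_t)-f_t(x)\big)\Big]\le 11.9\,RL\sqrt{T\,d^{1+\frac{2}{q\wedge2}-\frac2p}}.$$ -/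

import Mathlib

open MeasureTheory ProbabilityTheory
open scoped ENNReal

noncomputable section

namespace ZeroOrder

/-- The space of vectors with `d` real coordinates, with its Euclidean structure. -/
abbrev Vec (d : ℕ) : Type := EuclideanSpace ℝ (Fin d)

/-- The `ℓ_p`-norm of a vector, `1 ≤ p ≤ ∞`. -/
def ellNorm {d : ℕ} (p : ℝ≥0∞) (x : Vec d) : ℝ :=
  ‖(WithLp.toLp p (fun i => x i) : PiLp p (fun _ : Fin d => ℝ))‖

/-- The unit sphere of the `ℓ_1`-norm. -/
def ell1Sphere (d : ℕ) : Set (Vec d) := {x | ellNorm 1 x = 1}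

/-- `X` is uniformly distributed on the `ℓ_1`-sphere: its law is the surface measure, that is, the
`(d-1)`-dimensional Hausdorff measure for the Euclidean distance, restricted to the sphere and
normalized to have total mass one. -/
def IsUniformOnEll1Sphere {d : ℕ} {Ω : Type*} [MeasurableSpace Ω] (P : Measure Ω)
    (X : Ω → Vec d) : Prop :=
  pdf.IsUniform X (ell1Sphere d) P (Measure.hausdorffMeasure ((d : ℝ) - 1))

/-- The componentwise sign, with the convention that the sign of `0` is `1`. -/
def signVec {d : ℕ} (x : Vec d) : Vec d :=
  WithLp.toLp 2 (fun i => if 0 ≤ x i then (1 : ℝ) else -1)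

/-- The subdifferential at `x` of a function `V` on the set `Θ`. The values of `V` outside `Θ`
play no role. -/
def subdifferentialOn {d : ℕ} (Θ : Set (Vec d)) (V : Vec d → ℝ) (x : Vec d) : Set (Vec d) :=
  {w | ∀ y ∈ Θ, V x + inner ℝ w (y - x) ≤ V y}

/-- `V` is convex, and `1`-strongly convex with respect to the `ℓ_p`-norm, on `Θ`. -/
def OneStronglyConvexOn {d : ℕ} (p : ℝ≥0∞) (Θ : Set (Vec d)) (V : Vec d → ℝ) : Prop :=
  ConvexOn ℝ Θ V ∧
    ∀ x ∈ Θ, ∀ x' ∈ Θ, ∀ w ∈ subdifferentialOn Θ V x,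
      V x + inner ℝ w (x' - x) + 1 / 2 * ellNorm p (x - x') ^ 2 ≤ V x'

/-- A maximizer of `F` over `Θ` (an arbitrary vector if there is none). -/
def argmaxOn {d : ℕ} (Θ : Set (Vec d)) (F : Vec d → ℝ) : Vec d :=
  Classical.epsilon fun x => x ∈ Θ ∧ IsMaxOn F Θ x

/-- The two-point `ℓ_1`-randomized gradient estimate at the point `x`, in the direction `ζ`, with
discretization parameter `h`, where `ξ'` and `ξ''` are the noises of the two queries. -/
def gradEstimate {d : ℕ} (f : Vec d → ℝ) (h : ℝ) (x ζ : Vec d) (ξ' ξ'' : ℝ) : Vec d :=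
  (d / (2 * h) * ((f (x + h • ζ) + ξ') - (f (x - h • ζ) + ξ''))) • signVec ζ

/-- The point played by dual averaging when the dual variable is `z` and the step size is `η`. -/
def primalPoint {d : ℕ} (Θ : Set (Vec d)) (V : Vec d → ℝ) (η : ℝ) (z : Vec d) : Vec d :=
  argmaxOn Θ fun x => η * inner ℝ z x - V x

/-- The dual variable of zero-order `ℓ_1`-randomized online dual averaging at each round, for given
directions `ζ` and noises `ξ'`, `ξ''`. The rounds are indexed by `0, 1, 2, …`. -/
def dualVar {d : ℕ} (Θ : Set (Vec d)) (V : Vec d → ℝ) (η h : ℕ → ℝ) (f : ℕ → Vec d → ℝ)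
    (ζ : ℕ → Vec d) (ξ' ξ'' : ℕ → ℝ) : ℕ → Vec d
  | 0 => 0
  | t + 1 =>
      dualVar Θ V η h f ζ ξ' ξ'' t -
        gradEstimate (f t) (h t) (primalPoint Θ V (η t) (dualVar Θ V η h f ζ ξ' ξ'' t))
          (ζ t) (ξ' t) (ξ'' t)

/-- The point played by zero-order `ℓ_1`-randomized online dual averaging at round `t`. -/
def iterate {d : ℕ} (Θ : Set (Vec d)) (V : Vec d → ℝ) (η h : ℕ → ℝ) (f : ℕ → Vec d → ℝ)
    (ζ : ℕ → Vec d) (ξ' ξ'' : ℕ → ℝ) (t : ℕ) : Vec d :=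
  primalPoint Θ V (η t) (dualVar Θ V η h f ζ ξ' ξ'' t)

/-- The quantity `b_q(d)`: `q d^{1/q} / (d+1)` if `q < log d`, and `e log d / (d+1)` otherwise. -/
def biasConst (q : ℝ≥0∞) (d : ℕ) : ℝ :=
  1 / ((d : ℝ) + 1) *
    (if q < ENNReal.ofReal (Real.log d) then q.toReal * (d : ℝ) ^ (1 / q.toReal)
      else Real.exp 1 * Real.log d)

/-- `1 / (q ∧ 2)` as a real number. -/
def invMinTwo (q : ℝ≥0∞) : ℝ := 1 / (min q 2).toReal

/-- `1 / p` as a real number, with `1 / ∞ = 0`. -/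
def invExp (p : ℝ≥0∞) : ℝ := (p⁻¹).toReal

end ZeroOrder

end

/-!
The proof separates a pathwise inequality from the analysis of one round.

*Dual averaging.* Along every sequence of gradients, `dualAveraging_regret` bounds
`∑ ⟨g_t, x_t - u⟩` by `R² / η + η / 2 ∑ c_t²`, where `c_t` bounds the norm of `g_t` dual to `ℓ_p`. The
potential is the conjugate of `V`; the optimality condition for `x_t` says that `η z_t` is a
subgradient of `V` on `Θ`, so strong convexity can be used at `x_t`. As the noises cancel, the
iterates are almost surely those of a noise-free process (`noiseFreeDual`), in which `x_t` is a
measurable function of the directions of the previous rounds, hence independent of `ζ_t`. It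
remains to know the bias and the second moment of a gradient estimate at a fixed point.

*The uniform law.* Each half of the `ℓ_1`-sphere on either side of a coordinate hyperplane is a
graph over the unit ball of that hyperplane, with slopes `±1`, so that the area factor is the
constant `√d`. Thus, in every coordinate direction, the uniform law is the pushforward of a multiple
of Lebesgue measure (`exists_isUniformEll1`). This one description gives the divergence theorem on
the `ℓ_1`-ball (`IsUniformEll1.integral_sgn_mul_eq_ball`), by integrating along lines parallel to an
axis, and polar coordinates (`IsUniformEll1.laplace_polar`): if `W` is a vector of `d` independent
Laplace variables, then `W / ‖W‖₁` is uniform and independent of `‖W‖₁`, which has a Gamma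
distribution.

*Bias.* By the divergence theorem the mean of the estimate is the mean of the gradient of the loss
over an `ℓ_1`-ball of radius `h`. Convexity, applied at each point of the ball, leaves an error of
`L h` times the mean `ℓ_q`-norm of a uniform point of the unit ball, which is at most `6 b_q(d)` by
the moments of the Laplace distribution (`IsUniformEll1.integral_ball_ellNorm_le`).

*Second moment.* The difference `f (x + h s) - f (x - h s)` is an odd Lipschitz function of `s`, and
the Poincaré inequality for Laplace variables (`laplacePi_poincare`) shows that the mean square of
such a function with Euclidean Lipschitz constant `Λ` is at most `12 Λ² / d²`
(`IsUniformEll1.lintegral_odd_sq_le`).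

Losses that are not differentiable are limits of smooth convex ones with the same Lipschitz
constant (`exists_smooth_approx`). With the given `η` and `h` the three contributions add up to at
most `7.92 R L √(T d^{1 + 2/(q ∧ 2) - 2/p})`.
-/

noncomputable section

namespace ZeroOrder

/-! ### Inequalities between the `ℓ_p`-norms -/

section

variable {d : ℕ}

lemma ellNorm_top (x : Vec d) : ellNorm ∞ x = ⨆ i, ‖x i‖ := by
  simp [ellNorm, PiLp.norm_eq_ciSup]

lemma ellNorm_eq_sum {p : ℝ≥0∞} (hp : 1 ≤ p) (hp' : p ≠ ∞) (x : Vec d) :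
    ellNorm p x = (∑ i, |x i| ^ p.toReal) ^ (1 / p.toReal) := by
  have h0 : 0 < p.toReal := ENNReal.toReal_pos (by positivity) hp'
  simp [ellNorm, PiLp.norm_eq_sum h0]

lemma ellNorm_nonneg {p : ℝ≥0∞} (hp : 1 ≤ p) (x : Vec d) : 0 ≤ ellNorm p x := by
  have : Fact (1 ≤ p) := ⟨hp⟩
  exact norm_nonneg _

lemma ellNorm_smul {p : ℝ≥0∞} (hp : 1 ≤ p) (c : ℝ) (x : Vec d) :
    ellNorm p (c • x) = |c| * ellNorm p x := by
  have : Fact (1 ≤ p) := ⟨hp⟩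
  exact norm_smul c (WithLp.toLp p (fun i => x i) : PiLp p (fun _ : Fin d => ℝ))

lemma ellNorm_neg {p : ℝ≥0∞} (hp : 1 ≤ p) (x : Vec d) : ellNorm p (-x) = ellNorm p x := by
  simpa using ellNorm_smul hp (-1) x

lemma ellNorm_sub_comm {p : ℝ≥0∞} (hp : 1 ≤ p) (x y : Vec d) :
    ellNorm p (x - y) = ellNorm p (y - x) := by
  rw [← neg_sub, ellNorm_neg hp]

lemma abs_apply_le_ellNorm {p : ℝ≥0∞} (hp : 1 ≤ p) (x : Vec d) (i : Fin d) :
    |x i| ≤ ellNorm p x := by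
  have : Fact (1 ≤ p) := ⟨hp⟩
  exact PiLp.norm_apply_le (WithLp.toLp p (fun i => x i) : PiLp p (fun _ : Fin d => ℝ)) i

lemma ellNorm_one (x : Vec d) : ellNorm 1 x = ∑ i, |x i| := by
  simp [ellNorm_eq_sum le_rfl ENNReal.one_ne_top]

lemma ellNorm_two (x : Vec d) : ellNorm 2 x = ‖x‖ := rfl

lemma ellNorm_continuous {p : ℝ≥0∞} (hp : 1 ≤ p) : Continuous (ellNorm p : Vec d → ℝ) := by
  have : Fact (1 ≤ p) := ⟨hp⟩
  unfold ellNorm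
  fun_prop

lemma ofReal_ellNorm {p : ℝ≥0∞} (hp : 1 ≤ p) (x : Vec d) :
    ENNReal.ofReal (ellNorm p x) = eLpNorm (fun i => x i) p Measure.count := by
  rcases eq_or_ne p ∞ with rfl | hp'
  · rcases isEmpty_or_nonempty (Fin d) with hd | hd
    · simp [ellNorm_top]
    · rw [ellNorm_top, eLpNorm_exponent_top, eLpNormEssSup_count]
      rw [ENNReal.ofReal_mono.map_ciSup_of_continuousAt ENNReal.continuous_ofReal.continuousAt
        (Set.finite_range _).bddAbove]
      simp only [ofReal_norm]
  · have h0 : p ≠ 0 := by positivity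
    have h1 : 0 < p.toReal := ENNReal.toReal_pos h0 hp'
    rw [eLpNorm_eq_lintegral_rpow_enorm_toReal h0 hp', lintegral_count, tsum_fintype,
      ellNorm_eq_sum hp hp', ← ENNReal.ofReal_rpow_of_nonneg (by positivity) (by positivity),
      ENNReal.ofReal_sum_of_nonneg (fun i _ => by positivity)]
    congr 1
    refine Finset.sum_congr rfl fun i _ => ?_
    rw [← ENNReal.ofReal_rpow_of_nonneg (by positivity) h1.le, ← Real.norm_eq_abs,
      ofReal_norm]

/-- Hölder's inequality between the `ℓ_p`-norms. -/
lemma ellNorm_le_rpow_mul {p q : ℝ≥0∞} (hp : 1 ≤ p) (hpq : p ≤ q) (hd : 0 < d) (x : Vec d) :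
    ellNorm p x ≤ (d : ℝ) ^ (1 / p.toReal - 1 / q.toReal) * ellNorm q x := by
  have hq := hp.trans hpq
  have h := eLpNorm_le_eLpNorm_mul_rpow_measure_univ (μ := (Measure.count : Measure (Fin d))) hpq
    (f := fun i => x i) (by fun_prop)
  rw [← ofReal_ellNorm hp, ← ofReal_ellNorm hq, Measure.count_univ] at h
  have hd' : (0:ℝ) < d := by exact_mod_cast hd
  have e : ((ENat.card (Fin d) : ℕ∞) : ℝ≥0∞) = ENNReal.ofReal d := by simp
  rw [e, ENNReal.ofReal_rpow_of_pos hd', ← ENNReal.ofReal_mul (ellNorm_nonneg hq x)] at h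
  rw [mul_comm]
  exact (ENNReal.ofReal_le_ofReal_iff (mul_nonneg (ellNorm_nonneg hq x) (by positivity))).1 h

lemma ellNorm_antitone {p q : ℝ≥0∞} (hp : 1 ≤ p) (hpq : p ≤ q) (x : Vec d) :
    ellNorm q x ≤ ellNorm p x := by
  have hq := hp.trans hpq
  have hA := ellNorm_nonneg hp x
  rcases eq_or_ne q ∞ with rfl | hq'
  · rw [ellNorm_top]
    exact Real.iSup_le (fun i => abs_apply_le_ellNorm hp x i) hA
  · have hp' : p ≠ ∞ := ne_top_of_le_ne_top hq' hpq
    have hr : 0 < p.toReal := ENNReal.toReal_pos (by positivity) hp'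
    have hs : 0 < q.toReal := ENNReal.toReal_pos (by positivity) hq'
    have hrs : p.toReal ≤ q.toReal := ENNReal.toReal_mono hq' hpq
    rcases hA.eq_or_lt with h0 | hpos
    · have hx : ∀ i, |x i| = 0 := fun i =>
        le_antisymm (by simpa [← h0] using abs_apply_le_ellNorm hp x i) (abs_nonneg _)
      rw [ellNorm_eq_sum hq hq', ← h0]
      simp [hx, Real.zero_rpow hs.ne', Real.zero_rpow (inv_ne_zero hs.ne')]
    · rw [ellNorm_eq_sum hq hq', one_div,
        Real.rpow_inv_le_iff_of_pos (Finset.sum_nonneg fun i _ => by positivity) hA hs]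
      have hsum : ∑ i, |x i| ^ p.toReal = ellNorm p x ^ p.toReal := by
        rw [ellNorm_eq_sum hp hp', ← Real.rpow_mul (Finset.sum_nonneg fun i _ => by positivity),
          one_div_mul_cancel hr.ne', Real.rpow_one]
      calc ∑ i, |x i| ^ q.toReal
          ≤ ∑ i, |x i| ^ p.toReal * ellNorm p x ^ (q.toReal - p.toReal) := by
            refine Finset.sum_le_sum fun i _ => ?_
            have : |x i| ^ q.toReal = |x i| ^ p.toReal * |x i| ^ (q.toReal - p.toReal) := by
              rw [← Real.rpow_add_of_nonneg (abs_nonneg _) hr.le (by linarith)]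
              congr 1; ring
            rw [this]
            gcongr
            exact abs_apply_le_ellNorm hp x i
        _ = ellNorm p x ^ q.toReal := by
            rw [← Finset.sum_mul, hsum, ← Real.rpow_add hpos]
            congr 1; ring

/-- Comparison with the Euclidean norm, covering the cases `q ≤ 2` and `q ≥ 2` at once. -/
lemma ellNorm_le_rpow_mul_norm {q : ℝ≥0∞} (hq : 1 ≤ q) (hd : 0 < d) (x : Vec d) :
    ellNorm q x ≤ (d : ℝ) ^ (invMinTwo q - 1 / 2) * ‖x‖ := by
  rw [← ellNorm_two]
  rcases le_total q 2 with h | h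
  · have := ellNorm_le_rpow_mul hq h hd x
    simpa [invMinTwo, min_eq_left h] using this
  · simpa [invMinTwo, min_eq_right h] using ellNorm_antitone (by norm_num) h x

lemma sum_abs_le_rpow_mul_ellNorm {p : ℝ≥0∞} (hp : 1 ≤ p) (hd : 0 < d) (x : Vec d) :
    ∑ i, |x i| ≤ (d : ℝ) ^ (1 - invExp p) * ellNorm p x := by
  rw [← ellNorm_one]
  simpa [invExp] using ellNorm_le_rpow_mul le_rfl hp hd x

lemma norm_le_sum_abs (x : Vec d) : ‖x‖ ≤ ∑ i, |x i| := by
  rw [← ellNorm_one, ← ellNorm_two]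
  exact ellNorm_antitone le_rfl (by norm_num) x

lemma abs_inner_signVec_le (s v : Vec d) : |inner ℝ (signVec s) v| ≤ ∑ i, |v i| := by
  rw [PiLp.inner_apply]
  refine (Finset.abs_sum_le_sum_abs _ _).trans (Finset.sum_le_sum fun i _ => ?_)
  simp only [signVec, RCLike.inner_apply, conj_trivial]
  split_ifs <;> simp

lemma inner_signVec (s v : Vec d) :
    inner ℝ (signVec s) v = ∑ i, v i * (if 0 ≤ s i then (1 : ℝ) else -1) := by
  rw [PiLp.inner_apply]
  simp [signVec]

/-- Both branches of the definition of `biasConst` are the value of `s d^{1/s} / (d+1)` at a finite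
exponent `s ≤ q`, namely `s = q` or `s = log d`. -/
lemma exists_exponent_biasConst {q : ℝ≥0∞} (hq : 1 ≤ q) (hd : 3 ≤ d) :
    ∃ s : ℝ, 1 ≤ s ∧ ENNReal.ofReal s ≤ q ∧
      biasConst q d = s * (d : ℝ) ^ (1 / s) / (d + 1) := by
  by_cases h : q < ENNReal.ofReal (Real.log d)
  · have hq' : q ≠ ∞ := (h.trans ENNReal.ofReal_lt_top).ne
    refine ⟨q.toReal, ?_, (ENNReal.ofReal_toReal hq').le, ?_⟩
    · simpa using ENNReal.toReal_mono hq' hq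
    · rw [biasConst, if_pos h]; ring
  · have hd' : (3:ℝ) ≤ d := by exact_mod_cast hd
    have hlog : 1 ≤ Real.log d := by
      rw [Real.le_log_iff_exp_le (by linarith)]
      linarith [Real.exp_one_lt_d9]
    refine ⟨Real.log d, hlog, not_lt.1 h, ?_⟩
    rw [biasConst, if_neg h, Real.rpow_def_of_pos (by linarith),
      mul_one_div_cancel (by linarith)]
    ring

/-- Linearizing the `s`-th root bounds an `ℓ_q`-norm by a sum over coordinates, whose expectation
is immediate. -/
lemma ellNorm_le_linearized {q : ℝ≥0∞} {s : ℝ} (hs : 1 ≤ s) (hsq : ENNReal.ofReal s ≤ q)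
    (hd : 0 < d) (x : Vec d) :
    ellNorm q x ≤ 2 * s * (d : ℝ) ^ (1 / s) * (1 + (∑ i, (|x i| / (2 * s)) ^ s) / d) := by
  have hs1 : 1 ≤ ENNReal.ofReal s := by simpa using ENNReal.ofReal_le_ofReal hs
  have hd' : (0:ℝ) < d := by exact_mod_cast hd
  refine (ellNorm_antitone hs1 hsq x).trans ?_
  rw [ellNorm_eq_sum hs1 ENNReal.ofReal_ne_top, ENNReal.toReal_ofReal (by linarith)]
  set A := (∑ i, (|x i| / (2 * s)) ^ s) / d with hA
  have hA0 : 0 ≤ A := div_nonneg (Finset.sum_nonneg fun i _ => by positivity) hd'.le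
  have e : ∑ i, |x i| ^ s = (2 * s) ^ s * d * A := by
    rw [hA, mul_assoc, mul_div_cancel₀ _ hd'.ne', Finset.mul_sum]
    refine Finset.sum_congr rfl fun i _ => ?_
    rw [← Real.mul_rpow (by positivity) (by positivity), mul_div_cancel₀ _ (by positivity)]
  rw [e, Real.mul_rpow (by positivity) hA0, Real.mul_rpow (by positivity) hd'.le,
    ← Real.rpow_mul (by positivity), mul_one_div_cancel (by linarith), Real.rpow_one]
  gcongr
  calc A ^ (1 / s) ≤ (1 + A) ^ (1 / s) := by gcongr; linarith
    _ ≤ (1 + A) ^ (1 : ℝ) := by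
      apply Real.rpow_le_rpow_of_exponent_le (by linarith)
      rw [div_le_one (by linarith)]; exact hs
    _ = 1 + A := Real.rpow_one _

end

/-! ### Dual averaging along an arbitrary sequence of gradients -/

section

variable {d : ℕ} {p : ℝ≥0∞} {Θ : Set (Vec d)} {V : Vec d → ℝ} {η : ℝ}

lemma primalPoint_spec (hΘ : IsCompact Θ) (hne : Θ.Nonempty) (hV : LowerSemicontinuousOn V Θ)
    (η : ℝ) (z : Vec d) :
    primalPoint Θ V η z ∈ Θ ∧
      IsMaxOn (fun x => η * inner ℝ z x - V x) Θ (primalPoint Θ V η z) := by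
  refine Classical.epsilon_spec (p := fun x => x ∈ Θ ∧
    IsMaxOn (fun x => η * inner ℝ z x - V x) Θ x) ?_
  have hlsc : LowerSemicontinuousOn (fun x => V x + -(η * inner ℝ z x)) Θ := by
    have hc : Continuous fun x : Vec d => -(η * inner ℝ z x) := by fun_prop
    exact hV.add (hc.lowerSemicontinuous.lowerSemicontinuousOn Θ)
  obtain ⟨x, hx, hmin⟩ := hlsc.exists_isMinOn hne hΘ
  refine ⟨x, hx, fun y hy => ?_⟩
  have := hmin hy
  simp only [Set.mem_ofPred_eq] at this ⊢
  linarith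

/-- The optimality condition at the point played says that `η z` is a subgradient of `V` there, so
strong convexity improves it by a quadratic term. -/
lemma primalPoint_strong (hΘ : IsCompact Θ) (hV : LowerSemicontinuousOn V Θ)
    (hVc : OneStronglyConvexOn p Θ V) (z : Vec d) {y : Vec d} (hy : y ∈ Θ) :
    V (primalPoint Θ V η z) + η * inner ℝ z (y - primalPoint Θ V η z) +
      1 / 2 * ellNorm p (primalPoint Θ V η z - y) ^ 2 ≤ V y := by
  obtain ⟨hx, hmax⟩ := primalPoint_spec hΘ ⟨y, hy⟩ hV η z
  have h := hVc.2 _ hx y hy (η • z) ?_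
  · rwa [real_inner_smul_left] at h
  · intro w hw
    have := hmax hw
    simp only [Set.mem_ofPred_eq] at this
    rw [real_inner_smul_left, inner_sub_right]
    linarith

/-- The regret bound of dual averaging: `c t` bounds the dual norm of the gradient `g t`. -/
lemma dualAveraging_regret (hΘ : IsCompact Θ) (hV : LowerSemicontinuousOn V Θ)
    (hVc : OneStronglyConvexOn p Θ V) (hη : 0 < η) {R : ℝ}
    (hR : ∀ x ∈ Θ, ∀ x' ∈ Θ, V x - V x' ≤ R ^ 2) {z g : ℕ → Vec d} {c : ℕ → ℝ}
    (hz0 : z 0 = 0) (hz : ∀ t, z (t + 1) = z t - g t)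
    (hg : ∀ t v, |inner ℝ (g t) v| ≤ c t * ellNorm p v) {u : Vec d} (hu : u ∈ Θ) (T : ℕ) :
    ∑ t ∈ Finset.range T, inner ℝ (g t) (primalPoint Θ V η (z t) - u) ≤
      R ^ 2 / η + η / 2 * ∑ t ∈ Finset.range T, c t ^ 2 := by
  have hx : ∀ t, primalPoint Θ V η (z t) ∈ Θ := fun t => (primalPoint_spec hΘ ⟨u, hu⟩ hV η _).1
  -- the potential is the convex conjugate `max_x (η ⟨z, x⟩ - V x)`
  set Ψ : ℕ → ℝ := fun t => η * inner ℝ (z t) (primalPoint Θ V η (z t))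
    - V (primalPoint Θ V η (z t)) with hΨ
  have step : ∀ t, Ψ (t + 1) ≤ Ψ t - η * inner ℝ (g t) (primalPoint Θ V η (z t))
      + η ^ 2 / 2 * c t ^ 2 := by
    intro t
    have h1 := primalPoint_strong (η := η) hΘ hV hVc (z t) (hx (t + 1))
    have h2 := hg t (primalPoint Θ V η (z t) - primalPoint Θ V η (z (t + 1)))
    have h3 := (abs_le.1 h2).2
    simp only [hΨ]
    set x := primalPoint Θ V η (z t)
    set x' := primalPoint Θ V η (z (t + 1))
    set N := ellNorm p (x - x')
    rw [hz, inner_sub_left]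
    rw [inner_sub_right] at h1 h3
    nlinarith [sq_nonneg (N - η * c t), mul_le_mul_of_nonneg_left h3 hη.le]
  have tele : ∀ T, Ψ T ≤ Ψ 0 - η * ∑ t ∈ Finset.range T, inner ℝ (g t) (primalPoint Θ V η (z t))
      + η ^ 2 / 2 * ∑ t ∈ Finset.range T, c t ^ 2 := by
    intro T
    induction T with
    | zero => simp
    | succ T ih => rw [Finset.sum_range_succ, Finset.sum_range_succ]; linarith [step T]
  have hzT : ∀ T, z T = -∑ t ∈ Finset.range T, g t := by
    intro T
    induction T with
    | zero => simp [hz0]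
    | succ T ih => rw [Finset.sum_range_succ, hz, ih]; abel
  have hlow : -(η * ∑ t ∈ Finset.range T, inner ℝ (g t) u) - V u ≤ Ψ T := by
    have := (primalPoint_spec hΘ ⟨u, hu⟩ hV η (z T)).2 hu
    simp only [Set.mem_ofPred_eq] at this
    rw [hzT T, inner_neg_left, sum_inner, ← hzT T] at this
    linarith
  have h0 : Ψ 0 = -V (primalPoint Θ V η (z 0)) := by simp [hΨ, hz0]
  have hr := hR u hu _ (hx 0)
  simp only [inner_sub_right, Finset.sum_sub_distrib]
  have key : η * (∑ t ∈ Finset.range T, inner ℝ (g t) (primalPoint Θ V η (z t)) -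
      ∑ t ∈ Finset.range T, inner ℝ (g t) u) ≤
      R ^ 2 + η ^ 2 / 2 * ∑ t ∈ Finset.range T, c t ^ 2 := by
    linarith [tele T]
  rw [← mul_le_mul_iff_right₀ hη]
  refine key.trans_eq ?_
  field_simp

lemma primalPoint_continuous (hd : 0 < d) (hp : 1 ≤ p) (hΘ : IsCompact Θ) (hne : Θ.Nonempty)
    (hV : LowerSemicontinuousOn V Θ) (hVc : OneStronglyConvexOn p Θ V) (hη : 0 < η) :
    Continuous (primalPoint Θ V η) := by
  have hx : ∀ z, primalPoint Θ V η z ∈ Θ := fun z => (primalPoint_spec hΘ hne hV η z).1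
  set C : ℝ := (d : ℝ) ^ (1 - invExp p) with hC
  have hC0 : 0 ≤ C := by positivity
  have key : ∀ z z', ‖primalPoint Θ V η z - primalPoint Θ V η z'‖ ≤ C ^ 2 * η * ‖z - z'‖ := by
    intro z z'
    have h1 := primalPoint_strong (η := η) hΘ hV hVc z (hx z')
    have h2 := primalPoint_strong (η := η) hΘ hV hVc z' (hx z)
    rw [ellNorm_sub_comm hp] at h2
    set x := primalPoint Θ V η z
    set x' := primalPoint Θ V η z'
    have h3 : ‖x - x'‖ ≤ C * ellNorm p (x - x') :=
      (norm_le_sum_abs _).trans (sum_abs_le_rpow_mul_ellNorm hp hd _)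
    have h4 : ellNorm p (x - x') ^ 2 ≤ η * (‖z - z'‖ * ‖x - x'‖) := by
      have := real_inner_le_norm (z - z') (x - x')
      have h5 := mul_le_mul_of_nonneg_left this hη.le
      rw [inner_sub_left, inner_sub_right, inner_sub_right] at h5
      rw [inner_sub_right] at h1 h2
      linarith
    rcases (norm_nonneg (x - x')).eq_or_lt with h0 | h0
    · rw [← h0]; positivity
    · have h6 : ‖x - x'‖ ^ 2 ≤ C ^ 2 * (η * (‖z - z'‖ * ‖x - x'‖)) := by
        calc ‖x - x'‖ ^ 2 ≤ (C * ellNorm p (x - x')) ^ 2 := by gcongr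
          _ = C ^ 2 * ellNorm p (x - x') ^ 2 := by ring
          _ ≤ _ := by gcongr
      have : ‖x - x'‖ * ‖x - x'‖ ≤ (C ^ 2 * η * ‖z - z'‖) * ‖x - x'‖ := by
        nlinarith
      exact le_of_mul_le_mul_right this h0
  have hL : LipschitzWith (C ^ 2 * η).toNNReal (primalPoint Θ V η) :=
    LipschitzWith.of_dist_le_mul fun z z' => by
      rw [dist_eq_norm, dist_eq_norm, Real.coe_toNNReal _ (by positivity)]
      exact key z z'
  exact hL.continuous

end

/-! ### The Laplace distribution and its Poincaré inequality -/

section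

open Set Filter Topology

/-- The Laplace distribution on the real line, with density `exp (-|t|) / 2`. -/
def laplace : Measure ℝ := volume.withDensity fun t => ENNReal.ofReal (Real.exp (-|t|) / 2)

lemma integrableOn_pow_mul_exp_neg (k : ℕ) :
    IntegrableOn (fun t : ℝ => t ^ k * Real.exp (-t)) (Ioi 0) := by
  have := Real.GammaIntegral_convergent (s := (k : ℝ) + 1) (by positivity)
  simpa [mul_comm] using this

lemma integral_pow_mul_exp_neg (k : ℕ) :
    ∫ t in Ioi (0 : ℝ), t ^ k * Real.exp (-t) = k.factorial := by
  rw [← Real.Gamma_nat_eq_factorial, Real.Gamma_eq_integral (by positivity)]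
  simp [mul_comm]

lemma integrable_laplace_iff {g : ℝ → ℝ} :
    Integrable g laplace ↔ Integrable (fun t => Real.exp (-|t|) / 2 * g t) := by
  rw [laplace, integrable_withDensity_iff_integrable_smul' (by fun_prop) (by simp)]
  refine integrable_congr (ae_of_all _ fun t => ?_)
  simp [ENNReal.toReal_ofReal (show 0 ≤ Real.exp (-|t|) / 2 by positivity)]

lemma integral_laplace (g : ℝ → ℝ) :
    ∫ t, g t ∂laplace = ∫ t, Real.exp (-|t|) / 2 * g t := by
  rw [laplace, integral_withDensity_eq_integral_toReal_smul (by fun_prop) (by simp)]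
  refine integral_congr_ae (ae_of_all _ fun t => ?_)
  simp [ENNReal.toReal_ofReal (show 0 ≤ Real.exp (-|t|) / 2 by positivity)]

/-- Expectations under the Laplace distribution, folded onto the positive half-line. -/
lemma laplace_fold {g : ℝ → ℝ}
    (h1 : IntegrableOn (fun t => g t * Real.exp (-t)) (Ioi 0))
    (h2 : IntegrableOn (fun t => g (-t) * Real.exp (-t)) (Ioi 0)) :
    Integrable g laplace ∧ ∫ t, g t ∂laplace =
      ((∫ t in Ioi 0, g t * Real.exp (-t)) + ∫ t in Ioi 0, g (-t) * Real.exp (-t)) / 2 := by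
  have e1 : EqOn (fun t => g t * Real.exp (-t) / 2) (fun t => Real.exp (-|t|) / 2 * g t)
      (Ioi 0) := fun t ht => by
    simp only [abs_of_pos (mem_Ioi.1 ht)]; ring
  have e2 : EqOn (fun t => g (-t) * Real.exp (-t) / 2)
      (fun t => Real.exp (-|(-t)|) / 2 * g (-t)) (Ioi 0) := fun t ht => by
    simp only [abs_neg, abs_of_pos (mem_Ioi.1 ht)]; ring
  have i1 : IntegrableOn (fun t => Real.exp (-|t|) / 2 * g t) (Ioi 0) :=
    (integrableOn_congr_fun e1 measurableSet_Ioi).1 (h1.div_const 2)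
  have i2 : IntegrableOn (fun t => Real.exp (-|(-t)|) / 2 * g (-t)) (Ioi 0) :=
    (integrableOn_congr_fun e2 measurableSet_Ioi).1 (h2.div_const 2)
  have i3 : IntegrableOn (fun t => Real.exp (-|t|) / 2 * g t) (Iic 0) := by
    rw [integrableOn_Iic_iff_integrableOn_Iio]
    rw [← (Measure.measurePreserving_neg (volume : Measure ℝ)).integrableOn_comp_preimage
      (Homeomorph.neg ℝ).measurableEmbedding]
    simpa [Function.comp_def] using i2
  have i4 : Integrable (fun t => Real.exp (-|t|) / 2 * g t) := by
    rw [← integrableOn_univ, ← Iic_union_Ioi (a := (0 : ℝ))]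
    exact i3.union i1
  refine ⟨integrable_laplace_iff.2 i4, ?_⟩
  rw [integral_laplace, ← intervalIntegral.integral_Iic_add_Ioi i3 i1,
    ← setIntegral_congr_fun measurableSet_Ioi e1, integral_div]
  have := integral_comp_neg_Iic (0 : ℝ) (fun t => Real.exp (-|t|) / 2 * g (-t))
  simp only [abs_neg, neg_neg, neg_zero] at this
  rw [this]
  have e3 : EqOn (fun t => Real.exp (-|t|) / 2 * g (-t)) (fun t => g (-t) * Real.exp (-t) / 2)
      (Ioi 0) := fun t ht => by
    simp only [abs_of_pos (mem_Ioi.1 ht)]; ring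
  rw [setIntegral_congr_fun measurableSet_Ioi e3, integral_div]
  ring

instance : IsProbabilityMeasure laplace := by
  have h := integrableOn_pow_mul_exp_neg 0
  have h' := integral_pow_mul_exp_neg 0
  simp only [pow_zero] at h h'
  obtain ⟨hi, he⟩ := laplace_fold (g := fun _ => 1) h h
  rw [h'] at he
  have hfin : laplace univ ≠ ∞ := by
    rcases integrable_const_iff.1 hi with h0 | h0
    · simp at h0
    · exact measure_ne_top _ _
  refine ⟨?_⟩
  rw [integral_const] at he
  simp only [measureReal_def, smul_eq_mul, mul_one, Nat.factorial_zero, Nat.cast_one] at he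
  rw [← ENNReal.ofReal_toReal hfin, he]
  norm_num

lemma laplace_sq : Integrable (fun t : ℝ => t ^ 2) laplace ∧ ∫ t, t ^ 2 ∂laplace = 2 := by
  have h := integrableOn_pow_mul_exp_neg 2
  obtain ⟨hi, he⟩ := laplace_fold (g := fun t => t ^ 2) h (by simpa using h)
  refine ⟨hi, ?_⟩
  rw [he]
  simp only [neg_sq]
  rw [integral_pow_mul_exp_neg]
  norm_num [Nat.factorial]

lemma laplace_memLp : MemLp (fun t : ℝ => t) 2 laplace :=
  (memLp_two_iff_integrable_sq (by fun_prop)).2 laplace_sq.1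

lemma laplace_exp_half : Integrable (fun t : ℝ => Real.exp (|t| / 2)) laplace ∧
    ∫ t, Real.exp (|t| / 2) ∂laplace = 2 := by
  have e : EqOn (fun t : ℝ => Real.exp (-(1 / 2) * t))
      (fun t => Real.exp (|t| / 2) * Real.exp (-t)) (Ioi 0) := fun t ht => by
    simp only [abs_of_pos (mem_Ioi.1 ht), ← Real.exp_add]
    congr 1; ring
  have h : IntegrableOn (fun t => Real.exp (|t| / 2) * Real.exp (-t)) (Ioi 0) :=
    (integrableOn_congr_fun e measurableSet_Ioi).1 (exp_neg_integrableOn_Ioi 0 (by norm_num))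
  obtain ⟨hi, he⟩ := laplace_fold (g := fun t => Real.exp (|t| / 2)) h (by simpa using h)
  refine ⟨hi, ?_⟩
  rw [he]
  simp only [abs_neg]
  rw [← setIntegral_congr_fun measurableSet_Ioi e, integral_exp_mul_Ioi (by norm_num)]
  norm_num

/-- The absolute `s`-th moment of the Laplace distribution is at most `2 (2s)^s`. -/
lemma laplace_moment {s : ℝ} (hs : 1 ≤ s) : Integrable (fun t : ℝ => (|t| / (2 * s)) ^ s) laplace ∧
    ∫ t, (|t| / (2 * s)) ^ s ∂laplace ≤ 2 := by
  have hb : ∀ t : ℝ, (|t| / (2 * s)) ^ s ≤ Real.exp (|t| / 2) := fun t => by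
    have h1 : |t| / (2 * s) ≤ Real.exp (|t| / (2 * s)) := by
      linarith [Real.add_one_le_exp (|t| / (2 * s))]
    calc (|t| / (2 * s)) ^ s ≤ Real.exp (|t| / (2 * s)) ^ s := by gcongr
      _ = Real.exp (|t| / 2) := by
        rw [← Real.exp_mul]
        congr 1
        field_simp
  have hm : Measurable fun t : ℝ => (|t| / (2 * s)) ^ s := by fun_prop
  have hi : Integrable (fun t : ℝ => (|t| / (2 * s)) ^ s) laplace :=
    laplace_exp_half.1.mono' hm.aestronglyMeasurable (ae_of_all _ fun t => by
      rw [Real.norm_of_nonneg (by positivity)]; exact hb t)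
  exact ⟨hi, (integral_mono hi laplace_exp_half.1 hb).trans_eq laplace_exp_half.2⟩

/-- The Poincaré inequality for the exponential distribution: the derivative of `-φ² e^{-t}` is
`(φ² - 2 φ φ') e^{-t} ≥ (φ² / 2 - 2 φ'²) e^{-t}`, and its integral vanishes. -/
lemma exponential_poincare {φ φ' : ℝ → ℝ} {C : ℝ} (hφ : ∀ t, HasDerivAt φ (φ' t) t)
    (hc : Continuous φ') (hC : ∀ t, |φ' t| ≤ C) (h0 : φ 0 = 0) :
    IntegrableOn (fun t => φ t ^ 2 * Real.exp (-t)) (Ioi 0) ∧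
    IntegrableOn (fun t => φ' t ^ 2 * Real.exp (-t)) (Ioi 0) ∧
    ∫ t in Ioi 0, φ t ^ 2 * Real.exp (-t) ≤ 4 * ∫ t in Ioi 0, φ' t ^ 2 * Real.exp (-t) := by
  have hC0 : 0 ≤ C := (abs_nonneg _).trans (hC 0)
  have hφc : Continuous φ := continuous_iff_continuousAt.2 fun t => (hφ t).continuousAt
  have hgrow : ∀ t, |φ t| ≤ C * |t| := fun t => by
    have := Convex.norm_image_sub_le_of_norm_hasDerivWithin_le (f := φ) (f' := φ') (C := C)
      (s := univ) (x := 0) (y := t) (fun x _ => (hφ x).hasDerivWithinAt) (fun x _ => hC x)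
      convex_univ (mem_univ _) (mem_univ _)
    simpa [h0] using this
  have hsq : ∀ t, φ t ^ 2 ≤ C ^ 2 * t ^ 2 := fun t => by
    rw [← mul_pow, ← sq_abs (φ t)]
    have := hgrow t
    calc |φ t| ^ 2 ≤ (C * |t|) ^ 2 := by gcongr
      _ = (C * t) ^ 2 := by rw [mul_pow, mul_pow, sq_abs]
  have hsq' : ∀ t, φ' t ^ 2 ≤ C ^ 2 := fun t => by
    rw [← sq_abs]; exact pow_le_pow_left₀ (abs_nonneg _) (hC t) 2
  have i1 : IntegrableOn (fun t => φ t ^ 2 * Real.exp (-t)) (Ioi 0) := by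
    refine ((integrableOn_pow_mul_exp_neg 2).const_mul (C ^ 2)).mono'
      (by fun_prop) (ae_of_all _ fun t => ?_)
    rw [Real.norm_of_nonneg (by positivity), ← mul_assoc]
    exact mul_le_mul_of_nonneg_right (hsq t) (Real.exp_pos _).le
  have i2 : IntegrableOn (fun t => φ' t ^ 2 * Real.exp (-t)) (Ioi 0) := by
    refine ((integrableOn_pow_mul_exp_neg 0).const_mul (C ^ 2)).mono'
      (by fun_prop) (ae_of_all _ fun t => ?_)
    rw [Real.norm_of_nonneg (by positivity), pow_zero, one_mul]
    exact mul_le_mul_of_nonneg_right (hsq' t) (Real.exp_pos _).le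
  refine ⟨i1, i2, ?_⟩
  have i3 : IntegrableOn (fun t => (φ t ^ 2 - 2 * φ t * φ' t) * Real.exp (-t)) (Ioi 0) := by
    refine ((i1.const_mul 2).add i2).mono' (by fun_prop) (ae_of_all _ fun t => ?_)
    have hle : |φ t ^ 2 - 2 * φ t * φ' t| ≤ 2 * φ t ^ 2 + φ' t ^ 2 := by
      rw [abs_le]
      constructor <;> nlinarith [sq_nonneg (φ t - φ' t), sq_nonneg (φ t + φ' t)]
    rw [norm_mul, Real.norm_eq_abs, Real.norm_of_nonneg (Real.exp_pos _).le]
    calc _ ≤ (2 * φ t ^ 2 + φ' t ^ 2) * Real.exp (-t) := by gcongr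
      _ = _ := by simp only [Pi.add_apply]; ring
  have hder : ∀ t ∈ Ici (0 : ℝ), HasDerivAt (fun t => -(φ t ^ 2 * Real.exp (-t)))
      ((φ t ^ 2 - 2 * φ t * φ' t) * Real.exp (-t)) t := fun t _ => by
    have h1 : HasDerivAt (fun t : ℝ => Real.exp (-t)) (Real.exp (-t) * -1) t :=
      (hasDerivAt_neg t).exp
    refine (((hφ t).pow 2).mul h1).neg.congr_deriv ?_
    simp only [Pi.pow_apply]
    push_cast; ring
  have hlim : Tendsto (fun t => -(φ t ^ 2 * Real.exp (-t))) atTop (𝓝 0) := by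
    have h2 := (Real.tendsto_pow_mul_exp_neg_atTop_nhds_zero 2).const_mul (C ^ 2)
    rw [mul_zero] at h2
    rw [← neg_zero]
    refine Tendsto.neg (squeeze_zero (fun t => by positivity) (fun t => ?_) h2)
    rw [← mul_assoc]
    exact mul_le_mul_of_nonneg_right (hsq t) (Real.exp_pos _).le
  have hzero := integral_Ioi_of_hasDerivAt_of_tendsto' hder i3 hlim
  have hmono : ∫ t in Ioi 0, (1 / 2 * (φ t ^ 2 * Real.exp (-t)) - 2 * (φ' t ^ 2 * Real.exp (-t)))
      ≤ ∫ t in Ioi 0, (φ t ^ 2 - 2 * φ t * φ' t) * Real.exp (-t) := by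
    refine integral_mono ((i1.const_mul _).sub (i2.const_mul _)) i3 fun t => ?_
    have : 1 / 2 * φ t ^ 2 - 2 * φ' t ^ 2 ≤ φ t ^ 2 - 2 * φ t * φ' t := by
      nlinarith [sq_nonneg (φ t - 2 * φ' t)]
    have := mul_le_mul_of_nonneg_right this (Real.exp_pos (-t)).le
    simp only
    linarith
  rw [integral_sub (i1.const_mul _) (i2.const_mul _), integral_const_mul, integral_const_mul,
    hzero, h0] at hmono
  simp only [ne_eq, OfNat.ofNat_ne_zero, not_false_eq_true, zero_pow, zero_mul, neg_zero,
    sub_zero] at hmono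
  linarith

lemma laplace_poincare {φ φ' : ℝ → ℝ} {C : ℝ} (hφ : ∀ t, HasDerivAt φ (φ' t) t)
    (hc : Continuous φ') (hC : ∀ t, |φ' t| ≤ C) :
    ∫ t, (φ t - φ 0) ^ 2 ∂laplace ≤ 4 * ∫ t, φ' t ^ 2 ∂laplace := by
  obtain ⟨a1, a2, a3⟩ := exponential_poincare (φ := fun t => φ t - φ 0) (φ' := φ')
    (fun t => (hφ t).sub_const _) hc hC (by simp)
  obtain ⟨b1, b2, b3⟩ := exponential_poincare (φ := fun t => φ (-t) - φ 0)
    (φ' := fun t => -φ' (-t)) (C := C)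
    (fun t => by simpa using ((hφ (-t)).scomp t (hasDerivAt_neg t)).sub_const (φ 0))
    (by fun_prop) (fun t => by simpa using hC (-t)) (by simp)
  simp only [neg_sq] at b2 b3
  rw [(laplace_fold (g := fun t => (φ t - φ 0) ^ 2) a1 b1).2,
    (laplace_fold (g := fun t => φ' t ^ 2) a2 b2).2]
  linarith

end

/-! ### The Poincaré inequality in product form -/

section

open Set Filter Topology

/-- The law of `n` independent Laplace variables. -/
def laplacePi (n : ℕ) : Measure (Fin n → ℝ) := Measure.pi fun _ => laplace

instance (n : ℕ) : IsProbabilityMeasure (laplacePi n) := by unfold laplacePi; infer_instance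

lemma measurePreserving_cons (n : ℕ) :
    MeasurePreserving (fun z : ℝ × (Fin n → ℝ) => (Fin.cons z.1 z.2 : Fin (n + 1) → ℝ))
      (laplace.prod (laplacePi n)) (laplacePi (n + 1)) := by
  have h := (measurePreserving_piFinSuccAbove (fun _ : Fin (n + 1) => laplace) 0).symm
  have e : ⇑(MeasurableEquiv.piFinSuccAbove (fun _ : Fin (n + 1) => ℝ) 0).symm =
      fun z : ℝ × (Fin n → ℝ) => (Fin.cons z.1 z.2 : Fin (n + 1) → ℝ) := by
    funext z
    simp [MeasurableEquiv.piFinSuccAbove_symm_apply, Fin.insertNthEquiv]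
  rw [e] at h
  exact h

lemma measurableEmbedding_cons (n : ℕ) :
    MeasurableEmbedding (fun z : ℝ × (Fin n → ℝ) => (Fin.cons z.1 z.2 : Fin (n + 1) → ℝ)) := by
  have h := (MeasurableEquiv.piFinSuccAbove (fun _ : Fin (n + 1) => ℝ) 0).symm.measurableEmbedding
  convert h using 1
  funext z
  simp [MeasurableEquiv.piFinSuccAbove_symm_apply, Fin.insertNthEquiv]

lemma integral_laplacePi_succ {n : ℕ} (G : (Fin (n + 1) → ℝ) → ℝ) :
    ∫ w, G w ∂laplacePi (n + 1) =
      ∫ z : ℝ × (Fin n → ℝ), G (Fin.cons z.1 z.2) ∂laplace.prod (laplacePi n) :=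
  ((measurePreserving_cons n).integral_comp (measurableEmbedding_cons n) G).symm

lemma laplacePi_eval {n : ℕ} (i : Fin n) :
    MeasurePreserving (Function.eval i) (laplacePi n) laplace :=
  measurePreserving_eval (fun _ : Fin n => laplace) i

lemma memLp_of_lipschitz {n : ℕ} {F : (Fin n → ℝ) → ℝ} {C : NNReal} (hF : LipschitzWith C F) :
    MemLp F 2 (laplacePi n) := by
  have h1 : MemLp (fun w : Fin n → ℝ => |F 0| + C * ∑ i, |w i|) 2 (laplacePi n) := by
    have hi : ∀ i, MemLp (fun w : Fin n → ℝ => |w i|) 2 (laplacePi n) := fun i =>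
      laplace_memLp.abs.comp_measurePreserving (laplacePi_eval i)
    have hs : MemLp (fun w : Fin n → ℝ => ∑ i, |w i|) 2 (laplacePi n) :=
      memLp_finsetSum Finset.univ fun i _ => hi i
    exact (memLp_const |F 0|).add (hs.const_mul (C : ℝ))
  refine h1.mono hF.continuous.aestronglyMeasurable (ae_of_all _ fun w => ?_)
  rw [Real.norm_eq_abs, Real.norm_of_nonneg (by positivity)]
  have h2 := hF.dist_le_mul w 0
  rw [Real.dist_eq, dist_zero_right] at h2
  have h3 : ‖w‖ ≤ ∑ i, |w i| := by
    refine (pi_norm_le_iff_of_nonneg (Finset.sum_nonneg fun i _ => abs_nonneg _)).2 fun i => ?_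
    exact Finset.single_le_sum (f := fun i => |w i|) (fun i _ => abs_nonneg _) (Finset.mem_univ i)
  have h4 := abs_sub_abs_le_abs_sub (F w) (F 0)
  have h5 : (C : ℝ) * ‖w‖ ≤ C * ∑ i, |w i| := by gcongr
  linarith

lemma sq_integral_le {α : Type*} [MeasurableSpace α] {μ : Measure α} [IsProbabilityMeasure μ]
    {g : α → ℝ} (hg : MemLp g 2 μ) : (∫ a, g a ∂μ) ^ 2 ≤ ∫ a, g a ^ 2 ∂μ := by
  have h := variance_nonneg g μ
  rw [variance_eq_sub hg] at h
  simp only [Pi.pow_apply] at h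
  linarith

lemma cons_eq_add {n : ℕ} (x : ℝ) (y : Fin n → ℝ) :
    (Fin.cons x y : Fin (n + 1) → ℝ) = x • (Pi.single 0 1 : Fin (n + 1) → ℝ) + Fin.cons 0 y := by
  funext i
  refine Fin.cases ?_ (fun j => ?_) i <;> simp

/-- Prepending a zero coordinate, as a continuous linear map. -/
def consZero (n : ℕ) : (Fin n → ℝ) →L[ℝ] (Fin (n + 1) → ℝ) :=
  LinearMap.toContinuousLinearMap
    { toFun := fun y => Fin.cons 0 y
      map_add' := fun y z => by
        funext i; refine Fin.cases ?_ (fun j => ?_) i <;> simp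
      map_smul' := fun c y => by
        funext i; refine Fin.cases ?_ (fun j => ?_) i <;> simp }

lemma consZero_apply {n : ℕ} (y : Fin n → ℝ) : consZero n y = Fin.cons 0 y := rfl

lemma consZero_single {n : ℕ} (j : Fin n) :
    consZero n (Pi.single j 1) = Pi.single j.succ 1 := by
  rw [consZero_apply]
  funext i
  refine Fin.cases ?_ (fun k => ?_) i
  · simp
  · simp [Pi.single_apply, Fin.succ_inj]

lemma hasFDerivAt_cons_right {n : ℕ} {F : (Fin (n + 1) → ℝ) → ℝ} (hF : Differentiable ℝ F)
    (x : ℝ) (y : Fin n → ℝ) :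
    HasFDerivAt (fun y => F (Fin.cons x y)) ((fderiv ℝ F (Fin.cons x y)).comp (consZero n)) y := by
  refine HasFDerivAt.comp (g := F) y (hF _).hasFDerivAt ?_
  have : (fun y : Fin n → ℝ => (Fin.cons x y : Fin (n + 1) → ℝ)) =
      fun y => x • (Pi.single 0 1 : Fin (n + 1) → ℝ) + consZero n y := by
    funext y; rw [cons_eq_add, consZero_apply]
  change HasFDerivAt (fun y : Fin n → ℝ => (Fin.cons x y : Fin (n + 1) → ℝ)) _ _
  rw [this]
  exact (consZero n).hasFDerivAt.const_add _

lemma hasDerivAt_cons_left {n : ℕ} {F : (Fin (n + 1) → ℝ) → ℝ} (hF : Differentiable ℝ F)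
    (x : ℝ) (y : Fin n → ℝ) :
    HasDerivAt (fun x => F (Fin.cons x y)) (fderiv ℝ F (Fin.cons x y) (Pi.single 0 1)) x := by
  refine HasFDerivAt.comp_hasDerivAt (l := F) x (hF _).hasFDerivAt ?_
  have : (fun x : ℝ => (Fin.cons x y : Fin (n + 1) → ℝ)) =
      fun x => x • (Pi.single 0 1 : Fin (n + 1) → ℝ) + Fin.cons 0 y := by
    funext x; rw [cons_eq_add]
  rw [this]
  simpa using ((hasDerivAt_id x).smul_const (Pi.single 0 1 : Fin (n + 1) → ℝ)).add_const
    (Fin.cons 0 y : Fin (n + 1) → ℝ)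

lemma lipschitz_cons_right {n : ℕ} {F : (Fin (n + 1) → ℝ) → ℝ} {C : NNReal}
    (hF : LipschitzWith C F) (x : ℝ) : LipschitzWith C fun y => F (Fin.cons x y) := by
  refine LipschitzWith.of_dist_le_mul fun y z => (hF.dist_le_mul _ _).trans ?_
  gcongr
  refine (dist_pi_le_iff dist_nonneg).2 fun i => ?_
  refine Fin.cases ?_ (fun j => ?_) i
  · simp
  · simpa using dist_le_pi_dist y z j

lemma abs_fderiv_single_le {n : ℕ} {F : (Fin n → ℝ) → ℝ} {C : NNReal}
    (hF : LipschitzWith C F) (w : Fin n → ℝ) (i : Fin n) :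
    |fderiv ℝ F w (Pi.single i 1)| ≤ C := by
  have := (fderiv ℝ F w).le_of_opNorm_le (norm_fderiv_le_of_lipschitz ℝ hF (x₀ := w))
    (Pi.single i 1)
  simpa [Pi.norm_single] using this

/-- The Poincaré inequality for independent Laplace variables. In the induction, the variance is
split into the variance in the last `n` coordinates and that of the average over them, and the
latter is at most the mean square of the increments of `F` from `0` along the first coordinate. -/
theorem laplacePi_poincare {n : ℕ} {F : (Fin n → ℝ) → ℝ} (hF : ContDiff ℝ 1 F) {C : NNReal}
    (hL : LipschitzWith C F) :
    ∫ w, F w ^ 2 ∂laplacePi n ≤ (∫ w, F w ∂laplacePi n) ^ 2 +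
      4 * ∫ w, ∑ i, fderiv ℝ F w (Pi.single i 1) ^ 2 ∂laplacePi n := by
  induction n with
  | zero =>
    have : F = fun _ => F 0 := by funext w; rw [Subsingleton.elim w 0]
    rw [this]
    simp
  | succ n ih =>
    set μ := laplacePi n with hμ
    have hdiff : Differentiable ℝ F := hF.differentiable one_ne_zero
    have hcd : ∀ i, Continuous fun w => fderiv ℝ F w (Pi.single i 1) := fun i =>
      (hF.continuous_fderiv one_ne_zero).clm_apply continuous_const
    have hcons : Continuous fun z : ℝ × (Fin n → ℝ) => (Fin.cons z.1 z.2 : Fin (n + 1) → ℝ) := by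
      refine continuous_pi fun i => ?_
      refine Fin.cases ?_ (fun j => ?_) i
      · simp only [Fin.cons_zero]; fun_prop
      · simp only [Fin.cons_succ]; fun_prop
    have hconsL : ∀ y : Fin n → ℝ, Continuous fun x : ℝ => (Fin.cons x y : Fin (n + 1) → ℝ) :=
      fun y => hcons.comp (by fun_prop : Continuous fun x : ℝ => (x, y))
    -- square integrability
    have m1 : MemLp (fun z : ℝ × (Fin n → ℝ) => F (Fin.cons z.1 z.2)) 2 (laplace.prod μ) :=
      (memLp_of_lipschitz hL).comp_measurePreserving (measurePreserving_cons n)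
    have m2 : ∀ x, MemLp (fun y => F (Fin.cons x y)) 2 μ := fun x =>
      memLp_of_lipschitz (lipschitz_cons_right hL x)
    have m3 : MemLp (fun z : ℝ × (Fin n → ℝ) => F (Fin.cons 0 z.2)) 2 (laplace.prod μ) :=
      (m2 0).comp_measurePreserving measurePreserving_snd
    have i1 := m1.integrable_sq
    have i2 := (m1.sub m3).integrable_sq
    simp only [Pi.sub_apply] at i2
    have ib : ∀ i, Integrable (fun z : ℝ × (Fin n → ℝ) =>
        fderiv ℝ F (Fin.cons z.1 z.2) (Pi.single i 1) ^ 2) (laplace.prod μ) := fun i => by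
      refine Integrable.of_bound (((hcd i).comp hcons).pow 2).aestronglyMeasurable ((C : ℝ) ^ 2)
        (ae_of_all _ fun z => ?_)
      rw [norm_pow, Real.norm_eq_abs]
      exact pow_le_pow_left₀ (abs_nonneg _) (abs_fderiv_single_le hL _ i) 2
    have ibs := integrable_finsetSum Finset.univ fun (j : Fin n) _ => ib j.succ
    -- the average over the last coordinates
    set m : ℝ → ℝ := fun x => ∫ y, F (Fin.cons x y) ∂μ with hm
    have hm_le : ∀ x, (m x - m 0) ^ 2 ≤ ∫ y, (F (Fin.cons x y) - F (Fin.cons 0 y)) ^ 2 ∂μ := by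
      intro x
      rw [hm, ← integral_sub ((m2 x).integrable one_le_two) ((m2 0).integrable one_le_two)]
      exact sq_integral_le ((m2 x).sub (m2 0))
    have hm_meas : AEStronglyMeasurable m laplace :=
      m1.aestronglyMeasurable.integral_prod_right'
    have hm_memLp : MemLp m 2 laplace := by
      rw [memLp_two_iff_integrable_sq hm_meas]
      refine i1.integral_prod_left.mono' (hm_meas.pow 2) (ae_of_all _ fun x => ?_)
      rw [Real.norm_of_nonneg (sq_nonneg _)]
      exact sq_integral_le (m2 x)
    have hm_int : Integrable m laplace := hm_memLp.integrable one_le_two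
    have step1 : ∀ x, ∫ y, F (Fin.cons x y) ^ 2 ∂μ ≤ m x ^ 2 +
        4 * ∫ y, ∑ j : Fin n, fderiv ℝ F (Fin.cons x y) (Pi.single j.succ 1) ^ 2 ∂μ := by
      intro x
      have hcx : ContDiff ℝ 1 fun y => F (Fin.cons x y) := by
        have : (fun y : Fin n → ℝ => F (Fin.cons x y)) =
            fun y => F (x • (Pi.single 0 1 : Fin (n + 1) → ℝ) + consZero n y) := by
          funext y; rw [cons_eq_add, consZero_apply]
        rw [this]
        exact hF.comp (contDiff_const.add (consZero n).contDiff)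
      have h := ih hcx (lipschitz_cons_right hL x)
      refine h.trans_eq ?_
      congr 3
      funext y
      refine Finset.sum_congr rfl fun j _ => ?_
      rw [(hasFDerivAt_cons_right hdiff x y).fderiv, ContinuousLinearMap.comp_apply,
        consZero_single]
    have step2 : ∫ x, m x ^ 2 ∂laplace ≤ (∫ x, m x ∂laplace) ^ 2 +
        ∫ x, (m x - m 0) ^ 2 ∂laplace := by
      have e : ∫ x, (m x - m 0) ^ 2 ∂laplace =
          ∫ x, m x ^ 2 ∂laplace - 2 * m 0 * ∫ x, m x ∂laplace + m 0 ^ 2 := by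
        have : ∀ x, (m x - m 0) ^ 2 = m x ^ 2 - 2 * m 0 * m x + m 0 ^ 2 := fun x => by ring
        have hi : Integrable (fun x => m x ^ 2 - 2 * m 0 * m x) laplace :=
          hm_memLp.integrable_sq.sub (hm_int.const_mul _)
        simp_rw [this]
        rw [integral_add hi (integrable_const _),
          integral_sub hm_memLp.integrable_sq (hm_int.const_mul _), integral_const_mul]
        simp
      rw [e]
      nlinarith [sq_nonneg (∫ x, m x ∂laplace - m 0)]
    have step3 : ∫ x, (m x - m 0) ^ 2 ∂laplace ≤
        4 * ∫ z : ℝ × (Fin n → ℝ), fderiv ℝ F (Fin.cons z.1 z.2) (Pi.single 0 1) ^ 2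
          ∂laplace.prod μ := by
      calc ∫ x, (m x - m 0) ^ 2 ∂laplace
          ≤ ∫ x, ∫ y, (F (Fin.cons x y) - F (Fin.cons 0 y)) ^ 2 ∂μ ∂laplace :=
            integral_mono (hm_memLp.sub (memLp_const _)).integrable_sq i2.integral_prod_left hm_le
        _ = ∫ y, ∫ x, (F (Fin.cons x y) - F (Fin.cons 0 y)) ^ 2 ∂laplace ∂μ :=
            integral_integral_swap i2
        _ ≤ ∫ y, 4 * ∫ x, fderiv ℝ F (Fin.cons x y) (Pi.single 0 1) ^ 2 ∂laplace ∂μ := by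
            refine integral_mono i2.integral_prod_right ((ib 0).integral_prod_right.const_mul 4)
              fun y => ?_
            exact laplace_poincare (φ := fun x => F (Fin.cons x y))
              (fun x => hasDerivAt_cons_left hdiff x y) ((hcd 0).comp (hconsL y))
              (fun x => abs_fderiv_single_le hL _ 0)
        _ = _ := by
            rw [integral_const_mul, integral_prod_symm _ (ib 0)]
    have step4 : ∫ z : ℝ × (Fin n → ℝ), F (Fin.cons z.1 z.2) ^ 2 ∂laplace.prod μ ≤
        ∫ x, m x ^ 2 ∂laplace + 4 * ∫ z : ℝ × (Fin n → ℝ),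
          ∑ j : Fin n, fderiv ℝ F (Fin.cons z.1 z.2) (Pi.single j.succ 1) ^ 2 ∂laplace.prod μ := by
      rw [integral_prod _ i1, integral_prod _ ibs, ← integral_const_mul,
        ← integral_add hm_memLp.integrable_sq (ibs.integral_prod_left.const_mul 4)]
      exact integral_mono i1.integral_prod_left
        (hm_memLp.integrable_sq.add (ibs.integral_prod_left.const_mul 4)) step1
    rw [integral_laplacePi_succ, integral_laplacePi_succ, integral_laplacePi_succ]
    have e1 : ∫ z : ℝ × (Fin n → ℝ), F (Fin.cons z.1 z.2) ∂laplace.prod μ = ∫ x, m x ∂laplace :=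
      integral_prod _ (m1.integrable one_le_two)
    have e2 : ∫ z : ℝ × (Fin n → ℝ), ∑ i, fderiv ℝ F (Fin.cons z.1 z.2) (Pi.single i 1) ^ 2
          ∂laplace.prod μ =
        ∫ z : ℝ × (Fin n → ℝ), fderiv ℝ F (Fin.cons z.1 z.2) (Pi.single 0 1) ^ 2 ∂laplace.prod μ +
        ∫ z : ℝ × (Fin n → ℝ), ∑ j : Fin n, fderiv ℝ F (Fin.cons z.1 z.2) (Pi.single j.succ 1) ^ 2
          ∂laplace.prod μ := by
      rw [← integral_add (ib 0) ibs]
      simp_rw [Fin.sum_univ_succ]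
    rw [e1, e2]
    linarith

end

/-! ### The faces of the `ℓ_1`-sphere as graphs over the coordinate hyperplanes -/

section

open Set Filter Topology

/-- The point of the `ℓ_1`-sphere that lies above (`σ = 1`) or below (`σ = -1`) the point `u` of the
`ℓ_1`-ball of the hyperplane orthogonal to the `i`-th axis. -/
def face {n : ℕ} (i : Fin (n + 1)) (σ : ℝ) (u : Fin n → ℝ) : Vec (n + 1) :=
  WithLp.toLp 2 (i.insertNth (σ * (1 - ∑ j, |u j|)) u)

section
variable {n : ℕ} (i : Fin (n + 1))

@[simp] lemma face_same (σ : ℝ) (u : Fin n → ℝ) : face i σ u i = σ * (1 - ∑ j, |u j|) := by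
  simp [face]

@[simp] lemma face_succAbove (σ : ℝ) (u : Fin n → ℝ) (j : Fin n) :
    face i σ u (i.succAbove j) = u j := by
  simp [face]

lemma continuous_toLp_insertNth {α : Type*} [TopologicalSpace α] {a : α → ℝ} {b : α → Fin n → ℝ}
    (ha : Continuous a) (hb : Continuous b) :
    Continuous fun x => (WithLp.toLp 2 (i.insertNth (a x) (b x)) : Vec (n + 1)) := by
  refine (PiLp.continuous_toLp 2 _).comp (continuous_pi fun k => ?_)
  obtain rfl | ⟨j, rfl⟩ := i.eq_self_or_eq_succAbove k
  · simpa using ha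
  · simp only [Fin.insertNth_apply_succAbove]
    exact (continuous_apply j).comp hb

lemma face_continuous (σ : ℝ) : Continuous (face i σ) :=
  continuous_toLp_insertNth i (by fun_prop) continuous_id

lemma face_injective (σ : ℝ) : Function.Injective (face i σ) := fun u v h => by
  funext j
  have := congrArg (fun w : Vec (n + 1) => w (i.succAbove j)) h
  simpa using this

/-- The linear graph map `u ↦ (⟨c, u⟩, u)`, with the value in the `i`-th coordinate. -/
def graphMap (c : Fin n → ℝ) : Vec n →ₗ[ℝ] Vec (n + 1) where
  toFun u := WithLp.toLp 2 (i.insertNth (∑ j, c j * u j) (fun j => u j))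
  map_add' u v := by
    ext k
    obtain rfl | ⟨j, rfl⟩ := i.eq_self_or_eq_succAbove k
    · simp [mul_add, Finset.sum_add_distrib]
    · simp
  map_smul' r u := by
    ext k
    obtain rfl | ⟨j, rfl⟩ := i.eq_self_or_eq_succAbove k
    · simp only [PiLp.smul_apply, smul_eq_mul, Fin.insertNth_apply_same, RingHom.id_apply,
        Finset.mul_sum]
      exact Finset.sum_congr rfl fun j _ => by ring
    · simp

@[simp] lemma graphMap_same (c : Fin n → ℝ) (u : Vec n) :
    graphMap i c u i = ∑ j, c j * u j := by
  simp [graphMap]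

@[simp] lemma graphMap_succAbove (c : Fin n → ℝ) (u : Vec n) (j : Fin n) :
    graphMap i c u (i.succAbove j) = u j := by
  simp [graphMap]

/-- The area factor of a graph with slopes `±1`: the Gram matrix of the images of the standard basis
is `1 + c cᵀ`, of determinant `1 + ⟨c, c⟩`. -/
lemma graphMap_normDet {c : Fin n → ℝ} (hc : ∀ j, c j ^ 2 = 1) :
    (graphMap i c).normDet = √((n : ℝ) + 1) := by
  have h := (graphMap i c).normDet_sq_eq_det_gram (EuclideanSpace.basisFun (Fin n) ℝ)
  have hg : Matrix.gram ℝ (fun x => graphMap i c (EuclideanSpace.basisFun (Fin n) ℝ x)) =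
      1 + Matrix.replicateCol Unit c * Matrix.replicateRow Unit c := by
    ext j k
    rw [Matrix.gram, Matrix.of_apply, PiLp.inner_apply, Fin.sum_univ_succAbove _ i]
    simp [Matrix.mul_apply, Matrix.one_apply]
    ring
  rw [hg, Matrix.det_one_add_replicateCol_mul_replicateRow] at h
  have hs : c ⬝ᵥ c = n := by
    simp [dotProduct, ← pow_two, hc]
  rw [hs] at h
  have h' : (graphMap i c).normDet ^ 2 = 1 + n := by exact_mod_cast h
  rw [← Real.sqrt_sq (LinearMap.normDet_nonneg _), h', add_comm]

/-- The constant by which the surface measure of a face exceeds the Lebesgue measure of its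
projection to a coordinate hyperplane. -/
def faceConst (n : ℕ) : ℝ≥0∞ :=
  ENNReal.ofReal √((n : ℝ) + 1) *
    (Measure.addHaarScalarFactor (μH[(n : ℝ)] : Measure (Vec n)) volume : NNReal)

lemma hausdorffMeasure_graphMap {c : Fin n → ℝ} (hc : ∀ j, c j ^ 2 = 1) {E : Set (Fin n → ℝ)}
    (hE : MeasurableSet E) :
    μH[(n : ℝ)] ((fun u => graphMap i c (WithLp.toLp 2 u)) '' E) = faceConst n * volume E := by
  have hfr : Module.finrank ℝ (Vec n) = n := by simp
  have h1 := (graphMap i c).hausdorffMeasure_image (WithLp.toLp 2 '' E)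
  rw [hfr, image_image, graphMap_normDet i hc] at h1
  have hH : (μH[(n : ℝ)] : Measure (Vec n)).IsAddHaarMeasure := by
    have := isAddHaarMeasure_hausdorffMeasure (E := Vec n)
    rwa [hfr] at this
  have h2 := congrArg (fun μ : Measure (Vec n) => μ (WithLp.toLp 2 '' E))
    (Measure.isAddLeftInvariant_eq_smul (μH[(n : ℝ)] : Measure (Vec n)) volume)
  have h3 : (volume : Measure (Vec n)) (WithLp.toLp 2 '' E) = volume E := by
    have e : (WithLp.toLp 2 '' E : Set (Vec n)) = (WithLp.ofLp : Vec n → Fin n → ℝ) ⁻¹' E := by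
      ext x
      constructor
      · rintro ⟨u, hu, rfl⟩; exact hu
      · intro hx; exact ⟨WithLp.ofLp x, hx, rfl⟩
    rw [e]
    exact (PiLp.volume_preserving_ofLp (Fin n)).measure_preimage hE.nullMeasurableSet
  rw [h1, h2, Measure.smul_apply, h3, faceConst, mul_assoc]
  rfl

/-- On each orthant `face i σ` is, up to a translation, one of the maps `graphMap`. -/
lemma hausdorffMeasure_face {σ : ℝ} (hσ : σ ^ 2 = 1) {E : Set (Fin n → ℝ)}
    (hE : MeasurableSet E) :
    μH[(n : ℝ)] (face i σ '' E) = faceConst n * volume E := by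
  set O : (Fin n → Bool) → Set (Fin n → ℝ) := fun b => {u | ∀ j, (0 ≤ u j ↔ b j = true)} with hO
  have hOm : ∀ b, MeasurableSet (O b) := fun b => by
    have : O b = ⋂ j, {u : Fin n → ℝ | (0 ≤ u j ↔ b j = true)} := by ext u; simp [hO]
    rw [this]
    refine MeasurableSet.iInter fun j => ?_
    have h0 : MeasurableSet {u : Fin n → ℝ | 0 ≤ u j} := measurableSet_le (by fun_prop) (by fun_prop)
    cases hb : b j
    · simpa using measurableSet_lt (f := fun u : Fin n → ℝ => u j) (g := fun _ => (0 : ℝ))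
        (by fun_prop) (by fun_prop)
    · simpa using h0
  have hun : E = ⋃ b, E ∩ O b := by
    ext u
    simp only [mem_iUnion, mem_inter_iff]
    constructor
    · intro hu; exact ⟨fun j => decide (0 ≤ u j), hu, fun j => by simp⟩
    · rintro ⟨b, hu, -⟩; exact hu
  have hdisj : Pairwise (Function.onFun Disjoint fun b => E ∩ O b) := by
    intro b b' hbb
    refine Set.disjoint_left.2 fun u hu hu' => hbb ?_
    funext j
    rw [Bool.eq_iff_iff, ← hu.2 j, ← hu'.2 j]
  have piece : ∀ b, μH[(n : ℝ)] (face i σ '' (E ∩ O b)) = faceConst n * volume (E ∩ O b) := by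
    intro b
    set c : Fin n → ℝ := fun j => -σ * (if b j then 1 else -1) with hc
    have hc2 : ∀ j, c j ^ 2 = 1 := fun j => by
      simp only [hc]; split_ifs <;> simp [hσ]
    rw [← hausdorffMeasure_graphMap i hc2 (hE.inter (hOm b))]
    set p : Vec (n + 1) := WithLp.toLp 2 (i.insertNth σ (fun _ => (0 : ℝ))) with hp
    have e : face i σ '' (E ∩ O b) = (IsometryEquiv.addLeft p) ''
        ((fun u => graphMap i c (WithLp.toLp 2 u)) '' (E ∩ O b)) := by
      rw [image_image]
      refine image_congr fun u hu => ?_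
      ext k
      obtain rfl | ⟨j, rfl⟩ := i.eq_self_or_eq_succAbove k
      · have habs : ∀ j, |u j| = (if b j then 1 else -1) * u j := fun j => by
          have := hu.2 j
          split_ifs with hb
          · rw [abs_of_nonneg (this.2 hb), one_mul]
          · rw [abs_of_neg (not_le.1 fun h => hb (this.1 h))]; ring
        simp only [face_same, IsometryEquiv.addLeft_apply, PiLp.add_apply, hp, graphMap_same,
          Fin.insertNth_apply_same, habs, hc, mul_assoc, ← Finset.mul_sum]
        ring
      · simp [hp]
    rw [e, IsometryEquiv.hausdorffMeasure_image]
  have hmeas : ∀ b, MeasurableSet (face i σ '' (E ∩ O b)) := fun b =>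
    (hE.inter (hOm b)).image_of_continuousOn_injOn (face_continuous i σ).continuousOn
      (face_injective i σ).injOn
  have hdisj' : Pairwise (Function.onFun Disjoint fun b => face i σ '' (E ∩ O b)) :=
    fun b b' hbb => (disjoint_image_iff (face_injective i σ)).2 (hdisj hbb)
  conv_lhs => rw [hun, image_iUnion]
  conv_rhs => rw [hun]
  rw [measure_iUnion hdisj' hmeas, measure_iUnion hdisj fun b => hE.inter (hOm b)]
  simp_rw [piece]
  rw [ENNReal.tsum_mul_left]

/-- The open unit ball of the `ℓ_1`-norm, as a set of functions. -/
def ell1Ball (n : ℕ) : Set (Fin n → ℝ) := {u | ∑ j, |u j| < 1}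

lemma measurableSet_ell1Ball (n : ℕ) : MeasurableSet (ell1Ball n) :=
  measurableSet_lt (by fun_prop) (by fun_prop)

lemma ell1Ball_ae_eq (hn : 0 < n) :
    ({u : Fin n → ℝ | ∑ j, |u j| ≤ 1} : Set (Fin n → ℝ)) =ᵐ[volume] ell1Ball n := by
  have : Nonempty (Fin n) := ⟨⟨0, hn⟩⟩
  have h := measure_le_eq_lt (volume : Measure (Fin n → ℝ)) (g := fun u => ∑ j, |u j|)
    (by simp) (by simp)
    (fun x y => by
      rw [← Finset.sum_add_distrib]
      exact Finset.sum_le_sum fun j _ => abs_add_le _ _)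
    (fun {x} hx => by
      rw [Finset.sum_eq_zero_iff_of_nonneg fun j _ => abs_nonneg _] at hx
      funext j; simpa using hx j (Finset.mem_univ j))
    (fun r x => by simp [abs_mul, Finset.mul_sum]) 1
  have hsub : ell1Ball n ⊆ {u : Fin n → ℝ | ∑ j, |u j| ≤ 1} := fun u hu => by
    have h : ∑ j, |u j| < 1 := hu
    exact h.le
  have hfin : volume {u : Fin n → ℝ | ∑ j, |u j| ≤ 1} ≠ ∞ := by
    have : {u : Fin n → ℝ | ∑ j, |u j| ≤ 1} ⊆ Metric.closedBall 0 1 := fun u hu => by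
      rw [mem_closedBall_zero_iff, pi_norm_le_iff_of_nonneg zero_le_one]
      exact fun j => (Finset.single_le_sum (f := fun j => |u j|) (fun _ _ => abs_nonneg _)
        (Finset.mem_univ j)).trans hu
    exact ((measure_mono this).trans_lt measure_closedBall_lt_top).ne
  exact (ae_eq_of_subset_of_measure_ge hsub h.le
    (measurableSet_ell1Ball n).nullMeasurableSet hfin).symm

lemma measurableSet_ell1Sphere (d : ℕ) : MeasurableSet (ell1Sphere d) :=
  ((isClosed_singleton (x := (1 : ℝ))).preimage (ellNorm_continuous le_rfl)).measurableSet

lemma ell1Sphere_inter_nonneg :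
    ell1Sphere (n + 1) ∩ {w | 0 ≤ w i} = face i 1 '' {u | ∑ j, |u j| ≤ 1} := by
  ext w
  simp only [ell1Sphere, mem_inter_iff, mem_ofPred_eq, mem_image, ellNorm_one,
    Fin.sum_univ_succAbove _ i]
  constructor
  · rintro ⟨h1, h2⟩
    rw [abs_of_nonneg h2] at h1
    refine ⟨fun j => w (i.succAbove j), by linarith, ?_⟩
    ext k
    obtain rfl | ⟨j, rfl⟩ := i.eq_self_or_eq_succAbove k
    · simp; linarith
    · simp
  · rintro ⟨u, hu, rfl⟩
    have : 0 ≤ 1 - ∑ j, |u j| := by linarith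
    simp [abs_of_nonneg this, hu]

lemma ell1Sphere_inter_neg :
    ell1Sphere (n + 1) ∩ {w | ¬ 0 ≤ w i} = face i (-1) '' ell1Ball n := by
  ext w
  simp only [ell1Sphere, mem_inter_iff, mem_ofPred_eq, mem_image, ellNorm_one,
    Fin.sum_univ_succAbove _ i, ell1Ball, not_le]
  constructor
  · rintro ⟨h1, h2⟩
    rw [abs_of_neg h2] at h1
    refine ⟨fun j => w (i.succAbove j), by linarith, ?_⟩
    ext k
    obtain rfl | ⟨j, rfl⟩ := i.eq_self_or_eq_succAbove k
    · simp; linarith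
    · simp
  · rintro ⟨u, hu, rfl⟩
    have : 0 < 1 - ∑ j, |u j| := by linarith
    simp [abs_of_pos this, hu, -neg_sub]

/-- The pushforward of Lebesgue measure on the unit ball of the hyperplane orthogonal to the `i`-th
axis to the two halves of the `ℓ_1`-sphere. -/
def projMeasure : Measure (Vec (n + 1)) :=
  (volume.restrict (ell1Ball n)).map (face i 1) + (volume.restrict (ell1Ball n)).map (face i (-1))

/-- The surface measure of the `ℓ_1`-sphere is a multiple of the measure given by the projection
along any axis. -/
lemma hausdorffMeasure_restrict_ell1Sphere (hn : 0 < n) :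
    (μH[(n : ℝ)] : Measure (Vec (n + 1))).restrict (ell1Sphere (n + 1)) =
      faceConst n • projMeasure i := by
  ext A hA
  have hpos : MeasurableSet {w : Vec (n + 1) | 0 ≤ w i} :=
    measurableSet_le (by fun_prop) (by fun_prop)
  have hA' : ∀ σ, MeasurableSet (face i σ ⁻¹' A) := fun σ => (face_continuous i σ).measurable hA
  have hle : MeasurableSet {u : Fin n → ℝ | ∑ j, |u j| ≤ 1} :=
    measurableSet_le (by fun_prop) (by fun_prop)
  rw [Measure.restrict_apply hA, ← measure_inter_add_sdiff _ hpos, projMeasure, Measure.smul_apply,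
    Measure.add_apply, Measure.map_apply (face_continuous i 1).measurable hA,
    Measure.map_apply (face_continuous i (-1)).measurable hA,
    Measure.restrict_apply (hA' _), Measure.restrict_apply (hA' _), smul_eq_mul, mul_add]
  congr 1
  · rw [inter_assoc, ell1Sphere_inter_nonneg, inter_comm, ← image_inter_preimage,
      hausdorffMeasure_face i (by norm_num) (hle.inter (hA' _)), inter_comm]
    congr 1
    exact measure_congr ((ae_eq_refl _).inter (ell1Ball_ae_eq hn))
  · rw [sdiff_eq, inter_assoc, show ({w : Vec (n + 1) | 0 ≤ w i})ᶜ = {w | ¬ 0 ≤ w i} from rfl,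
      ell1Sphere_inter_neg, inter_comm, ← image_inter_preimage,
      hausdorffMeasure_face i (by norm_num) ((measurableSet_ell1Ball n).inter (hA' _)), inter_comm]

end

/-- A probability measure on `ℝ^{n+1}` that is `c` times `projMeasure i` for every axis `i`: the form
in which the uniform law on the `ℓ_1`-sphere is used. -/
structure IsUniformEll1 {n : ℕ} (ν : Measure (Vec (n + 1))) (c : ℝ≥0∞) : Prop where
  prob : IsProbabilityMeasure ν
  pos : 0 < n
  ne_zero : c ≠ 0
  ne_top : c ≠ ∞
  eq_proj : ∀ i, ν = c • projMeasure i

lemma projMeasure_univ {n : ℕ} (i : Fin (n + 1)) :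
    projMeasure i univ = 2 * volume (ell1Ball n) := by
  rw [projMeasure, Measure.add_apply, Measure.map_apply (face_continuous i 1).measurable .univ,
    Measure.map_apply (face_continuous i (-1)).measurable .univ]
  simp [two_mul]

/-- Finiteness and positivity of the surface measure need no separate proof: they are forced by the
normalized measure being a law, of total mass one. -/
lemma exists_isUniformEll1 {n : ℕ} (hn : 0 < n) {Ω : Type*} [MeasurableSpace Ω] {P : Measure Ω}
    [IsProbabilityMeasure P] {X : Ω → Vec (n + 1)} (hX : Measurable X)
    (h : IsUniformOnEll1Sphere P X) : ∃ c, IsUniformEll1 (P.map X) c := by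
  have hp : IsProbabilityMeasure (P.map X) := Measure.isProbabilityMeasure_map hX.aemeasurable
  have he : ∀ i, P.map X = ((μH[(n : ℝ)] (ell1Sphere (n + 1)))⁻¹ * faceConst n) •
      projMeasure i := fun i => by
    have h' : P.map X = ProbabilityTheory.cond μH[((n + 1 : ℕ) : ℝ) - 1] (ell1Sphere (n + 1)) := h
    have e : ((n + 1 : ℕ) : ℝ) - 1 = n := by push_cast; ring
    rw [h', ProbabilityTheory.cond, e, hausdorffMeasure_restrict_ell1Sphere i hn, smul_smul]
  have h1 : 1 = ((μH[(n : ℝ)] (ell1Sphere (n + 1)))⁻¹ * faceConst n) *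
      (2 * volume (ell1Ball n)) := by
    rw [← projMeasure_univ 0, ← smul_eq_mul, ← Measure.smul_apply, ← he 0, measure_univ]
  refine ⟨_, hp, hn, ?_, ?_, he⟩
  · intro h0; rw [h0] at h1; simp at h1
  · intro h0
    rw [h0] at h1
    rcases eq_or_ne (2 * volume (ell1Ball n)) 0 with h2 | h2
    · rw [h2] at h1; simp at h1
    · rw [ENNReal.top_mul h2] at h1; simp at h1

end

/-! ### Polar coordinates for the `ℓ_1`-norm -/

section

open Set Filter Topology

section
variable {n : ℕ}

lemma volume_preserving_insertNth (i : Fin (n + 1)) :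
    MeasurePreserving (fun z : ℝ × (Fin n → ℝ) => (i.insertNth z.1 z.2 : Fin (n + 1) → ℝ)) := by
  have h := (volume_preserving_piFinSuccAbove (fun _ : Fin (n + 1) => ℝ) i).symm
  have e : ⇑(MeasurableEquiv.piFinSuccAbove (fun _ : Fin (n + 1) => ℝ) i).symm =
      fun z : ℝ × (Fin n → ℝ) => (i.insertNth z.1 z.2 : Fin (n + 1) → ℝ) := by
    funext z
    simp [MeasurableEquiv.piFinSuccAbove_symm_apply, Fin.insertNthEquiv]
  rwa [e] at h

lemma lintegral_projMeasure (i : Fin (n + 1)) {Φ : Vec (n + 1) → ℝ≥0∞} (hΦ : Measurable Φ) :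
    ∫⁻ s, Φ s ∂projMeasure i =
      (∫⁻ u in ell1Ball n, Φ (face i 1 u)) + ∫⁻ u in ell1Ball n, Φ (face i (-1) u) := by
  rw [projMeasure, lintegral_add_measure, lintegral_map hΦ (face_continuous i 1).measurable,
    lintegral_map hΦ (face_continuous i (-1)).measurable]

lemma face_mem_ell1Sphere (i : Fin (n + 1)) {σ : ℝ} (hσ : |σ| = 1) {u : Fin n → ℝ}
    (hu : u ∈ ell1Ball n) : face i σ u ∈ ell1Sphere (n + 1) := by
  have hu' : ∑ j, |u j| < 1 := hu
  have : 0 ≤ 1 - ∑ j, |u j| := by linarith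
  change ellNorm 1 (face i σ u) = 1
  rw [ellNorm_one, Fin.sum_univ_succAbove _ i]
  simp [abs_mul, hσ, abs_of_nonneg this]

lemma IsUniformEll1.ae_mem {ν : Measure (Vec (n + 1))} {c : ℝ≥0∞} (h : IsUniformEll1 ν c) :
    ∀ᵐ s ∂ν, s ∈ ell1Sphere (n + 1) := by
  rw [h.eq_proj 0, Measure.ae_ennreal_smul_measure_iff h.ne_zero, projMeasure, ae_add_measure_iff]
  have hS := measurableSet_ell1Sphere (n + 1)
  refine ⟨?_, ?_⟩
  · refine (ae_map_iff (face_continuous 0 1).aemeasurable hS).2 ?_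
    filter_upwards [ae_restrict_mem (measurableSet_ell1Ball n)] with u hu
    exact face_mem_ell1Sphere 0 (by simp) hu
  · refine (ae_map_iff (face_continuous 0 (-1)).aemeasurable hS).2 ?_
    filter_upwards [ae_restrict_mem (measurableSet_ell1Ball n)] with u hu
    exact face_mem_ell1Sphere 0 (by simp) hu

lemma lintegral_scale {r : ℝ} (hr : 0 < r) {g : (Fin n → ℝ) → ℝ≥0∞} (hg : Measurable g) :
    ∫⁻ u, g u = ENNReal.ofReal (r ^ n) * ∫⁻ v, g (r • v) := by
  have h := Measure.map_addHaar_smul (volume : Measure (Fin n → ℝ)) hr.ne'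
  rw [← lintegral_map hg (measurable_const_smul r), h, lintegral_smul_measure, smul_eq_mul,
    ← mul_assoc]
  have : (0:ℝ) < r ^ n := by positivity
  simp only [Module.finrank_fintype_fun_eq_card, Fintype.card_fin, abs_inv, abs_of_pos this]
  rw [← ENNReal.ofReal_mul this.le, mul_inv_cancel₀ this.ne', ENNReal.ofReal_one, one_mul]

/-- Integration over the half-space `σ w_i > 0`: translating the `i`-th coordinate by the
`ℓ_1`-norm of the others turns it into the radius. -/
lemma lintegral_halfspace (i : Fin (n + 1)) (σ : ℝ) {F : Vec (n + 1) → ℝ≥0∞} (hF : Measurable F) :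
    ∫⁻ u : Fin n → ℝ, ∫⁻ t in Ioi (0 : ℝ), F (WithLp.toLp 2 (i.insertNth (σ * t) u)) =
      ∫⁻ r in Ioi (0 : ℝ), ENNReal.ofReal (r ^ n) *
        ∫⁻ v in ell1Ball n, F (r • face i σ v) := by
  set G : ℝ → (Fin n → ℝ) → ℝ≥0∞ := fun r u =>
    (Ioi (∑ j, |u j|)).indicator
      (fun r => F (WithLp.toLp 2 (i.insertNth (σ * (r - ∑ j, |u j|)) u))) r with hG
  have hGm : Measurable fun z : ℝ × (Fin n → ℝ) => G z.1 z.2 := by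
    have hc : Continuous fun z : ℝ × (Fin n → ℝ) =>
        (WithLp.toLp 2 (i.insertNth (σ * (z.1 - ∑ j, |z.2 j|)) z.2) : Vec (n + 1)) :=
      continuous_toLp_insertNth i (by fun_prop) (by fun_prop)
    have hm : MeasurableSet {z : ℝ × (Fin n → ℝ) | ∑ j, |z.2 j| < z.1} :=
      measurableSet_lt (by fun_prop) (by fun_prop)
    exact (hF.comp hc.measurable).indicator hm
  have h1 : ∀ u : Fin n → ℝ,
      ∫⁻ t in Ioi (0 : ℝ), F (WithLp.toLp 2 (i.insertNth (σ * t) u)) = ∫⁻ r, G r u := by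
    intro u
    rw [← lintegral_indicator measurableSet_Ioi, ← lintegral_sub_right_eq_self _ (∑ j, |u j|)]
    refine lintegral_congr fun r => ?_
    simp [hG, indicator_apply]
  simp_rw [h1]
  rw [lintegral_lintegral_swap (f := fun u r => G r u)
    (hGm.comp measurable_swap).aemeasurable, ← lintegral_indicator measurableSet_Ioi]
  refine lintegral_congr fun r => ?_
  by_cases hr : 0 < r
  · have hGr : Measurable (G r) :=
      hGm.comp (by fun_prop : Measurable fun u : Fin n → ℝ => (r, u))
    rw [indicator_of_mem (mem_Ioi.2 hr), lintegral_scale hr hGr,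
      ← lintegral_indicator (measurableSet_ell1Ball n)]
    congr 1
    refine lintegral_congr fun v => ?_
    have hs : ∑ j, |(r • v) j| = r * ∑ j, |v j| := by
      simp [abs_mul, abs_of_pos hr, Finset.mul_sum]
    simp only [hG, indicator_apply, mem_Ioi, hs]
    have hiff : (r * ∑ j, |v j| < r) ↔ v ∈ ell1Ball n := by
      change _ ↔ ∑ j, |v j| < 1
      constructor
      · intro h; by_contra h'; nlinarith [not_lt.1 h']
      · intro h; nlinarith
    by_cases hv : v ∈ ell1Ball n
    · rw [indicator_of_mem hv, if_pos (hiff.2 hv)]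
      congr 1
      ext k
      obtain rfl | ⟨j, rfl⟩ := i.eq_self_or_eq_succAbove k
      · simp; ring
      · simp
    · rw [indicator_of_notMem hv, if_neg (fun h => hv (hiff.1 h))]
  · rw [indicator_of_notMem (by simpa using hr)]
    have : ∀ u, G r u = 0 := fun u => by
      have h0 : 0 ≤ ∑ j, |u j| := Finset.sum_nonneg fun j _ => abs_nonneg _
      exact indicator_of_notMem (fun h => hr (h0.trans_lt h)) _
    simp [this]

lemma lintegral_real_fold {g : ℝ → ℝ≥0∞} (hg : Measurable g) :
    ∫⁻ t, g t = (∫⁻ t in Ioi (0 : ℝ), g (1 * t)) + ∫⁻ t in Ioi (0 : ℝ), g (-1 * t) := by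
  rw [← lintegral_add_compl g (measurableSet_Ioi (a := (0 : ℝ)))]
  simp only [one_mul, compl_Ioi, neg_one_mul]
  congr 1
  rw [setLIntegral_congr Iio_ae_eq_Iic.symm,
    ← (Measure.measurePreserving_neg (volume : Measure ℝ)).setLIntegral_comp_preimage
    measurableSet_Iio hg]
  simp

/-- Polar coordinates for the `ℓ_1`-norm. -/
lemma IsUniformEll1.polar {ν : Measure (Vec (n + 1))} {c : ℝ≥0∞} (h : IsUniformEll1 ν c)
    {F : Vec (n + 1) → ℝ≥0∞} (hF : Measurable F) :
    c * ∫⁻ w : Fin (n + 1) → ℝ, F (WithLp.toLp 2 w) =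
      ∫⁻ r in Ioi (0 : ℝ), ENNReal.ofReal (r ^ n) * ∫⁻ s, F (r • s) ∂ν := by
  have hFm : ∀ r : ℝ, Measurable fun s : Vec (n + 1) => F (r • s) := fun r =>
    hF.comp (measurable_const_smul r)
  have e : ∀ r : ℝ, ∫⁻ s, F (r • s) ∂ν = c * ((∫⁻ u in ell1Ball n, F (r • face 0 1 u)) +
      ∫⁻ u in ell1Ball n, F (r • face 0 (-1) u)) := fun r => by
    rw [h.eq_proj 0, lintegral_smul_measure, lintegral_projMeasure 0 (hFm r), smul_eq_mul]
  have hm : ∀ σ : ℝ, Measurable fun r : ℝ =>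
      ENNReal.ofReal (r ^ n) * ∫⁻ u in ell1Ball n, F (r • face 0 σ u) := fun σ => by
    refine Measurable.mul (by fun_prop) (Measurable.lintegral_prod_right' (f := fun z : ℝ × _ =>
      F (z.1 • face 0 σ z.2)) (hF.comp ?_))
    exact (continuous_fst.smul ((face_continuous 0 σ).comp continuous_snd)).measurable
  have hG : Measurable fun w : Fin (n + 1) → ℝ => F (WithLp.toLp 2 w) :=
    hF.comp (by fun_prop)
  have hins : Continuous fun z : ℝ × (Fin n → ℝ) =>
      (WithLp.toLp 2 ((0 : Fin (n + 1)).insertNth z.1 z.2) : Vec (n + 1)) :=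
    continuous_toLp_insertNth 0 continuous_fst continuous_snd
  rw [← (volume_preserving_insertNth (0 : Fin (n + 1))).lintegral_comp hG]
  have hFi : Measurable fun z : ℝ × (Fin n → ℝ) =>
      F (WithLp.toLp 2 ((0 : Fin (n + 1)).insertNth z.1 z.2)) := hF.comp hins.measurable
  rw [Measure.volume_eq_prod, lintegral_prod_symm _ hFi.aemeasurable]
  have hu : ∀ u : Fin n → ℝ, Measurable fun t : ℝ =>
      F (WithLp.toLp 2 ((0 : Fin (n + 1)).insertNth t u)) := fun u =>
    hF.comp (hins.comp (by fun_prop : Continuous fun t : ℝ => (t, u))).measurable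
  have hsplit : ∀ u : Fin n → ℝ, ∫⁻ t, F (WithLp.toLp 2 ((0 : Fin (n + 1)).insertNth t u)) =
      (∫⁻ t in Ioi (0 : ℝ), F (WithLp.toLp 2 ((0 : Fin (n + 1)).insertNth (1 * t) u))) +
      ∫⁻ t in Ioi (0 : ℝ), F (WithLp.toLp 2 ((0 : Fin (n + 1)).insertNth (-1 * t) u)) :=
    fun u => lintegral_real_fold (hu u)
  simp_rw [hsplit]
  rw [lintegral_add_left, lintegral_halfspace 0 1 hF, lintegral_halfspace 0 (-1) hF,
    ← lintegral_add_left (hm 1), ← lintegral_const_mul' _ _ h.ne_top]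
  · refine lintegral_congr fun r => ?_
    rw [e]; ring
  · refine Measurable.lintegral_prod_right' (f := fun z : (Fin n → ℝ) × ℝ =>
      F (WithLp.toLp 2 ((0 : Fin (n + 1)).insertNth (1 * z.2) z.1))) (hF.comp ?_)
    exact (continuous_toLp_insertNth 0 (by fun_prop) continuous_fst).measurable

/-- The density of `n` independent Laplace variables. -/
def laplaceDensity (n : ℕ) (w : Fin n → ℝ) : ℝ≥0∞ :=
  ENNReal.ofReal (Real.exp (-∑ i, |w i|) / 2 ^ n)

lemma measurable_laplaceDensity (n : ℕ) : Measurable (laplaceDensity n) := by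
  unfold laplaceDensity; fun_prop

lemma laplacePi_eq_withDensity (n : ℕ) :
    laplacePi n = volume.withDensity (laplaceDensity n) := by
  induction n with
  | zero =>
    have : laplaceDensity 0 = 1 := by funext w; simp [laplaceDensity]
    rw [this, withDensity_one, laplacePi, volume_pi, Measure.pi_of_empty, Measure.pi_of_empty]
  | succ n ih =>
    refine Measure.ext_of_lintegral _ fun φ hφ => ?_
    have hcons : MeasurePreserving (fun z : ℝ × (Fin n → ℝ) =>
        (Fin.cons z.1 z.2 : Fin (n + 1) → ℝ)) := by
      simpa using volume_preserving_insertNth (0 : Fin (n + 1))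
    have hD := measurable_laplaceDensity n
    have hρ : Measurable fun z : ℝ × (Fin n → ℝ) =>
        ENNReal.ofReal (Real.exp (-|z.1|) / 2) * laplaceDensity n z.2 := by fun_prop
    have hφ' : Measurable fun z : ℝ × (Fin n → ℝ) => φ (Fin.cons z.1 z.2) :=
      hφ.comp hcons.measurable
    rw [← (measurePreserving_cons n).lintegral_comp hφ, ih, laplace,
      prod_withDensity (by fun_prop) hD, lintegral_withDensity_eq_lintegral_mul _ hρ hφ',
      lintegral_withDensity_eq_lintegral_mul _ (measurable_laplaceDensity _) hφ,
      ← hcons.lintegral_comp ((measurable_laplaceDensity _).mul hφ), ← Measure.volume_eq_prod]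
    refine lintegral_congr fun z => ?_
    simp only [Pi.mul_apply]
    congr 1
    rw [laplaceDensity, laplaceDensity, ← ENNReal.ofReal_mul (by positivity), Fin.sum_univ_succ]
    congr 1
    simp only [Fin.cons_zero, Fin.cons_succ]
    rw [div_mul_div_comm, ← Real.exp_add, neg_add, pow_succ']

/-- Polar coordinates for independent Laplace variables: their `ℓ_1`-norm has a Gamma distribution
and is independent of their direction, which is uniform on the `ℓ_1`-sphere. -/
lemma IsUniformEll1.laplace_polar {ν : Measure (Vec (n + 1))} {c : ℝ≥0∞} (h : IsUniformEll1 ν c)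
    {H : Vec (n + 1) → ℝ≥0∞} (hH : Measurable H) :
    n.factorial * ∫⁻ w, H (WithLp.toLp 2 w) ∂laplacePi (n + 1) =
      ∫⁻ r in Ioi (0 : ℝ), ENNReal.ofReal (r ^ n * Real.exp (-r)) * ∫⁻ s, H (r • s) ∂ν := by
  have key : ∀ {H : Vec (n + 1) → ℝ≥0∞}, Measurable H →
      c * 2 ^ (n + 1) * ∫⁻ w, H (WithLp.toLp 2 w) ∂laplacePi (n + 1) =
      ∫⁻ r in Ioi (0 : ℝ), ENNReal.ofReal (r ^ n * Real.exp (-r)) * ∫⁻ s, H (r • s) ∂ν := by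
    intro H hH
    have hD := measurable_laplaceDensity (n + 1)
    have hH2 : Measurable fun w : Fin (n + 1) → ℝ => H (WithLp.toLp 2 w) := hH.comp (by fun_prop)
    have hDH : Measurable fun w : Vec (n + 1) => laplaceDensity (n + 1) w.ofLp * H w :=
      (hD.comp (by fun_prop)).mul hH
    have hpol := h.polar hDH
    rw [laplacePi_eq_withDensity, lintegral_withDensity_eq_lintegral_mul _ hD hH2, mul_assoc,
      mul_left_comm]
    simp only [Pi.mul_apply]
    rw [hpol, ← lintegral_const_mul' _ _ (by simp)]
    refine setLIntegral_congr_fun measurableSet_Ioi fun r hr => ?_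
    have hr' : (0 : ℝ) < r := hr
    have hae : ∀ᵐ s ∂ν, laplaceDensity (n + 1) (r • s).ofLp * H (r • s) =
        ENNReal.ofReal (Real.exp (-r) / 2 ^ (n + 1)) * H (r • s) := by
      filter_upwards [h.ae_mem] with s hs
      have hs' : ∑ i, |s i| = 1 := by rw [← ellNorm_one]; exact hs
      have : ∑ i, |(r • s) i| = r := by
        simp [abs_mul, abs_of_pos hr', ← Finset.mul_sum, hs']
      rw [laplaceDensity]
      simp only [this]
    simp only
    rw [lintegral_congr_ae hae, lintegral_const_mul' _ _ ENNReal.ofReal_ne_top, ← mul_assoc,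
      ← mul_assoc]
    congr 1
    have h2 : (2 : ℝ≥0∞) ^ (n + 1) = ENNReal.ofReal (2 ^ (n + 1)) := by
      rw [ENNReal.ofReal_pow (by norm_num)]; norm_num
    rw [h2, ← ENNReal.ofReal_mul (by positivity), ← ENNReal.ofReal_mul (by positivity)]
    congr 1
    field_simp
  have hprob := h.prob
  have hone : c * 2 ^ (n + 1) = n.factorial := by
    have := key (H := fun _ => 1) measurable_const
    simp only [lintegral_const, measure_univ, mul_one] at this
    rw [this, ← ofReal_integral_eq_lintegral_ofReal (integrableOn_pow_mul_exp_neg n),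
      integral_pow_mul_exp_neg]
    · simp
    · filter_upwards [ae_restrict_mem measurableSet_Ioi] with r hr
      have : (0 : ℝ) < r := hr
      positivity
  rw [← key hH, hone]

/-- For a homogeneous function the integral over the radius is a Gamma integral. -/
lemma IsUniformEll1.laplace_homogeneous {ν : Measure (Vec (n + 1))} {c : ℝ≥0∞}
    (h : IsUniformEll1 ν c) {H : Vec (n + 1) → ℝ≥0∞} (hH : Measurable H) (k : ℕ)
    (hk : ∀ r : ℝ, 0 < r → ∀ s, H (r • s) = ENNReal.ofReal (r ^ k) * H s) :
    n.factorial * ∫⁻ w, H (WithLp.toLp 2 w) ∂laplacePi (n + 1) =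
      (n + k).factorial * ∫⁻ s, H s ∂ν := by
  rw [h.laplace_polar hH]
  have : ∀ r ∈ Ioi (0 : ℝ), ENNReal.ofReal (r ^ n * Real.exp (-r)) * ∫⁻ s, H (r • s) ∂ν =
      ENNReal.ofReal (r ^ (n + k) * Real.exp (-r)) * ∫⁻ s, H s ∂ν := by
    intro r hr
    have hr' : (0 : ℝ) < r := hr
    simp_rw [hk r hr']
    rw [lintegral_const_mul' _ _ ENNReal.ofReal_ne_top, ← mul_assoc,
      ← ENNReal.ofReal_mul (by positivity)]
    congr 2
    ring
  rw [setLIntegral_congr_fun measurableSet_Ioi this, lintegral_mul_const _ (by fun_prop),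
    ← ofReal_integral_eq_lintegral_ofReal (integrableOn_pow_mul_exp_neg _),
    integral_pow_mul_exp_neg]
  · simp
  · filter_upwards [ae_restrict_mem measurableSet_Ioi] with r hr
    have : (0 : ℝ) < r := hr
    positivity

/-- Integrals of homogeneous functions over the `ℓ_1`-ball and the `ℓ_1`-sphere are proportional. -/
lemma IsUniformEll1.ball_homogeneous {ν : Measure (Vec (n + 1))} {c : ℝ≥0∞}
    (h : IsUniformEll1 ν c) {H : Vec (n + 1) → ℝ≥0∞} (hH : Measurable H) (k : ℕ)
    (hk : ∀ r : ℝ, 0 < r → ∀ s, H (r • s) = ENNReal.ofReal (r ^ k) * H s) :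
    c * ∫⁻ w in ell1Ball (n + 1), H (WithLp.toLp 2 w) =
      ENNReal.ofReal (1 / (n + k + 1)) * ∫⁻ s, H s ∂ν := by
  have hB : MeasurableSet {w : Vec (n + 1) | ∑ i, |w i| < 1} :=
    measurableSet_lt (by fun_prop) (by fun_prop)
  have e : ∫⁻ w in ell1Ball (n + 1), H (WithLp.toLp 2 w) = ∫⁻ w : Fin (n + 1) → ℝ,
      {w : Vec (n + 1) | ∑ i, |w i| < 1}.indicator H (WithLp.toLp 2 w) := by
    rw [← lintegral_indicator (measurableSet_ell1Ball _)]
    rfl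
  rw [e, h.polar (hH.indicator hB)]
  have : ∀ r ∈ Ioi (0 : ℝ), ENNReal.ofReal (r ^ n) *
      ∫⁻ s, {w : Vec (n + 1) | ∑ i, |w i| < 1}.indicator H (r • s) ∂ν =
      (Iio (1 : ℝ)).indicator (fun r => ENNReal.ofReal (r ^ (n + k)) * ∫⁻ s, H s ∂ν) r := by
    intro r hr
    have hr' : (0 : ℝ) < r := hr
    have hae : ∀ᵐ s ∂ν, {w : Vec (n + 1) | ∑ i, |w i| < 1}.indicator H (r • s) =
        if r < 1 then ENNReal.ofReal (r ^ k) * H s else 0 := by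
      filter_upwards [h.ae_mem] with s hs
      have hs' : ∑ i, |s i| = 1 := by rw [← ellNorm_one]; exact hs
      have : ∑ i, |(r • s) i| = r := by
        simp [abs_mul, abs_of_pos hr', ← Finset.mul_sum, hs']
      by_cases h1 : r < 1
      · rw [if_pos h1, indicator_of_mem (by rw [mem_ofPred_eq, this]; exact h1), hk r hr']
      · rw [if_neg h1, indicator_of_notMem (by rw [mem_ofPred_eq, this]; exact h1)]
    rw [lintegral_congr_ae hae, indicator_apply]
    by_cases h1 : r < 1
    · simp only [h1, if_true, mem_Iio]
      rw [lintegral_const_mul' _ _ ENNReal.ofReal_ne_top, ← mul_assoc,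
        ← ENNReal.ofReal_mul (by positivity), pow_add]
    · simp [h1]
  rw [setLIntegral_congr_fun measurableSet_Ioi this, lintegral_indicator measurableSet_Iio,
    Measure.restrict_restrict measurableSet_Iio, lintegral_mul_const _ (by fun_prop)]
  congr 1
  have hset : Iio (1 : ℝ) ∩ Ioi 0 = Ioo 0 1 := by rw [inter_comm, Ioi_inter_Iio]
  have hi : IntegrableOn (fun r : ℝ => r ^ (n + k)) (Ioo 0 1) :=
    ((continuous_pow (n + k)).integrableOn_Icc (a := (0 : ℝ)) (b := 1)).mono_set Ioo_subset_Icc_self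
  rw [hset, ← ofReal_integral_eq_lintegral_ofReal hi]
  · rw [← integral_Ioc_eq_integral_Ioo, ← intervalIntegral.integral_of_le zero_le_one,
      integral_pow]
    simp
  · filter_upwards [ae_restrict_mem measurableSet_Ioo] with r hr
    have : (0 : ℝ) < r := hr.1
    positivity

end

end

/-! ### Moments and concentration on the `ℓ_1`-sphere -/

section

open Set Filter Topology

section
variable {n : ℕ}

lemma integral_apply_laplacePi {d : ℕ} (i : Fin d) {g : ℝ → ℝ} (hg : Integrable g laplace) :
    Integrable (fun w : Fin d → ℝ => g (w i)) (laplacePi d) ∧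
      ∫ w, g (w i) ∂laplacePi d = ∫ t, g t ∂laplace := by
  have hm := laplacePi_eval i
  refine ⟨hm.integrable_comp_of_integrable hg, ?_⟩
  have h1 : AEStronglyMeasurable g (Measure.map (Function.eval i) (laplacePi d)) := by
    rw [hm.map_eq]; exact hg.aestronglyMeasurable
  have h2 := integral_map hm.measurable.aemeasurable h1
  rw [hm.map_eq] at h2
  exact h2.symm

lemma integral_ellNorm_laplacePi_le {d : ℕ} {q : ℝ≥0∞} (hq : 1 ≤ q) {s : ℝ} (hs : 1 ≤ s)
    (hsq : ENNReal.ofReal s ≤ q) (hd : 0 < d) :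
    Integrable (fun w : Fin d → ℝ => ellNorm q (WithLp.toLp 2 w)) (laplacePi d) ∧
      ∫ w, ellNorm q (WithLp.toLp 2 w) ∂laplacePi d ≤ 6 * (s * (d : ℝ) ^ (1 / s)) := by
  have hd' : (0 : ℝ) < d := by exact_mod_cast hd
  have hmom := laplace_moment hs
  have hi : ∀ i : Fin d, Integrable (fun w : Fin d → ℝ => (|w i| / (2 * s)) ^ s) (laplacePi d) :=
    fun i => (integral_apply_laplacePi i hmom.1).1
  have hsum := integrable_finsetSum Finset.univ fun i _ => hi i
  have hI : Integrable (fun w : Fin d → ℝ => 2 * s * (d : ℝ) ^ (1 / s) *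
      (1 + (∑ i, (|w i| / (2 * s)) ^ s) / d)) (laplacePi d) :=
    (((integrable_const 1).add (hsum.div_const _)).const_mul _)
  have hc : Continuous fun w : Fin d → ℝ => ellNorm q (WithLp.toLp 2 w : Vec d) :=
    (ellNorm_continuous hq).comp (PiLp.continuous_toLp 2 _)
  have hI' : Integrable (fun w : Fin d → ℝ => ellNorm q (WithLp.toLp 2 w)) (laplacePi d) :=
    hI.mono' hc.aestronglyMeasurable (ae_of_all _ fun w => by
      rw [Real.norm_of_nonneg (ellNorm_nonneg hq _)]
      exact ellNorm_le_linearized hs hsq hd _)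
  refine ⟨hI', ?_⟩
  calc ∫ w, ellNorm q (WithLp.toLp 2 w) ∂laplacePi d
      ≤ ∫ w : Fin d → ℝ, 2 * s * (d : ℝ) ^ (1 / s) *
          (1 + (∑ i, (|w i| / (2 * s)) ^ s) / d) ∂laplacePi d :=
        integral_mono hI' hI fun w => ellNorm_le_linearized hs hsq hd _
    _ = 2 * s * (d : ℝ) ^ (1 / s) *
          (1 + (∑ _i : Fin d, ∫ t, (|t| / (2 * s)) ^ s ∂laplace) / d) := by
        rw [integral_const_mul, integral_add (integrable_const _) (hsum.div_const _),
          integral_div, integral_finsetSum _ fun i _ => hi i]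
        simp [(integral_apply_laplacePi _ hmom.1).2]
    _ ≤ 2 * s * (d : ℝ) ^ (1 / s) * (1 + 2) := by
        rw [Finset.sum_const, Finset.card_univ, Fintype.card_fin, nsmul_eq_mul,
          mul_div_cancel_left₀ _ hd'.ne']
        gcongr
        exact hmom.2
    _ = _ := by ring

lemma continuous_toLp_fin {d : ℕ} : Continuous fun w : Fin d → ℝ => (WithLp.toLp 2 w : Vec d) :=
  PiLp.continuous_toLp 2 _

lemma IsUniformEll1.volume_ball {ν : Measure (Vec (n + 1))} {c : ℝ≥0∞} (h : IsUniformEll1 ν c) :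
    (n + 1) * c.toReal * volume.real (ell1Ball (n + 1)) = 1 := by
  have hp := h.prob
  have h1 := h.ball_homogeneous (H := fun _ => 1) measurable_const 0 (by simp)
  have h2 := congrArg ENNReal.toReal h1
  simp only [lintegral_const, Measure.restrict_apply, MeasurableSet.univ, univ_inter, one_mul,
    measure_univ, mul_one, ENNReal.toReal_mul, CharP.cast_eq_zero, add_zero] at h2
  rw [ENNReal.toReal_ofReal (by positivity)] at h2
  rw [mul_assoc, measureReal_def, h2]
  field_simp

lemma integrableOn_ell1Ball {d : ℕ} {g : (Fin d → ℝ) → ℝ} (hg : Continuous g) :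
    IntegrableOn g (ell1Ball d) := by
  have : ell1Ball d ⊆ Metric.closedBall 0 1 := fun u hu => by
    have hu' : ∑ j, |u j| < 1 := hu
    rw [mem_closedBall_zero_iff, pi_norm_le_iff_of_nonneg zero_le_one]
    exact fun j => (Finset.single_le_sum (f := fun j => |u j|) (fun _ _ => abs_nonneg _)
      (Finset.mem_univ j)).trans hu'.le
  exact (hg.continuousOn.integrableOn_compact (isCompact_closedBall 0 1)).mono_set this

/-- The mean `ℓ_q`-norm of a uniform point of the `ℓ_1`-ball is at most `6 b_q(d)`. -/
lemma IsUniformEll1.integral_ball_ellNorm_le {ν : Measure (Vec (n + 1))} {c : ℝ≥0∞}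
    (h : IsUniformEll1 ν c) {q : ℝ≥0∞} (hq : 1 ≤ q) (hn : 3 ≤ n + 1) :
    (n + 1) * c.toReal * ∫ w in ell1Ball (n + 1), ellNorm q (WithLp.toLp 2 w) ≤
      6 * biasConst q (n + 1) := by
  obtain ⟨s, hs, hsq, hb⟩ := exists_exponent_biasConst hq hn
  obtain ⟨hi, hle⟩ := integral_ellNorm_laplacePi_le hq hs hsq (d := n + 1) (by omega)
  have hm : Measurable fun w : Vec (n + 1) => ENNReal.ofReal (ellNorm q w) :=
    (ellNorm_continuous hq).measurable.ennreal_ofReal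
  have hk : ∀ r : ℝ, 0 < r → ∀ s : Vec (n + 1), ENNReal.ofReal (ellNorm q (r • s)) =
      ENNReal.ofReal (r ^ 1) * ENNReal.ofReal (ellNorm q s) := fun r hr s => by
    rw [ellNorm_smul hq, abs_of_pos hr, ENNReal.ofReal_mul hr.le, pow_one]
  have h1 := congrArg ENNReal.toReal (h.ball_homogeneous hm 1 hk)
  have h2 := congrArg ENNReal.toReal (h.laplace_homogeneous hm 1 hk)
  have e1 : (∫⁻ w in ell1Ball (n + 1), ENNReal.ofReal (ellNorm q (WithLp.toLp 2 w))).toReal =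
      ∫ w in ell1Ball (n + 1), ellNorm q (WithLp.toLp 2 w) := by
    rw [integral_eq_lintegral_of_nonneg_ae (ae_of_all _ fun w => ellNorm_nonneg hq _)
      ((ellNorm_continuous hq).comp continuous_toLp_fin).aestronglyMeasurable]
  have e2 : (∫⁻ w, ENNReal.ofReal (ellNorm q (WithLp.toLp 2 w)) ∂laplacePi (n + 1)).toReal =
      ∫ w, ellNorm q (WithLp.toLp 2 w) ∂laplacePi (n + 1) := by
    rw [integral_eq_lintegral_of_nonneg_ae (ae_of_all _ fun w => ellNorm_nonneg hq _)
      ((ellNorm_continuous hq).comp continuous_toLp_fin).aestronglyMeasurable]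
  rw [ENNReal.toReal_mul, ENNReal.toReal_mul, e1, ENNReal.toReal_ofReal (by positivity)] at h1
  rw [ENNReal.toReal_mul, ENNReal.toReal_mul, e2, ENNReal.toReal_natCast,
    ENNReal.toReal_natCast, Nat.factorial_succ] at h2
  set A := (∫⁻ s, ENNReal.ofReal (ellNorm q s) ∂ν).toReal
  have hfac : (0 : ℝ) < n.factorial := by exact_mod_cast n.factorial_pos
  push_cast at h1 h2 hle hb
  have h3 : ∫ w, ellNorm q (WithLp.toLp 2 w) ∂laplacePi (n + 1) = (n + 1) * A := by
    have : (n.factorial : ℝ) * ∫ w, ellNorm q (WithLp.toLp 2 w) ∂laplacePi (n + 1) =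
        n.factorial * ((n + 1) * A) := by rw [h2]; ring
    exact mul_left_cancel₀ hfac.ne' this
  rw [mul_assoc, h1, hb]
  rw [h3] at hle
  have hn2 : (0 : ℝ) < n + 1 + 1 := by positivity
  calc (n + 1 : ℝ) * (1 / (n + 1 + 1) * A) = ((n + 1) * A) / (n + 1 + 1) := by ring
    _ ≤ (6 * (s * (n + 1 : ℝ) ^ (1 / s))) / (n + 1 + 1) := by gcongr
    _ = _ := by ring

lemma integral_sq_norm_laplacePi (d : ℕ) :
    Integrable (fun w : Fin d → ℝ => ‖(WithLp.toLp 2 w : Vec d)‖ ^ 2) (laplacePi d) ∧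
      ∫ w, ‖(WithLp.toLp 2 w : Vec d)‖ ^ 2 ∂laplacePi d = 2 * d := by
  have hi : ∀ i : Fin d, Integrable (fun w : Fin d → ℝ => w i ^ 2) (laplacePi d) :=
    fun i => (integral_apply_laplacePi i laplace_sq.1).1
  simp only [EuclideanSpace.real_norm_sq_eq]
  refine ⟨integrable_finsetSum Finset.univ fun i _ => hi i, ?_⟩
  rw [integral_finsetSum _ fun i _ => hi i]
  have : ∀ i : Fin d, ∫ w : Fin d → ℝ, w i ^ 2 ∂laplacePi d = 2 := fun i => by
    rw [(integral_apply_laplacePi i laplace_sq.1).2, laplace_sq.2]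
  simp [this, mul_comm]

lemma IsUniformEll1.lintegral_sq_norm {ν : Measure (Vec (n + 1))} {c : ℝ≥0∞}
    (h : IsUniformEll1 ν c) :
    ∫⁻ s, ENNReal.ofReal (‖s‖ ^ 2) ∂ν = ENNReal.ofReal (2 / (n + 2)) := by
  have h1 := h.laplace_homogeneous (H := fun s => ENNReal.ofReal (‖s‖ ^ 2)) (by fun_prop) 2
    (fun r hr s => by
      rw [norm_smul, mul_pow, Real.norm_of_nonneg hr.le, ENNReal.ofReal_mul (by positivity)])
  obtain ⟨hi, he⟩ := integral_sq_norm_laplacePi (n + 1)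
  rw [← ofReal_integral_eq_lintegral_ofReal hi (ae_of_all _ fun w => by positivity), he,
    Nat.factorial_succ, Nat.factorial_succ] at h1
  have e : ∀ k : ℕ, (k : ℝ≥0∞) = ENNReal.ofReal k := fun k => by simp
  rw [e, e, ← ENNReal.ofReal_mul (by positivity)] at h1
  have hpos : (0 : ℝ) < ((n + 1 + 1) * ((n + 1) * n.factorial) : ℕ) := by positivity
  refine (ENNReal.mul_right_inj (ENNReal.ofReal_pos.2 hpos).ne' ENNReal.ofReal_ne_top).1 ?_
  rw [← h1, ← ENNReal.ofReal_mul hpos.le]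
  congr 1
  push_cast
  field_simp
  ring

lemma integral_laplacePi_odd {d : ℕ} {F : (Fin d → ℝ) → ℝ} (hF : ∀ w, F (-w) = -F w) :
    ∫ w, F w ∂laplacePi d = 0 := by
  rw [laplacePi_eq_withDensity, integral_withDensity_eq_integral_toReal_smul
    (measurable_laplaceDensity d) (by simp [laplaceDensity])]
  have h := integral_neg_eq_self (fun w => (laplaceDensity d w).toReal • F w) volume
  have e : ∀ w, (laplaceDensity d (-w)).toReal • F (-w) = -((laplaceDensity d w).toReal • F w) :=
    fun w => by simp [laplaceDensity, hF]
  simp_rw [e] at h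
  rw [integral_neg] at h
  linarith

lemma sum_sq_apply_single {d : ℕ} (ℓ : Vec d →L[ℝ] ℝ) :
    ∑ i, ℓ (EuclideanSpace.single i 1) ^ 2 = ‖ℓ‖ ^ 2 := by
  set g := (InnerProductSpace.toDual ℝ (Vec d)).symm ℓ with hg
  have h1 : ∀ v, ℓ v = inner ℝ g v := fun v => by
    rw [hg, InnerProductSpace.toDual_symm_apply]
  have h2 : ‖ℓ‖ = ‖g‖ := by rw [hg, LinearIsometryEquiv.norm_map]
  rw [h2, EuclideanSpace.real_norm_sq_eq]
  refine Finset.sum_congr rfl fun i _ => ?_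
  rw [h1]
  simp [EuclideanSpace.inner_single_right]

/-- The Poincaré inequality for a rescaled vector of independent Laplace variables. -/
lemma laplacePi_odd_sq_le {d : ℕ} {G : Vec d → ℝ} (hG : ContDiff ℝ 1 G) {Λ : NNReal}
    (hL : LipschitzWith Λ G) (hodd : ∀ w, G (-w) = -G w) (a : ℝ) :
    Integrable (fun w : Fin d → ℝ => G (a • WithLp.toLp 2 w) ^ 2) (laplacePi d) ∧
    ∫ w, G (a • WithLp.toLp 2 w) ^ 2 ∂laplacePi d ≤ 4 * (a ^ 2 * Λ ^ 2) := by
  set A : (Fin d → ℝ) →L[ℝ] Vec d :=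
    a • (PiLp.continuousLinearEquiv 2 ℝ (fun _ : Fin d => ℝ)).symm.toContinuousLinearMap with hA
  have hAe : ∀ w, A w = a • WithLp.toLp 2 w := fun w => rfl
  have hAs : ∀ i, A (Pi.single i 1) = a • EuclideanSpace.single i (1 : ℝ) := fun i => rfl
  have hF : ContDiff ℝ 1 fun w => G (A w) := hG.comp A.contDiff
  have hFL : LipschitzWith (Λ * ‖A‖₊) fun w => G (A w) := hL.comp A.lipschitz
  refine ⟨(memLp_of_lipschitz hFL).integrable_sq, ?_⟩
  have h := laplacePi_poincare hF hFL
  rw [integral_laplacePi_odd (F := fun w => G (A w)) (fun w => by rw [map_neg, hodd])] at h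
  simp only [← hAe]
  refine h.trans ?_
  rw [zero_pow two_ne_zero, zero_add]
  refine mul_le_mul_of_nonneg_left ?_ (by norm_num)
  have hb : ∀ w, ∑ i, fderiv ℝ (fun w => G (A w)) w (Pi.single i 1) ^ 2 ≤ a ^ 2 * Λ ^ 2 := by
    intro w
    have hfd : fderiv ℝ (fun w => G (A w)) w = (fderiv ℝ G (A w)).comp A :=
      ((hG.differentiable one_ne_zero _).hasFDerivAt.comp w A.hasFDerivAt).fderiv
    simp only [hfd, ContinuousLinearMap.comp_apply, hAs, map_smul, smul_eq_mul, mul_pow,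
      ← Finset.mul_sum, sum_sq_apply_single]
    gcongr
    exact norm_fderiv_le_of_lipschitz ℝ hL
  have hnn : ∀ w, 0 ≤ ∑ i, fderiv ℝ (fun w => G (A w)) w (Pi.single i 1) ^ 2 :=
    fun w => Finset.sum_nonneg fun i _ => sq_nonneg _
  refine (integral_mono_of_nonneg (ae_of_all _ hnn) (integrable_const (a ^ 2 * (Λ : ℝ) ^ 2))
    (ae_of_all _ hb)).trans ?_
  simp

lemma lintegral_radius_deviation (n : ℕ) :
    ∫⁻ r in Ioi (0 : ℝ), ENNReal.ofReal (r ^ n * Real.exp (-r) * (1 - r / (n + 1)) ^ 2) =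
      ENNReal.ofReal (n.factorial / (n + 1)) := by
  have e : ∀ r : ℝ, r ^ n * Real.exp (-r) * (1 - r / (n + 1)) ^ 2 =
      r ^ n * Real.exp (-r) - 2 / (n + 1) * (r ^ (n + 1) * Real.exp (-r)) +
        1 / (n + 1) ^ 2 * (r ^ (n + 2) * Real.exp (-r)) := fun r => by
    field_simp; ring
  have i1 := integrableOn_pow_mul_exp_neg n
  have i2 := (integrableOn_pow_mul_exp_neg (n + 1)).const_mul (2 / ((n : ℝ) + 1))
  have i3 := (integrableOn_pow_mul_exp_neg (n + 2)).const_mul (1 / ((n : ℝ) + 1) ^ 2)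
  have i12 : IntegrableOn (fun r : ℝ => r ^ n * Real.exp (-r) -
      2 / (n + 1) * (r ^ (n + 1) * Real.exp (-r))) (Ioi 0) := i1.sub i2
  have i123 : IntegrableOn (fun r : ℝ => r ^ n * Real.exp (-r) * (1 - r / (n + 1)) ^ 2)
      (Ioi 0) := by
    simp_rw [e]
    exact i12.add i3
  rw [← ofReal_integral_eq_lintegral_ofReal i123]
  · congr 1
    simp_rw [e]
    rw [integral_add i12 i3, integral_sub i1 i2, integral_const_mul, integral_const_mul,
      integral_pow_mul_exp_neg, integral_pow_mul_exp_neg, integral_pow_mul_exp_neg,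
      Nat.factorial_succ, Nat.factorial_succ, Nat.factorial_succ]
    push_cast
    field_simp
    ring
  · filter_upwards [ae_restrict_mem measurableSet_Ioi] with r hr
    have : (0 : ℝ) < r := hr
    positivity

/-- An odd Lipschitz function on the `ℓ_1`-sphere is of size `Λ / d`. With `S` the `ℓ_1`-norm of a
vector of independent Laplace variables, the function is compared on the sphere and at radius
`S / d`: the Poincaré inequality controls it there, and `S / d` is within `d^{-1/2}` of `1`, while
the points of the sphere have Euclidean norm of order `d^{-1/2}`. -/
lemma IsUniformEll1.lintegral_odd_sq_le {ν : Measure (Vec (n + 1))} {c : ℝ≥0∞}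
    (h : IsUniformEll1 ν c) {G : Vec (n + 1) → ℝ} (hG : ContDiff ℝ 1 G) {Λ : NNReal}
    (hL : LipschitzWith Λ G) (hodd : ∀ w, G (-w) = -G w) :
    ∫⁻ s, ENNReal.ofReal (G s ^ 2) ∂ν ≤ ENNReal.ofReal (12 * Λ ^ 2 / (n + 1) ^ 2) := by
  have hGm : Measurable G := hG.continuous.measurable
  set a : ℝ := 1 / (n + 1) with ha
  obtain ⟨hi, hP⟩ := laplacePi_odd_sq_le hG hL hodd a
  have hfac : (0 : ℝ) < n.factorial := by exact_mod_cast n.factorial_pos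
  have e : ∀ k : ℕ, (k : ℝ≥0∞) = ENNReal.ofReal k := fun k => by simp
  have hpt : ∀ (r : ℝ) (s : Vec (n + 1)), G s ^ 2 ≤ 2 * G (a • r • s) ^ 2 +
      2 * Λ ^ 2 * (1 - r / (n + 1)) ^ 2 * ‖s‖ ^ 2 := by
    intro r s
    have h1 := hL.dist_le_mul s (a • r • s)
    have h2 : s - a • r • s = (1 - r / (n + 1)) • s := by
      rw [smul_smul, sub_smul, one_smul, ha]
      congr 2
      ring
    rw [Real.dist_eq, dist_eq_norm, h2, norm_smul, Real.norm_eq_abs] at h1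
    have h3 : (G s - G (a • r • s)) ^ 2 ≤ Λ ^ 2 * (1 - r / (n + 1)) ^ 2 * ‖s‖ ^ 2 := by
      rw [← sq_abs, ← sq_abs (1 - r / ((n : ℝ) + 1)), mul_assoc, ← mul_pow, ← mul_pow]
      gcongr
    nlinarith [sq_nonneg (G s - 2 * G (a • r • s))]
  have hone : ∫⁻ r in Ioi (0 : ℝ), ENNReal.ofReal (r ^ n * Real.exp (-r)) = n.factorial := by
    rw [← ofReal_integral_eq_lintegral_ofReal (integrableOn_pow_mul_exp_neg n),
      integral_pow_mul_exp_neg, e]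
    filter_upwards [ae_restrict_mem measurableSet_Ioi] with r hr
    have : (0 : ℝ) < r := hr
    positivity
  have hmH : Measurable fun w : Vec (n + 1) => ENNReal.ofReal (2 * G (a • w) ^ 2) := by
    have := hGm.comp (by fun_prop : Measurable fun w : Vec (n + 1) => a • w)
    exact ((this.pow_const 2).const_mul 2).ennreal_ofReal
  have hpol := h.laplace_polar hmH
  have hmain : n.factorial * ∫⁻ s, ENNReal.ofReal (G s ^ 2) ∂ν ≤
      n.factorial * ∫⁻ w, ENNReal.ofReal (2 * G (a • WithLp.toLp 2 w) ^ 2) ∂laplacePi (n + 1) +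
      ENNReal.ofReal (2 * Λ ^ 2 * (n.factorial / (n + 1)) * (2 / (n + 2))) := by
    rw [hpol, ← hone, ← lintegral_mul_const _ (by fun_prop)]
    have e2 : ENNReal.ofReal (2 * Λ ^ 2 * (n.factorial / (n + 1)) * (2 / (n + 2))) =
        ∫⁻ r in Ioi (0 : ℝ), ENNReal.ofReal (r ^ n * Real.exp (-r)) *
          (ENNReal.ofReal (2 * Λ ^ 2 * (1 - r / (n + 1)) ^ 2) *
            ∫⁻ s, ENNReal.ofReal (‖s‖ ^ 2) ∂ν) := by
      rw [h.lintegral_sq_norm, ENNReal.ofReal_mul (by positivity),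
        ENNReal.ofReal_mul (by positivity), ← lintegral_radius_deviation,
        ← lintegral_const_mul' _ _ ENNReal.ofReal_ne_top,
        ← lintegral_mul_const' _ _ ENNReal.ofReal_ne_top]
      refine setLIntegral_congr_fun measurableSet_Ioi fun r hr => ?_
      have hr' : (0 : ℝ) < r := hr
      rw [← mul_assoc]
      congr 1
      rw [← ENNReal.ofReal_mul (by positivity), ← ENNReal.ofReal_mul (by positivity)]
      congr 1
      ring
    rw [e2, ← lintegral_add_right]
    · refine setLIntegral_mono' measurableSet_Ioi fun r hr => ?_
      rw [← mul_add]
      gcongr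
      rw [← lintegral_const_mul' _ _ ENNReal.ofReal_ne_top, ← lintegral_add_right _ (by fun_prop)]
      refine lintegral_mono fun s => ?_
      rw [← ENNReal.ofReal_mul (by positivity), ← ENNReal.ofReal_add (by positivity)
        (by positivity)]
      exact ENNReal.ofReal_le_ofReal (hpt r s)
    · fun_prop
  rw [← ofReal_integral_eq_lintegral_ofReal (hi.const_mul 2)
    (ae_of_all _ fun w => by positivity), integral_const_mul, e,
    ← ENNReal.ofReal_mul hfac.le] at hmain
  have hI0 : 0 ≤ ∫ w, G (a • WithLp.toLp 2 w) ^ 2 ∂laplacePi (n + 1) :=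
    integral_nonneg fun w => sq_nonneg _
  rw [← ENNReal.ofReal_add (by positivity) (by positivity)] at hmain
  refine (ENNReal.mul_le_mul_iff_right (ENNReal.ofReal_pos.2 hfac).ne' ENNReal.ofReal_ne_top).1
    (hmain.trans ?_)
  rw [← ENNReal.ofReal_mul hfac.le]
  refine ENNReal.ofReal_le_ofReal ?_
  calc (n.factorial : ℝ) * (2 * ∫ w, G (a • WithLp.toLp 2 w) ^ 2 ∂laplacePi (n + 1)) +
        2 * (Λ : ℝ) ^ 2 * (n.factorial / (n + 1)) * (2 / (n + 2))
      ≤ n.factorial * (2 * (4 * (a ^ 2 * (Λ : ℝ) ^ 2))) +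
        2 * (Λ : ℝ) ^ 2 * (n.factorial / (n + 1)) * (2 / (n + 1)) := by
        gcongr
        linarith
    _ = n.factorial * (12 * (Λ : ℝ) ^ 2 / (n + 1) ^ 2) := by
        rw [ha]; field_simp; ring

end

end

/-! ### The divergence theorem on the `ℓ_1`-ball -/

section

open Set Filter Topology

section
variable {n : ℕ} {ν : Measure (Vec (n + 1))} {c : ℝ≥0∞}

lemma isCompact_ell1Sphere (d : ℕ) : IsCompact (ell1Sphere d) := by
  refine Metric.isCompact_of_isClosed_isBounded
    ((isClosed_singleton (x := (1 : ℝ))).preimage (ellNorm_continuous le_rfl)) ?_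
  refine (Metric.isBounded_closedBall (x := (0 : Vec d)) (r := 1)).subset fun s hs => ?_
  have hs' : ellNorm 1 s = 1 := hs
  rw [mem_closedBall_zero_iff, ← hs', ellNorm_one]
  exact norm_le_sum_abs s

/-- The sign of a real number, with `sgn 0 = 1` as in `signVec`. -/
def sgn (t : ℝ) : ℝ := if 0 ≤ t then 1 else -1

lemma measurable_sgn : Measurable sgn :=
  Measurable.ite measurableSet_Ici measurable_const measurable_const

lemma abs_sgn (t : ℝ) : |sgn t| = 1 := by
  unfold sgn; split_ifs <;> simp

lemma IsUniformEll1.integrable_of_le (h : IsUniformEll1 ν c) {Φ : Vec (n + 1) → ℝ}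
    (hΦ : Measurable Φ) {C : ℝ} (hC : ∀ s ∈ ell1Sphere (n + 1), |Φ s| ≤ C) : Integrable Φ ν := by
  have := h.prob
  refine Integrable.of_bound hΦ.aestronglyMeasurable C ?_
  filter_upwards [h.ae_mem] with s hs
  exact hC s hs

lemma IsUniformEll1.integrable_sgn_mul (h : IsUniformEll1 ν c) {F : Vec (n + 1) → ℝ}
    (hF : Continuous F) (i : Fin (n + 1)) : Integrable (fun s => sgn (s i) * F s) ν := by
  obtain ⟨C, hC⟩ := (isCompact_ell1Sphere (n + 1)).exists_bound_of_continuousOn hF.continuousOn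
  refine h.integrable_of_le ?_ (C := C) fun s hs => ?_
  · have : Measurable fun s : Vec (n + 1) => sgn (s i) :=
      measurable_sgn.comp (by fun_prop)
    exact this.mul hF.measurable
  · rw [abs_mul, abs_sgn, one_mul]; exact hC s hs

lemma IsUniformEll1.integral_sgn_mul (h : IsUniformEll1 ν c) {F : Vec (n + 1) → ℝ}
    (hF : Continuous F) (i : Fin (n + 1)) :
    ∫ s, sgn (s i) * F s ∂ν =
      c.toReal * ∫ u in ell1Ball n, (F (face i 1 u) - F (face i (-1) u)) := by
  have hm : Measurable fun s : Vec (n + 1) => sgn (s i) * F s :=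
    (measurable_sgn.comp (by fun_prop : Measurable fun s : Vec (n + 1) => s i)).mul hF.measurable
  have hsgn : ∀ σ : ℝ, ∀ u ∈ ell1Ball n, sgn (face i σ u i) = sgn σ := fun σ u hu => by
    have hu' : ∑ j, |u j| < 1 := hu
    have : 0 < 1 - ∑ j, |u j| := by linarith
    simp only [sgn, face_same, mul_nonneg_iff_of_pos_right this]
  have hcont : ∀ σ, Continuous fun u => F (face i σ u) := fun σ => hF.comp (face_continuous i σ)
  have e : ∀ σ : ℝ, ∫ s, sgn (s i) * F s ∂(volume.restrict (ell1Ball n)).map (face i σ) =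
      sgn σ * ∫ u in ell1Ball n, F (face i σ u) := fun σ => by
    rw [integral_map (face_continuous i σ).aemeasurable hm.aestronglyMeasurable,
      ← integral_const_mul]
    exact setIntegral_congr_fun (measurableSet_ell1Ball n) fun u hu => by
      simp only [hsgn σ u hu]
  have hint : ∀ σ : ℝ, Integrable (fun s : Vec (n + 1) => sgn (s i) * F s)
      ((volume.restrict (ell1Ball n)).map (face i σ)) := fun σ => by
    rw [integrable_map_measure hm.aestronglyMeasurable (face_continuous i σ).aemeasurable]
    refine (integrableOn_congr_fun (g := fun u => sgn σ * F (face i σ u)) (fun u hu => ?_)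
      (measurableSet_ell1Ball n)).2 ((integrableOn_ell1Ball (hcont σ)).const_mul _)
    simp only [Function.comp, hsgn σ u hu]
  rw [h.eq_proj i, integral_smul_measure, projMeasure, integral_add_measure (hint 1) (hint (-1)),
    e, e, integral_sub (integrableOn_ell1Ball (hcont 1)) (integrableOn_ell1Ball (hcont (-1)))]
  simp only [sgn, zero_le_one, if_true, smul_eq_mul]
  norm_num
  left; ring

lemma measurableEmbedding_insertNth (i : Fin (n + 1)) :
    MeasurableEmbedding (fun z : ℝ × (Fin n → ℝ) => (i.insertNth z.1 z.2 : Fin (n + 1) → ℝ)) := by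
  have h := (MeasurableEquiv.piFinSuccAbove (fun _ : Fin (n + 1) => ℝ) i).symm.measurableEmbedding
  convert h using 1
  funext z
  simp [MeasurableEquiv.piFinSuccAbove_symm_apply, Fin.insertNthEquiv]

lemma hasDerivAt_insertNth {F : Vec (n + 1) → ℝ} (hF : Differentiable ℝ F) (i : Fin (n + 1))
    (u : Fin n → ℝ) (t : ℝ) :
    HasDerivAt (fun t => F (WithLp.toLp 2 (i.insertNth t u)))
      (fderiv ℝ F (WithLp.toLp 2 (i.insertNth t u)) (EuclideanSpace.single i 1)) t := by
  refine HasFDerivAt.comp_hasDerivAt (l := F) t (hF _).hasFDerivAt ?_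
  have : (fun t : ℝ => (WithLp.toLp 2 (i.insertNth t u) : Vec (n + 1))) = fun t =>
      t • EuclideanSpace.single i (1 : ℝ) + WithLp.toLp 2 (i.insertNth 0 u) := by
    funext t
    ext k
    obtain rfl | ⟨j, rfl⟩ := i.eq_self_or_eq_succAbove k
    · simp
    · simp
  rw [this]
  simpa using ((hasDerivAt_id t).smul_const (EuclideanSpace.single i (1 : ℝ))).add_const
    (WithLp.toLp 2 (i.insertNth 0 u) : Vec (n + 1))

/-- Integrating a partial derivative over the `ℓ_1`-ball, along the lines parallel to the axis. -/
lemma integral_ball_fderiv {F : Vec (n + 1) → ℝ} (hF : ContDiff ℝ 1 F) (i : Fin (n + 1)) :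
    ∫ w in ell1Ball (n + 1), fderiv ℝ F (WithLp.toLp 2 w) (EuclideanSpace.single i 1) =
      ∫ u in ell1Ball n, (F (face i 1 u) - F (face i (-1) u)) := by
  set D : Vec (n + 1) → ℝ := fun w => fderiv ℝ F w (EuclideanSpace.single i 1) with hD
  have hDc : Continuous D := (hF.continuous_fderiv one_ne_zero).clm_apply continuous_const
  have hDL : Continuous fun w : Fin (n + 1) → ℝ => D (WithLp.toLp 2 w) :=
    hDc.comp continuous_toLp_fin
  set Φ : (Fin (n + 1) → ℝ) → ℝ := (ell1Ball (n + 1)).indicator fun w => D (WithLp.toLp 2 w)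
    with hΦ
  have hΦi : Integrable Φ :=
    (integrable_indicator_iff (measurableSet_ell1Ball _)).2 (integrableOn_ell1Ball hDL)
  have hmp := volume_preserving_insertNth i
  have hΦp : Integrable (fun z : ℝ × (Fin n → ℝ) => Φ (i.insertNth z.1 z.2)) :=
    (hmp.integrable_comp_emb (measurableEmbedding_insertNth i)).2 hΦi
  rw [← integral_indicator (measurableSet_ell1Ball _),
    ← hmp.integral_comp (measurableEmbedding_insertNth i), Measure.volume_eq_prod,
    integral_prod_symm _ (by rw [← Measure.volume_eq_prod]; exact hΦp),
    ← integral_indicator (measurableSet_ell1Ball n)]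
  refine integral_congr_ae (ae_of_all _ fun u => ?_)
  have hmem : ∀ t, (i.insertNth t u : Fin (n + 1) → ℝ) ∈ ell1Ball (n + 1) ↔
      |t| < 1 - ∑ j, |u j| := fun t => by
    change ∑ k, |(i.insertNth t u : Fin (n + 1) → ℝ) k| < 1 ↔ _
    rw [Fin.sum_univ_succAbove _ i]
    simp only [Fin.insertNth_apply_same, Fin.insertNth_apply_succAbove]
    constructor <;> intro h <;> linarith
  simp only
  by_cases hu : u ∈ ell1Ball n
  · have hu' : ∑ j, |u j| < 1 := hu
    set a := 1 - ∑ j, |u j| with ha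
    have ha0 : 0 < a := by linarith
    rw [indicator_of_mem hu]
    have e : ∀ t, Φ (i.insertNth t u) =
        (Ioo (-a) a).indicator (fun t => D (WithLp.toLp 2 (i.insertNth t u))) t := fun t => by
      by_cases ht : |t| < a
      · rw [indicator_of_mem (by rw [mem_Ioo, ← abs_lt]; exact ht), hΦ,
          indicator_of_mem ((hmem t).2 ht)]
      · rw [indicator_of_notMem (by rw [mem_Ioo, ← abs_lt]; exact ht), hΦ,
          indicator_of_notMem (fun h => ht ((hmem t).1 h))]
    change ∫ t, Φ (i.insertNth t u) = _
    simp_rw [e]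
    have hc : Continuous fun t : ℝ => D (WithLp.toLp 2 (i.insertNth t u)) :=
      hDc.comp (continuous_toLp_insertNth i continuous_id continuous_const)
    rw [integral_indicator measurableSet_Ioo, ← integral_Ioc_eq_integral_Ioo,
      ← intervalIntegral.integral_of_le (by linarith),
      intervalIntegral.integral_eq_sub_of_hasDerivAt
        (fun t _ => hasDerivAt_insertNth (hF.differentiable one_ne_zero) i u t)
        (hc.intervalIntegrable _ _)]
    simp [face, ha]
  · rw [indicator_of_notMem hu]
    have hu' : 1 ≤ ∑ j, |u j| := not_lt.1 hu
    have e : ∀ t, Φ (i.insertNth t u) = 0 := fun t => by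
      refine indicator_of_notMem (fun h => ?_) _
      have := (hmem t).1 h
      linarith [abs_nonneg t]
    change ∫ t, Φ (i.insertNth t u) = _
    simp [e]

/-- The divergence theorem on the `ℓ_1`-ball, whose outer normals are the sign vectors up to
scaling. -/
lemma IsUniformEll1.integral_sgn_mul_eq_ball (h : IsUniformEll1 ν c) {F : Vec (n + 1) → ℝ}
    (hF : ContDiff ℝ 1 F) (v : Vec (n + 1)) :
    ∫ s, (∑ i, v i * sgn (s i)) * F s ∂ν =
      c.toReal * ∫ w in ell1Ball (n + 1), fderiv ℝ F (WithLp.toLp 2 w) v := by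
  have hv : v = ∑ i, v i • EuclideanSpace.single i (1 : ℝ) := by
    ext k
    simp [Finset.sum_apply, Pi.single_apply]
  have hint : ∀ i, IntegrableOn (fun w : Fin (n + 1) → ℝ =>
      fderiv ℝ F (WithLp.toLp 2 w) (EuclideanSpace.single i 1)) (ell1Ball (n + 1)) := fun i =>
    integrableOn_ell1Ball (((hF.continuous_fderiv one_ne_zero).comp continuous_toLp_fin).clm_apply
      continuous_const)
  have e1 : ∀ w : Fin (n + 1) → ℝ, fderiv ℝ F (WithLp.toLp 2 w) v =
      ∑ i, v i * fderiv ℝ F (WithLp.toLp 2 w) (EuclideanSpace.single i 1) := fun w => by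
    conv_lhs => rw [hv]
    simp [map_sum]
  have e2 : ∀ s : Vec (n + 1), (∑ i, v i * sgn (s i)) * F s =
      ∑ i, v i * (sgn (s i) * F s) := fun s => by
    rw [Finset.sum_mul]
    exact Finset.sum_congr rfl fun i _ => by ring
  simp_rw [e1, e2]
  rw [integral_finsetSum _ fun i _ => (h.integrable_sgn_mul hF.continuous i).const_mul _,
    integral_finsetSum _ fun i _ => (hint i).const_mul _, Finset.mul_sum]
  refine Finset.sum_congr rfl fun i _ => ?_
  rw [integral_const_mul, integral_const_mul, h.integral_sgn_mul hF.continuous,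
    integral_ball_fderiv hF]
  ring

end

/-! ### Bias and variance of the gradient estimate -/

section
variable {n : ℕ} {ν : Measure (Vec (n + 1))} {c : ℝ≥0∞} {f : Vec (n + 1) → ℝ} {q : ℝ≥0∞} {L h : ℝ}

lemma convexOn_gradient_inequality {d : ℕ} {f : Vec d → ℝ} (hf : ConvexOn ℝ univ f)
    (hd : Differentiable ℝ f) (z y : Vec d) : f z - f y ≤ fderiv ℝ f z (z - y) := by
  have hconv : ConvexOn ℝ univ fun t : ℝ => f (z + t • (y - z)) := by
    refine ⟨convex_univ, fun a _ b _ α β hα hβ hαβ => ?_⟩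
    have := hf.2 (mem_univ (z + a • (y - z))) (mem_univ (z + b • (y - z))) hα hβ hαβ
    refine (le_of_eq ?_).trans this
    rw [smul_add, smul_add, add_add_add_comm, ← add_smul, hαβ, one_smul, smul_smul, smul_smul,
      ← add_smul, smul_eq_mul, smul_eq_mul]
  have hder : HasDerivAt (fun t : ℝ => f (z + t • (y - z))) (fderiv ℝ f z (y - z)) 0 := by
    have hz : z + (0 : ℝ) • (y - z) = z := by simp
    refine HasFDerivAt.comp_hasDerivAt (l := f) 0 (by rw [hz]; exact (hd z).hasFDerivAt) ?_
    simpa using ((hasDerivAt_id (0 : ℝ)).smul_const (y - z)).const_add z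
  have := hconv.le_slope_of_hasDerivAt (mem_univ 0) (mem_univ 1) zero_lt_one hder
  simp only [slope_def_field, one_smul, zero_smul, add_zero, sub_zero, div_one,
    add_sub_cancel] at this
  rw [← neg_sub y z, map_neg]
  linarith

lemma inner_gradEstimate (f : Vec (n + 1) → ℝ) (h : ℝ) (x s v : Vec (n + 1)) :
    inner ℝ (gradEstimate f h x s 0 0) v =
      (n + 1) / (2 * h) * ((∑ i, v i * sgn (s i)) * (f (x + h • s) - f (x - h • s))) := by
  rw [gradEstimate, real_inner_smul_left, inner_signVec]
  simp only [add_zero, sgn]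
  push_cast
  ring

/-- The bias bound for a smooth loss. The divergence theorem turns the mean of the estimate into the
mean gradient of the loss over the ball of radius `h`, to which the gradient inequality applies
pointwise; the values of the loss over the ball have mean at least that at the center. -/
lemma IsUniformEll1.bias_of_contDiff (hν : IsUniformEll1 ν c) (hn : 3 ≤ n + 1) (hq : 1 ≤ q)
    (hL : 0 ≤ L) (hh : 0 < h) (hf : ConvexOn ℝ univ f) (hfd : ContDiff ℝ 1 f)
    (hfL : ∀ x y, |f x - f y| ≤ L * ellNorm q (x - y)) (x u : Vec (n + 1)) :
    f x - f u - L * h * (6 * biasConst q (n + 1)) ≤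
      ∫ s, inner ℝ (gradEstimate f h x s 0 0) (x - u) ∂ν := by
  have hdiff := hfd.differentiable one_ne_zero
  set F : Vec (n + 1) → ℝ := fun s => f (x + h • s) - f (x - h • s) with hF
  have hFd : ContDiff ℝ 1 F := by fun_prop
  have hFder : ∀ w v, fderiv ℝ F w v =
      h * (fderiv ℝ f (x + h • w) v + fderiv ℝ f (x - h • w) v) := fun w v => by
    have h1 : HasFDerivAt (fun s : Vec (n + 1) => x + h • s) (h • ContinuousLinearMap.id ℝ _) w :=
      ((hasFDerivAt_id w).const_smul h).const_add x
    have h2 : HasFDerivAt (fun s : Vec (n + 1) => x - h • s)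
        (-(h • ContinuousLinearMap.id ℝ _)) w :=
      ((hasFDerivAt_id w).const_smul h).const_sub x
    have h3 := ((hdiff (x + h • w)).hasFDerivAt.comp w h1).sub
      ((hdiff (x - h • w)).hasFDerivAt.comp w h2)
    have h4 : fderiv ℝ F w = _ := h3.fderiv
    rw [h4]
    simp
    ring
  have hc0 : 0 ≤ c.toReal := ENNReal.toReal_nonneg
  have hcB : Continuous fun w : Fin (n + 1) → ℝ => ellNorm q (WithLp.toLp 2 w : Vec (n + 1)) :=
    (ellNorm_continuous hq).comp continuous_toLp_fin
  have hI1 : IntegrableOn (fun w : Fin (n + 1) → ℝ => fderiv ℝ F (WithLp.toLp 2 w) (x - u))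
      (ell1Ball (n + 1)) :=
    integrableOn_ell1Ball (((hFd.continuous_fderiv one_ne_zero).comp
      continuous_toLp_fin).clm_apply continuous_const)
  have hI2 : IntegrableOn (fun w : Fin (n + 1) → ℝ =>
      2 * h * (f x - f u) - 2 * h * (L * h) * ellNorm q (WithLp.toLp 2 w : Vec (n + 1)))
      (ell1Ball (n + 1)) := integrableOn_ell1Ball (by fun_prop)
  have hpt : ∀ w : Vec (n + 1), 2 * h * (f x - f u) - 2 * h * (L * h) * ellNorm q w ≤
      fderiv ℝ F w (x - u) := fun w => by
    have g1 := convexOn_gradient_inequality hf hdiff (x + h • w) (u + h • w)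
    have g2 := convexOn_gradient_inequality hf hdiff (x - h • w) (u - h • w)
    rw [add_sub_add_right_eq_sub] at g1
    rw [sub_sub_sub_cancel_right] at g2
    have g3 : 2 * f x ≤ f (x + h • w) + f (x - h • w) := by
      have := hf.2 (mem_univ (x + h • w)) (mem_univ (x - h • w))
        (by norm_num : (0 : ℝ) ≤ 1 / 2) (by norm_num : (0 : ℝ) ≤ 1 / 2) (by norm_num)
      have e : (1 / 2 : ℝ) • (x + h • w) + (1 / 2 : ℝ) • (x - h • w) = x := by module
      rw [e] at this
      simp only [smul_eq_mul] at this
      linarith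
    have g4 : f (u + h • w) ≤ f u + L * h * ellNorm q w := by
      have := (abs_le.1 (hfL (u + h • w) u)).2
      rw [add_sub_cancel_left, ellNorm_smul hq, abs_of_pos hh] at this
      linarith
    have g5 : f (u - h • w) ≤ f u + L * h * ellNorm q w := by
      have := (abs_le.1 (hfL (u - h • w) u)).2
      rw [sub_sub_cancel_left, ellNorm_neg hq, ellNorm_smul hq, abs_of_pos hh] at this
      linarith
    rw [hFder]
    have : 2 * (f x - f u) - 2 * (L * h) * ellNorm q w ≤
        fderiv ℝ f (x + h • w) (x - u) + fderiv ℝ f (x - h • w) (x - u) := by linarith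
    calc _ = h * (2 * (f x - f u) - 2 * (L * h) * ellNorm q w) := by ring
      _ ≤ _ := mul_le_mul_of_nonneg_left this hh.le
  have hmono : ∫ w in ell1Ball (n + 1), (2 * h * (f x - f u) -
      2 * h * (L * h) * ellNorm q (WithLp.toLp 2 w : Vec (n + 1))) ≤
      ∫ w in ell1Ball (n + 1), fderiv ℝ F (WithLp.toLp 2 w) (x - u) :=
    integral_mono hI2 hI1 fun w => hpt _
  have hfin : volume (ell1Ball (n + 1)) ≠ ∞ := by
    have := integrableOn_ell1Ball (d := n + 1) (g := fun _ => (1 : ℝ)) continuous_const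
    rw [integrableOn_const_iff] at this
    simpa [lt_top_iff_ne_top] using this
  rw [integral_sub (integrableOn_ell1Ball continuous_const)
    (integrableOn_ell1Ball (by fun_prop)), setIntegral_const, integral_const_mul,
    smul_eq_mul] at hmono
  have hV := hν.volume_ball
  have hb := hν.integral_ball_ellNorm_le hq hn
  set V := volume.real (ell1Ball (n + 1))
  set J := ∫ w in ell1Ball (n + 1), ellNorm q (WithLp.toLp 2 w : Vec (n + 1))
  have e : ∫ s, inner ℝ (gradEstimate f h x s 0 0) (x - u) ∂ν =
      (n + 1) / (2 * h) * (c.toReal *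
        ∫ w in ell1Ball (n + 1), fderiv ℝ F (WithLp.toLp 2 w) (x - u)) := by
    rw [← hν.integral_sgn_mul_eq_ball hFd, ← integral_const_mul]
    exact integral_congr_ae (ae_of_all _ fun s => inner_gradEstimate f h x s (x - u))
  rw [e]
  calc f x - f u - L * h * (6 * biasConst q (n + 1))
      ≤ f x - f u - L * h * ((n + 1) * c.toReal * J) := by gcongr
    _ = (n + 1) * c.toReal * V * (f x - f u) - L * h * ((n + 1) * c.toReal * J) := by
        rw [hV, one_mul]
    _ = (n + 1) / (2 * h) * (c.toReal *
          (V * (2 * h * (f x - f u)) - 2 * h * (L * h) * J)) := by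
        field_simp
    _ ≤ _ := by gcongr

/-- The two-point difference of a smooth loss has mean square of order `(h / d)²`. -/
lemma IsUniformEll1.variance_of_contDiff (hν : IsUniformEll1 ν c) (hL : 0 ≤ L) (hh : 0 < h)
    (hfd : ContDiff ℝ 1 f) (hfL : ∀ x y, |f x - f y| ≤ L * ‖x - y‖) (x : Vec (n + 1)) :
    ∫ s, (f (x + h • s) - f (x - h • s)) ^ 2 ∂ν ≤ 12 * (2 * h * L) ^ 2 / (n + 1) ^ 2 := by
  set F : Vec (n + 1) → ℝ := fun s => f (x + h • s) - f (x - h • s) with hF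
  have hFd : ContDiff ℝ 1 F := by fun_prop
  have hΛ : (0 : ℝ) ≤ 2 * h * L := by positivity
  have hFL : LipschitzWith (2 * h * L).toNNReal F := by
    refine LipschitzWith.of_dist_le_mul fun s t => ?_
    rw [Real.dist_eq, dist_eq_norm, Real.coe_toNNReal _ hΛ]
    have h1 := hfL (x + h • s) (x + h • t)
    have h2 := hfL (x - h • t) (x - h • s)
    have e1 : x + h • s - (x + h • t) = h • (s - t) := by module
    have e2 : x - h • t - (x - h • s) = h • (s - t) := by module
    rw [e1, norm_smul, Real.norm_of_nonneg hh.le] at h1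
    rw [e2, norm_smul, Real.norm_of_nonneg hh.le] at h2
    have e3 : F s - F t = (f (x + h • s) - f (x + h • t)) + (f (x - h • t) - f (x - h • s)) := by
      simp only [hF]; ring
    rw [e3]
    refine (abs_add_le _ _).trans ?_
    linarith
  have hodd : ∀ w, F (-w) = -F w := fun w => by
    simp only [hF, smul_neg, sub_neg_eq_add, ← sub_eq_add_neg]; ring
  have key := hν.lintegral_odd_sq_le hFd hFL hodd
  rw [Real.coe_toNNReal _ hΛ] at key
  rw [integral_eq_lintegral_of_nonneg_ae (ae_of_all _ fun s => sq_nonneg _)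
    (hFd.continuous.pow 2).aestronglyMeasurable]
  exact (ENNReal.toReal_mono ENNReal.ofReal_ne_top key).trans_eq
    (ENNReal.toReal_ofReal (by positivity))

end

end

/-! ### Smoothing of the loss -/

section

open Set Filter Topology

lemma continuous_of_ellNorm_lipschitz {d : ℕ} (hd : 0 < d) {q : ℝ≥0∞} (hq : 1 ≤ q) {L : ℝ}
    (hL : 0 ≤ L) {f : Vec d → ℝ} (hfL : ∀ x y, |f x - f y| ≤ L * ellNorm q (x - y)) :
    Continuous f := by
  have : LipschitzWith (L * (d : ℝ) ^ (invMinTwo q - 1 / 2)).toNNReal f :=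
    LipschitzWith.of_dist_le_mul fun x y => by
      rw [Real.dist_eq, dist_eq_norm, Real.coe_toNNReal _ (by positivity), mul_assoc]
      exact (hfL x y).trans (by gcongr; exact ellNorm_le_rpow_mul_norm hq hd _)
  exact this.continuous

/-- A convex Lipschitz function is a limit of smooth ones with the same Lipschitz constant. -/
lemma exists_smooth_approx {d : ℕ} (hd : 0 < d) {q : ℝ≥0∞} (hq : 1 ≤ q) {L : ℝ} (hL : 0 ≤ L)
    {f : Vec d → ℝ} (hf : ConvexOn ℝ univ f)
    (hfL : ∀ x y, |f x - f y| ≤ L * ellNorm q (x - y)) :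
    ∃ g : ℕ → Vec d → ℝ, (∀ k, ContDiff ℝ 1 (g k)) ∧ (∀ k, ConvexOn ℝ univ (g k)) ∧
      (∀ k x y, |g k x - g k y| ≤ L * ellNorm q (x - y)) ∧
      ∀ x, Tendsto (fun k => g k x) atTop (𝓝 (f x)) := by
  have hfc := continuous_of_ellNorm_lipschitz hd hq hL hfL
  let φ : ℕ → ContDiffBump (0 : Vec d) := fun k =>
    ⟨1 / (k + 2), 1 / (k + 1), by positivity, by
      apply one_div_lt_one_div_of_lt <;> linarith [(Nat.cast_nonneg k : (0 : ℝ) ≤ k)]⟩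
  set ρ : ℕ → Vec d → ℝ := fun k => (φ k).normed volume with hρ
  have hρc : ∀ k, Continuous (ρ k) := fun k => (φ k).continuous_normed
  have hρ0 : ∀ k t, 0 ≤ ρ k t := fun k t => (φ k).nonneg_normed t
  have hρi : ∀ k, Integrable (ρ k) := fun k => (φ k).integrable_normed
  have hρ1 : ∀ k, ∫ t, ρ k t = 1 := fun k => (φ k).integral_normed
  have hint : ∀ k x, Integrable fun t => ρ k t * f (x - t) := fun k x => by
    refine Continuous.integrable_of_hasCompactSupport ((hρc k).mul (by fun_prop)) ?_
    exact (φ k).hasCompactSupport_normed.mul_right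
  set g : ℕ → Vec d → ℝ := fun k =>
    convolution (ρ k) f (ContinuousLinearMap.lsmul ℝ ℝ) volume with hg
  have hgx : ∀ k x, g k x = ∫ t, ρ k t * f (x - t) := fun k x => rfl
  refine ⟨g, fun k => ?_, fun k => ⟨convex_univ, fun x _ y _ a b ha hb hab => ?_⟩,
    fun k x y => ?_, fun x => ?_⟩
  · exact (φ k).hasCompactSupport_normed.contDiff_convolution_left (n := 1) _
      (φ k).contDiff_normed hfc.locallyIntegrable
  · rw [hgx, hgx, hgx, smul_eq_mul, smul_eq_mul, ← integral_const_mul, ← integral_const_mul,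
      ← integral_add ((hint k x).const_mul a) ((hint k y).const_mul b)]
    refine integral_mono (hint k _) (((hint k x).const_mul a).add ((hint k y).const_mul b))
      fun t => ?_
    have h1 := hf.2 (mem_univ (x - t)) (mem_univ (y - t)) ha hb hab
    have e : a • (x - t) + b • (y - t) = a • x + b • y - t := by
      have : t = a • t + b • t := by rw [← add_smul, hab, one_smul]
      conv_rhs => rw [this]
      module
    rw [e] at h1
    simp only [smul_eq_mul] at h1 ⊢
    have h2 := mul_le_mul_of_nonneg_left h1 (hρ0 k t)
    linarith
  · rw [hgx, hgx, ← integral_sub (hint k x) (hint k y)]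
    calc |∫ t, (ρ k t * f (x - t) - ρ k t * f (y - t))|
        ≤ ∫ t, |ρ k t * f (x - t) - ρ k t * f (y - t)| := abs_integral_le_integral_abs
      _ ≤ ∫ t, ρ k t * (L * ellNorm q (x - y)) := by
          refine integral_mono ((hint k x).sub (hint k y)).abs ((hρi k).mul_const _) fun t => ?_
          rw [← mul_sub, abs_mul, abs_of_nonneg (hρ0 k t)]
          refine mul_le_mul_of_nonneg_left ?_ (hρ0 k t)
          have := hfL (x - t) (y - t)
          rwa [sub_sub_sub_cancel_right] at this
      _ = L * ellNorm q (x - y) := by rw [integral_mul_const, hρ1, one_mul]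
  · refine ContDiffBump.convolution_tendsto_right_of_continuous ?_ hfc x
    exact tendsto_one_div_add_atTop_nhds_zero_nat

section
variable {n : ℕ} {ν : Measure (Vec (n + 1))} {c : ℝ≥0∞} {f : Vec (n + 1) → ℝ} {q : ℝ≥0∞} {L h : ℝ}

lemma abs_two_point_le (hq : 1 ≤ q) (hL : 0 ≤ L) (hh : 0 < h)
    (hfL : ∀ x y, |f x - f y| ≤ L * ellNorm q (x - y)) (x : Vec (n + 1)) {s : Vec (n + 1)}
    (hs : s ∈ ell1Sphere (n + 1)) : |f (x + h • s) - f (x - h • s)| ≤ 2 * h * L := by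
  have hs' : ellNorm 1 s = 1 := hs
  have h1 := hfL (x + h • s) (x - h • s)
  have e : x + h • s - (x - h • s) = (2 * h) • s := by module
  rw [e, ellNorm_smul hq, abs_of_pos (show 0 < 2 * h by positivity)] at h1
  refine h1.trans ?_
  have h2 := ellNorm_antitone le_rfl hq s
  rw [hs'] at h2
  calc L * (2 * h * ellNorm q s) ≤ L * (2 * h * 1) := by gcongr
    _ = 2 * h * L := by ring

lemma abs_inner_gradEstimate_le (hq : 1 ≤ q) (hL : 0 ≤ L) (hh : 0 < h)
    (hfL : ∀ x y, |f x - f y| ≤ L * ellNorm q (x - y)) (x v : Vec (n + 1)) {s : Vec (n + 1)}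
    (hs : s ∈ ell1Sphere (n + 1)) :
    |inner ℝ (gradEstimate f h x s 0 0) v| ≤ (n + 1) * L * ∑ i, |v i| := by
  rw [inner_gradEstimate, abs_mul, abs_mul, abs_of_nonneg (by positivity)]
  have h1 := abs_two_point_le hq hL hh hfL x hs
  have h2 : |∑ i, v i * sgn (s i)| ≤ ∑ i, |v i| := by
    refine (Finset.abs_sum_le_sum_abs _ _).trans_eq (Finset.sum_congr rfl fun i _ => ?_)
    rw [abs_mul, abs_sgn, mul_one]
  calc (n + 1 : ℝ) / (2 * h) * (|∑ i, v i * sgn (s i)| * |f (x + h • s) - f (x - h • s)|)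
      ≤ (n + 1 : ℝ) / (2 * h) * ((∑ i, |v i|) * (2 * h * L)) := by gcongr
    _ = _ := by field_simp

lemma measurable_inner_gradEstimate (hf : Continuous f) (x v : Vec (n + 1)) :
    Measurable fun s => inner ℝ (gradEstimate f h x s 0 0) v := by
  simp_rw [inner_gradEstimate]
  have h1 : Measurable fun s : Vec (n + 1) => ∑ i, v i * sgn (s i) :=
    Finset.measurable_sum _ fun i _ =>
      (measurable_sgn.comp (by fun_prop : Measurable fun s : Vec (n + 1) => s i)).const_mul _
  have h2 : Continuous fun s : Vec (n + 1) => f (x + h • s) - f (x - h • s) := by fun_prop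
  exact (h1.mul h2.measurable).const_mul _

/-- The bias of the gradient estimate. -/
theorem IsUniformEll1.bias (hν : IsUniformEll1 ν c) (hn : 3 ≤ n + 1) (hq : 1 ≤ q)
    (hL : 0 ≤ L) (hh : 0 < h) (hf : ConvexOn ℝ univ f)
    (hfL : ∀ x y, |f x - f y| ≤ L * ellNorm q (x - y)) (x u : Vec (n + 1)) :
    f x - f u - L * h * (6 * biasConst q (n + 1)) ≤
      ∫ s, inner ℝ (gradEstimate f h x s 0 0) (x - u) ∂ν := by
  have := hν.prob
  obtain ⟨g, g1, g2, g3, g4⟩ := exists_smooth_approx n.succ_pos hq hL hf hfL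
  have hb := fun k => hν.bias_of_contDiff hn hq hL hh (g2 k) (g1 k) (g3 k) x u
  refine le_of_tendsto_of_tendsto (((g4 x).sub (g4 u)).sub_const _)
    (tendsto_integral_of_dominated_convergence (fun _ => (n + 1) * L * ∑ i, |(x - u) i|)
      (fun k => (measurable_inner_gradEstimate (g1 k).continuous x _).aestronglyMeasurable)
      (integrable_const _) (fun k => ?_) (ae_of_all _ fun s => ?_)) (Eventually.of_forall hb)
  · filter_upwards [hν.ae_mem] with s hs
    exact abs_inner_gradEstimate_le hq hL hh (g3 k) x _ hs
  · simp_rw [inner_gradEstimate]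
    exact (((g4 _).sub (g4 _)).const_mul _).const_mul _

/-- The mean square of the two-point difference. -/
theorem IsUniformEll1.variance (hν : IsUniformEll1 ν c) (hq : 1 ≤ q)
    (hL : 0 ≤ L) (hh : 0 < h) (hf : ConvexOn ℝ univ f)
    (hfL : ∀ x y, |f x - f y| ≤ L * ellNorm q (x - y)) (x : Vec (n + 1)) :
    ∫ s, (f (x + h • s) - f (x - h • s)) ^ 2 ∂ν ≤
      12 * (2 * h * (L * ((n + 1 : ℕ) : ℝ) ^ (invMinTwo q - 1 / 2))) ^ 2 / (n + 1) ^ 2 := by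
  have := hν.prob
  obtain ⟨g, g1, g2, g3, g4⟩ := exists_smooth_approx n.succ_pos hq hL hf hfL
  have hb := fun k => hν.variance_of_contDiff (f := g k)
    (L := L * ((n + 1 : ℕ) : ℝ) ^ (invMinTwo q - 1 / 2)) (by positivity) hh (g1 k)
    (fun x y => (g3 k x y).trans (by
      rw [mul_assoc]; gcongr; exact ellNorm_le_rpow_mul_norm hq n.succ_pos _)) x
  refine le_of_tendsto (tendsto_integral_of_dominated_convergence (fun _ => (2 * h * L) ^ 2)
      (fun k => ?_) (integrable_const _) (fun k => ?_) (ae_of_all _ fun s => ?_))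
      (Eventually.of_forall hb)
  · have := (g1 k).continuous
    exact Continuous.aestronglyMeasurable (by fun_prop)
  · filter_upwards [hν.ae_mem] with s hs
    rw [norm_pow, Real.norm_eq_abs]
    exact pow_le_pow_left₀ (abs_nonneg _) (abs_two_point_le hq hL hh (g3 k) x hs) 2
  · exact ((g4 _).sub (g4 _)).pow 2

end

end

/-! ### The noise-free process -/

section

open Set Filter Topology

section
variable {d : ℕ} {Θ : Set (Vec d)} {V : Vec d → ℝ} {η h : ℝ} {f : ℕ → Vec d → ℝ}

lemma gradEstimate_canceling {d : ℕ} (f : Vec d → ℝ) (h : ℝ) (x s : Vec d) (a : ℝ) :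
    gradEstimate f h x s a a = gradEstimate f h x s 0 0 := by
  simp only [gradEstimate, add_sub_add_right_eq_sub, add_zero]

/-- The dual variable along a sequence `e` of directions when the noises cancel. -/
def noiseFreeDual (Θ : Set (Vec d)) (V : Vec d → ℝ) (η h : ℝ) (f : ℕ → Vec d → ℝ)
    (e : ℕ → Vec d) (t : ℕ) : Vec d :=
  dualVar Θ V (fun _ => η) (fun _ => h) f e (fun _ => 0) (fun _ => 0) t

lemma noiseFreeDual_succ (e : ℕ → Vec d) (t : ℕ) :
    noiseFreeDual Θ V η h f e (t + 1) = noiseFreeDual Θ V η h f e t -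
      gradEstimate (f t) h (primalPoint Θ V η (noiseFreeDual Θ V η h f e t)) (e t) 0 0 := rfl

lemma dualVar_eq_noiseFreeDual {e : ℕ → Vec d} {ξ' ξ'' : ℕ → ℝ} (hξ : ∀ t, ξ' t = ξ'' t) (t : ℕ) :
    dualVar Θ V (fun _ => η) (fun _ => h) f e ξ' ξ'' t = noiseFreeDual Θ V η h f e t := by
  induction t with
  | zero => rfl
  | succ t ih => rw [dualVar, noiseFreeDual_succ, ih, hξ, gradEstimate_canceling]

lemma noiseFreeDual_congr {e e' : ℕ → Vec d} {t : ℕ} (hee : ∀ s < t, e s = e' s) :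
    noiseFreeDual Θ V η h f e t = noiseFreeDual Θ V η h f e' t := by
  induction t with
  | zero => rfl
  | succ t ih =>
    rw [noiseFreeDual_succ, noiseFreeDual_succ, ih fun s hs => hee s (by omega),
      hee t (by omega)]

lemma measurable_signVec : Measurable (signVec : Vec d → Vec d) := by
  have h : Measurable fun x : Vec d => fun i => sgn (x i) :=
    measurable_pi_lambda _ fun i =>
      measurable_sgn.comp (by fun_prop : Measurable fun x : Vec d => x i)
  exact (PiLp.continuous_toLp 2 _).measurable.comp h

lemma measurable_gradEstimate {f : Vec d → ℝ} (hf : Continuous f) :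
    Measurable fun z : Vec d × Vec d => gradEstimate f h z.1 z.2 0 0 := by
  have h1 : Measurable fun z : Vec d × Vec d =>
      (d : ℝ) / (2 * h) * ((f (z.1 + h • z.2) + 0) - (f (z.1 - h • z.2) + 0)) :=
    Continuous.measurable (by fun_prop)
  have h2 : Measurable ((signVec : Vec d → Vec d) ∘ (Prod.snd : Vec d × Vec d → Vec d)) :=
    measurable_signVec.comp measurable_snd
  have h3 : Measurable fun z : ℝ × Vec d => z.1 • z.2 := Continuous.measurable (by fun_prop)
  exact h3.comp (h1.prodMk h2)

lemma measurable_noiseFreeDual (hpp : Continuous (primalPoint Θ V η))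
    (hf : ∀ t, Continuous (f t)) (t : ℕ) :
    Measurable fun e : ℕ → Vec d => noiseFreeDual Θ V η h f e t := by
  induction t with
  | zero => exact measurable_const
  | succ t ih =>
    simp_rw [noiseFreeDual_succ]
    have h1 : Measurable fun e : ℕ → Vec d =>
        (primalPoint Θ V η (noiseFreeDual Θ V η h f e t), e t) :=
      (hpp.measurable.comp ih).prodMk (measurable_pi_apply t)
    have h2 := (measurable_gradEstimate (h := h) (hf t)).comp h1
    exact Measurable.sub ih h2

/-- The point played at round `t` is a function of the directions of the previous rounds. -/
lemma indepFun_primalPoint (hpp : Continuous (primalPoint Θ V η)) (hf : ∀ t, Continuous (f t))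
    {Ω : Type*} [MeasurableSpace Ω] {P : Measure Ω} {ζ : ℕ → Ω → Vec d}
    (hζ : ∀ t, Measurable (ζ t)) (hind : iIndepFun ζ P) (t : ℕ) :
    IndepFun (fun ω => primalPoint Θ V η (noiseFreeDual Θ V η h f (fun s => ζ s ω) t))
      (ζ t) P := by
  have h0 := hind.indepFun_finset (Finset.range t) {t} (by simp) hζ
  let ext : (Finset.range t → Vec d) → ℕ → Vec d := fun v s =>
    if hs : s ∈ Finset.range t then v ⟨s, hs⟩ else 0
  have hext : Measurable ext := by
    refine measurable_pi_lambda _ fun s => ?_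
    by_cases hs : s ∈ Finset.range t
    · simp only [ext, hs, dite_true]
      exact measurable_pi_apply _
    · simp only [ext, hs, dite_false]
      exact measurable_const
  have hφ : Measurable fun v => primalPoint Θ V η (noiseFreeDual Θ V η h f (ext v) t) :=
    hpp.measurable.comp ((measurable_noiseFreeDual hpp hf t).comp hext)
  have h1 := h0.comp hφ (measurable_pi_apply (⟨t, by simp⟩ : ({t} : Finset ℕ)))
  have e : (fun ω => primalPoint Θ V η (noiseFreeDual Θ V η h f (fun s => ζ s ω) t)) =
      (fun v => primalPoint Θ V η (noiseFreeDual Θ V η h f (ext v) t)) ∘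
        fun ω (i : Finset.range t) => ζ i ω := by
    funext ω
    simp only [Function.comp]
    congr 1
    refine noiseFreeDual_congr fun s hs => ?_
    simp [ext, hs]
  rw [e]
  exact h1

end

/-! ### One round of the algorithm -/

section
variable {n : ℕ} {c : ℝ≥0∞} {f : Vec (n + 1) → ℝ} {q : ℝ≥0∞} {L h : ℝ}
  {Ω : Type*} [MeasurableSpace Ω] {P : Measure Ω} [IsProbabilityMeasure P]
  {X ζ : Ω → Vec (n + 1)} {Θ : Set (Vec (n + 1))}

lemma integral_indep {Φ : Vec (n + 1) × Vec (n + 1) → ℝ} (hΦ : Measurable Φ) (hX : Measurable X)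
    (hζ : Measurable ζ) (hind : IndepFun X ζ P) (hi : Integrable (fun ω => Φ (X ω, ζ ω)) P) :
    Integrable (fun x => ∫ s, Φ (x, s) ∂P.map ζ) (P.map X) ∧
      ∫ ω, Φ (X ω, ζ ω) ∂P = ∫ x, ∫ s, Φ (x, s) ∂P.map ζ ∂P.map X := by
  have := Measure.isProbabilityMeasure_map (μ := P) hζ.aemeasurable
  have := Measure.isProbabilityMeasure_map (μ := P) hX.aemeasurable
  have hm := (indepFun_iff_map_prod_eq_prod_map_map hX.aemeasurable hζ.aemeasurable).1 hind
  have hi' : Integrable Φ ((P.map X).prod (P.map ζ)) := by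
    rw [← hm, integrable_map_measure hΦ.aestronglyMeasurable (hX.prodMk hζ).aemeasurable]
    exact hi
  refine ⟨hi'.integral_prod_left, ?_⟩
  rw [← integral_prod _ hi', ← hm, integral_map (hX.prodMk hζ).aemeasurable
    hΦ.aestronglyMeasurable]

lemma integrable_of_isCompact (hΘ : IsCompact Θ) (hX : Measurable X) (hXΘ : ∀ ω, X ω ∈ Θ)
    {g : Vec (n + 1) → ℝ} (hg : Continuous g) : Integrable (fun ω => g (X ω)) P := by
  obtain ⟨C, hC⟩ := hΘ.exists_bound_of_continuousOn hg.continuousOn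
  exact Integrable.of_bound (hg.measurable.comp hX).aestronglyMeasurable C
    (ae_of_all _ fun ω => hC _ (hXΘ ω))

/-- As the point played is independent of the direction, the bound at a fixed point can be averaged.
The estimate is integrable since `X` stays in the compact set `Θ`. -/
lemma round_bias (hν : IsUniformEll1 (P.map ζ) c) (hn : 3 ≤ n + 1) (hq : 1 ≤ q) (hL : 0 ≤ L)
    (hh : 0 < h) (hf : ConvexOn ℝ univ f) (hfL : ∀ x y, |f x - f y| ≤ L * ellNorm q (x - y))
    (hΘ : IsCompact Θ) (hX : Measurable X) (hXΘ : ∀ ω, X ω ∈ Θ) (hζ : Measurable ζ)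
    (hind : IndepFun X ζ P) (u : Vec (n + 1)) :
    Integrable (fun ω => inner ℝ (gradEstimate f h (X ω) (ζ ω) 0 0) (X ω - u)) P ∧
      ∫ ω, (f (X ω) - f u) ∂P ≤
        ∫ ω, inner ℝ (gradEstimate f h (X ω) (ζ ω) 0 0) (X ω - u) ∂P +
          L * h * (6 * biasConst q (n + 1)) := by
  have hfc := continuous_of_ellNorm_lipschitz n.succ_pos hq hL hfL
  have := Measure.isProbabilityMeasure_map (μ := P) hX.aemeasurable
  have hΦ : Measurable fun z : Vec (n + 1) × Vec (n + 1) =>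
      inner ℝ (gradEstimate f h z.1 z.2 0 0) (z.1 - u) :=
    (measurable_gradEstimate hfc).inner (by fun_prop)
  have hi : Integrable (fun ω => inner ℝ (gradEstimate f h (X ω) (ζ ω) 0 0) (X ω - u)) P := by
    have hb : Integrable (fun ω => (n + 1) * L * ∑ i, |(X ω - u) i|) P :=
      integrable_of_isCompact hΘ hX hXΘ
        (g := fun x => (n + 1) * L * ∑ i, |(x - u) i|) (by fun_prop)
    refine hb.mono' (hΦ.comp (hX.prodMk hζ)).aestronglyMeasurable ?_
    filter_upwards [ae_of_ae_map hζ.aemeasurable hν.ae_mem] with ω hω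
    exact abs_inner_gradEstimate_le hq hL hh hfL _ _ hω
  refine ⟨hi, ?_⟩
  obtain ⟨h1, h2⟩ := integral_indep hΦ hX hζ hind hi
  have hfi := integrable_of_isCompact (P := P) hΘ hX hXΘ (g := fun x => f x - f u)
    (by fun_prop)
  have hfi' : Integrable (fun x => f x - f u) (P.map X) := by
    rw [integrable_map_measure (Continuous.aestronglyMeasurable (by fun_prop)) hX.aemeasurable]
    exact hfi
  have h3 : ∫ ω, (f (X ω) - f u) ∂P = ∫ x, (f x - f u) ∂P.map X :=
    (integral_map hX.aemeasurable (f := fun x => f x - f u)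
      (Continuous.aestronglyMeasurable (by fun_prop))).symm
  have h4 : ∫ x, (f x - f u - L * h * (6 * biasConst q (n + 1))) ∂P.map X ≤
      ∫ x, ∫ s, inner ℝ (gradEstimate f h x s 0 0) (x - u) ∂P.map ζ ∂P.map X :=
    integral_mono (hfi'.sub (integrable_const _)) h1 fun x =>
      hν.bias hn hq hL hh hf hfL x u
  rw [integral_sub hfi' (integrable_const _), integral_const, probReal_univ, one_smul] at h4
  rw [h2, h3]
  linarith

lemma round_variance (hν : IsUniformEll1 (P.map ζ) c) (hq : 1 ≤ q) (hL : 0 ≤ L)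
    (hh : 0 < h) (hf : ConvexOn ℝ univ f) (hfL : ∀ x y, |f x - f y| ≤ L * ellNorm q (x - y))
    (hX : Measurable X) (hζ : Measurable ζ) (hind : IndepFun X ζ P) :
    Integrable (fun ω => (f (X ω + h • ζ ω) - f (X ω - h • ζ ω)) ^ 2) P ∧
      ∫ ω, (f (X ω + h • ζ ω) - f (X ω - h • ζ ω)) ^ 2 ∂P ≤
        12 * (2 * h * (L * ((n + 1 : ℕ) : ℝ) ^ (invMinTwo q - 1 / 2))) ^ 2 / (n + 1) ^ 2 := by
  have hfc := continuous_of_ellNorm_lipschitz n.succ_pos hq hL hfL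
  have := Measure.isProbabilityMeasure_map (μ := P) hX.aemeasurable
  have hΦ : Measurable fun z : Vec (n + 1) × Vec (n + 1) =>
      (f (z.1 + h • z.2) - f (z.1 - h • z.2)) ^ 2 := Continuous.measurable (by fun_prop)
  have hi : Integrable (fun ω => (f (X ω + h • ζ ω) - f (X ω - h • ζ ω)) ^ 2) P := by
    refine Integrable.of_bound (hΦ.comp (hX.prodMk hζ)).aestronglyMeasurable ((2 * h * L) ^ 2) ?_
    filter_upwards [ae_of_ae_map hζ.aemeasurable hν.ae_mem] with ω hω
    rw [norm_pow, Real.norm_eq_abs]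
    exact pow_le_pow_left₀ (abs_nonneg _) (abs_two_point_le hq hL hh hfL _ hω) 2
  refine ⟨hi, ?_⟩
  obtain ⟨h1, h2⟩ := integral_indep hΦ hX hζ hind hi
  rw [h2]
  refine (integral_mono h1 (integrable_const _) fun x =>
    hν.variance hq hL hh hf hfL x).trans ?_
  simp

end

end

/-! ### The regret bound -/

section

lemma abs_inner_gradEstimate_le_ellNorm {d : ℕ} {p : ℝ≥0∞} (hp : 1 ≤ p) (hd : 0 < d)
    (f : Vec d → ℝ) {h : ℝ} (hh : 0 < h) (x s v : Vec d) :
    |inner ℝ (gradEstimate f h x s 0 0) v| ≤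
      d / (2 * h) * |f (x + h • s) - f (x - h • s)| * (d : ℝ) ^ (1 - invExp p) * ellNorm p v := by
  have h0 : 0 ≤ (d : ℝ) / (2 * h) := by positivity
  rw [gradEstimate, real_inner_smul_left, abs_mul, abs_mul, abs_of_nonneg h0, add_zero, add_zero,
    mul_assoc (_ * _) _ (ellNorm p v)]
  exact mul_le_mul_of_nonneg_left
    ((abs_inner_signVec_le s v).trans (sum_abs_le_rpow_mul_ellNorm hp hd v)) (by positivity)

lemma biasConst_pos {d : ℕ} (hd : 3 ≤ d) {q : ℝ≥0∞} (hq : 1 ≤ q) : 0 < biasConst q d := by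
  obtain ⟨s, hs, -, e⟩ := exists_exponent_biasConst hq hd
  rw [e]
  have : (0 : ℝ) < d := by exact_mod_cast (by omega : 0 < d)
  positivity

/-- The contributions of the diameter, of the second moment of the gradient estimates and of their
bias, with the step size that balances the first two. -/
lemma regret_constants {d : ℕ} (hd : 0 < d) {R L b h η m ι : ℝ} {T : ℕ} (hT : 0 < T) (hR : 0 < R)
    (hL : 0 < L) (hb : 0 < b)
    (hη : η = (√6 + √12)⁻¹ * (R / L) * √((d : ℝ) ^ (-1 - 2 * m + 2 * ι) / T))
    (h_le : h ≤ 7 * R / (100 * b * √(T : ℝ)) * (d : ℝ) ^ (1 / 2 + m - ι)) :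
    R ^ 2 / η + η / 2 * (T * (12 * L ^ 2 * (d : ℝ) ^ (1 + 2 * m - 2 * ι))) +
      T * (L * h * (6 * b)) ≤
        11.9 * R * L * √(T * (d : ℝ) ^ (1 + 2 * m - 2 * ι)) := by
  have hd' : (0 : ℝ) < d := by exact_mod_cast hd
  have hT' : (0 : ℝ) < T := by exact_mod_cast hT
  set τ := √(T : ℝ) with hτ
  have hτ0 : 0 < τ := Real.sqrt_pos.2 hT'
  have hτ2 : (T : ℝ) = τ ^ 2 := (Real.sq_sqrt hT'.le).symm
  set δ := (d : ℝ) ^ (1 / 2 + m - ι) with hδ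
  have hδ0 : 0 < δ := Real.rpow_pos_of_pos hd' _
  have hδ2 : (d : ℝ) ^ (1 + 2 * m - 2 * ι) = δ ^ 2 := by
    rw [hδ, ← Real.rpow_natCast, ← Real.rpow_mul hd'.le]
    congr 1
    push_cast
    ring
  have hδ2' : (d : ℝ) ^ (-1 - 2 * m + 2 * ι) = (δ ^ 2)⁻¹ := by
    rw [← hδ2, ← Real.rpow_neg hd'.le]
    congr 1
    ring
  have e1 : √((T : ℝ) * δ ^ 2) = τ * δ := by
    rw [hτ2, ← mul_pow, Real.sqrt_sq (by positivity)]
  have e2 : √((δ ^ 2)⁻¹ / (T : ℝ)) = (τ * δ)⁻¹ := by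
    rw [hτ2, ← Real.sqrt_sq (by positivity : 0 ≤ (τ * δ)⁻¹)]
    congr 1
    field_simp
  rw [hδ2, e1]
  rw [hδ2', e2] at hη
  set K : ℝ := √6 + √12 with hK
  have h6 : √6 ^ 2 = 6 := Real.sq_sqrt (by norm_num)
  have h12 : √12 ^ 2 = 12 := Real.sq_sqrt (by norm_num)
  have h6' := Real.sqrt_nonneg (6 : ℝ)
  have h12' := Real.sqrt_nonneg (12 : ℝ)
  have hK1 : 4 ≤ K := by nlinarith
  have hK2 : K ≤ 6 := by
    have h1 : √6 ≤ 5 / 2 := by nlinarith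
    have h2 : √12 ≤ 7 / 2 := by nlinarith
    linarith
  have hK0 : 0 < K := by linarith
  have t1 : R ^ 2 / η = K * (R * L * (τ * δ)) := by
    rw [hη]; field_simp
  have t2 : η / 2 * (T * (12 * L ^ 2 * δ ^ 2)) = 6 / K * (R * L * (τ * δ)) := by
    rw [hη, hτ2]; field_simp; norm_num
  have t3 : T * (L * h * (6 * b)) ≤ 42 / 100 * (R * L * (τ * δ)) := by
    calc T * (L * h * (6 * b)) ≤
        T * (L * (7 * R / (100 * b * τ) * δ) * (6 * b)) := by gcongr
      _ = _ := by rw [hτ2]; field_simp; norm_num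
  have t4 : 6 / K ≤ 3 / 2 := by rw [div_le_iff₀ hK0]; linarith
  have hM : 0 ≤ R * L * (τ * δ) := by positivity
  rw [t1, t2]
  nlinarith [mul_le_mul_of_nonneg_right t4 hM, mul_le_mul_of_nonneg_right hK2 hM]

/-- The second moment of the dual norm of a gradient estimate. -/
lemma dualNorm_sq_constants {d : ℕ} (hd : 0 < d) {h L : ℝ} (hh : 0 < h) (m ι : ℝ) :
    (d / (2 * h)) ^ 2 * ((d : ℝ) ^ (1 - ι)) ^ 2 *
      (12 * (2 * h * (L * (d : ℝ) ^ (m - 1 / 2))) ^ 2 / (d : ℝ) ^ 2) =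
        12 * L ^ 2 * (d : ℝ) ^ (1 + 2 * m - 2 * ι) := by
  have hd' : (0 : ℝ) < d := by exact_mod_cast hd
  have e : (d : ℝ) ^ (1 + 2 * m - 2 * ι) = ((d : ℝ) ^ (1 - ι)) ^ 2 * ((d : ℝ) ^ (m - 1 / 2)) ^ 2 := by
    rw [← mul_pow, ← Real.rpow_add hd', ← Real.rpow_natCast, ← Real.rpow_mul hd'.le]
    congr 1
    push_cast
    ring
  rw [e]
  field_simp

/-- The regret bound for the noise-free process, whose points depend measurably on the
directions. -/
lemma regret_noiseFree {d : ℕ} (hd : 3 ≤ d) {p q : ℝ≥0∞} (hp : 1 ≤ p) (hq : 1 ≤ q) {R L : ℝ}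
    (hL : 0 < L) {Θ : Set (Vec d)} (hΘ : IsCompact Θ) {V : Vec d → ℝ}
    (hV : LowerSemicontinuousOn V Θ) (hVc : OneStronglyConvexOn p Θ V)
    (hR : ∀ x ∈ Θ, ∀ x' ∈ Θ, V x - V x' ≤ R ^ 2)
    {f : ℕ → Vec d → ℝ} (hf : ∀ t, ConvexOn ℝ Set.univ (f t))
    (hfL : ∀ t x x', |f t x - f t x'| ≤ L * ellNorm q (x - x'))
    {Ω : Type*} [MeasurableSpace Ω] {P : Measure Ω} [IsProbabilityMeasure P]
    {ζ : ℕ → Ω → Vec d} (hζ : ∀ t, Measurable (ζ t)) (hu1 : ∀ t, IsUniformOnEll1Sphere P (ζ t))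
    (hind : iIndepFun ζ P) (T : ℕ) {η h : ℝ} (hη : 0 < η) (hh : 0 < h) {u : Vec d} (hu : u ∈ Θ) :
    (∀ t, Integrable (fun ω => f t (primalPoint Θ V η
      (noiseFreeDual Θ V η h f (fun s => ζ s ω) t)) - f t u) P) ∧
    ∫ ω, ∑ t ∈ Finset.range T, (f t (primalPoint Θ V η
      (noiseFreeDual Θ V η h f (fun s => ζ s ω) t)) - f t u) ∂P ≤
      R ^ 2 / η + η / 2 * (T * (12 * L ^ 2 * (d : ℝ) ^ (1 + 2 * invMinTwo q - 2 * invExp p))) +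
        T * (L * h * (6 * biasConst q d)) := by
  obtain ⟨n, rfl⟩ : ∃ n, d = n + 1 := ⟨d - 1, by omega⟩
  have hn0 : 0 < n + 1 := n.succ_pos
  have hpp := primalPoint_continuous hn0 hp hΘ ⟨u, hu⟩ hV hVc hη
  have hfc := fun t => continuous_of_ellNorm_lipschitz hn0 hq hL.le (hfL t)
  set X : ℕ → Ω → Vec (n + 1) := fun t ω =>
    primalPoint Θ V η (noiseFreeDual Θ V η h f (fun s => ζ s ω) t) with hXdef
  have hXm : ∀ t, Measurable (X t) := fun t =>
    hpp.measurable.comp ((measurable_noiseFreeDual hpp hfc t).comp (measurable_pi_lambda _ hζ))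
  have hXΘ : ∀ t ω, X t ω ∈ Θ := fun t ω => (primalPoint_spec hΘ ⟨u, hu⟩ hV η _).1
  have hXi : ∀ t, IndepFun (X t) (ζ t) P := indepFun_primalPoint hpp hfc hζ hind
  have hint : ∀ t, Integrable (fun ω => f t (X t ω) - f t u) P := fun t =>
    integrable_of_isCompact hΘ (hXm t) (hXΘ t) (g := fun x => f t x - f t u)
      ((hfc t).sub continuous_const)
  refine ⟨hint, ?_⟩
  have hbias : ∀ t, Integrable
      (fun ω => inner ℝ (gradEstimate (f t) h (X t ω) (ζ t ω) 0 0) (X t ω - u)) P ∧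
      ∫ ω, (f t (X t ω) - f t u) ∂P ≤
        ∫ ω, inner ℝ (gradEstimate (f t) h (X t ω) (ζ t ω) 0 0) (X t ω - u) ∂P +
          L * h * (6 * biasConst q (n + 1)) := fun t => by
    obtain ⟨c, hc⟩ := exists_isUniformEll1 (by omega) (hζ t) (hu1 t)
    exact round_bias hc hd hq hL.le hh (hf t) (hfL t) hΘ (hXm t) (hXΘ t) (hζ t) (hXi t) u
  have hvar : ∀ t, Integrable
      (fun ω => (f t (X t ω + h • ζ t ω) - f t (X t ω - h • ζ t ω)) ^ 2) P ∧
      ∫ ω, (f t (X t ω + h • ζ t ω) - f t (X t ω - h • ζ t ω)) ^ 2 ∂P ≤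
        12 * (2 * h * (L * ((n + 1 : ℕ) : ℝ) ^ (invMinTwo q - 1 / 2))) ^ 2 /
          ((n + 1 : ℕ) : ℝ) ^ 2 := fun t => by
    obtain ⟨c, hc⟩ := exists_isUniformEll1 (by omega) (hζ t) (hu1 t)
    have := round_variance hc hq hL.le hh (hf t) (hfL t) (hXm t) (hζ t) (hXi t)
    simpa only [Nat.cast_add, Nat.cast_one] using this
  set D : ℝ := ((n + 1 : ℕ) : ℝ)
  set Δ : ℕ → Ω → ℝ := fun t ω => f t (X t ω + h • ζ t ω) - f t (X t ω - h • ζ t ω) with hΔ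
  set A : ℝ := (D / (2 * h)) ^ 2 * (D ^ (1 - invExp p)) ^ 2 with hA
  have hpath : ∀ ω, ∑ t ∈ Finset.range T,
      inner ℝ (gradEstimate (f t) h (X t ω) (ζ t ω) 0 0) (X t ω - u) ≤
        R ^ 2 / η + η / 2 * ∑ t ∈ Finset.range T, A * Δ t ω ^ 2 := fun ω => by
    refine (dualAveraging_regret (z := noiseFreeDual Θ V η h f (fun s => ζ s ω))
      (g := fun t => gradEstimate (f t) h (X t ω) (ζ t ω) 0 0)
      (c := fun t => D / (2 * h) * |Δ t ω| * D ^ (1 - invExp p)) hΘ hV hVc hη hR rfl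
      (fun t => rfl)
      (fun t v => abs_inner_gradEstimate_le_ellNorm hp hn0 (f t) hh _ _ v) hu T).trans_eq ?_
    congr 2
    refine Finset.sum_congr rfl fun t _ => ?_
    rw [mul_pow, mul_pow, sq_abs, hA]
    ring
  have hΔi : Integrable (fun ω => ∑ t ∈ Finset.range T, A * Δ t ω ^ 2) P :=
    integrable_finsetSum _ fun t _ => (hvar t).1.const_mul A
  have hΔb : ∫ ω, ∑ t ∈ Finset.range T, A * Δ t ω ^ 2 ∂P ≤
      T * (12 * L ^ 2 * D ^ (1 + 2 * invMinTwo q - 2 * invExp p)) := by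
    rw [integral_finsetSum _ fun t _ => (hvar t).1.const_mul A]
    refine (Finset.sum_le_card_nsmul _ _
      (12 * L ^ 2 * D ^ (1 + 2 * invMinTwo q - 2 * invExp p)) fun t _ => ?_).trans_eq ?_
    · rw [integral_const_mul, ← dualNorm_sq_constants hn0 hh]
      exact mul_le_mul_of_nonneg_left (hvar t).2 (by positivity)
    · rw [Finset.card_range, nsmul_eq_mul]
  have hreg : ∑ t ∈ Finset.range T,
      ∫ ω, inner ℝ (gradEstimate (f t) h (X t ω) (ζ t ω) 0 0) (X t ω - u) ∂P ≤
        R ^ 2 / η + η / 2 * ∫ ω, ∑ t ∈ Finset.range T, A * Δ t ω ^ 2 ∂P := by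
    rw [← integral_finsetSum _ fun t _ => (hbias t).1]
    refine (integral_mono (integrable_finsetSum _ fun t _ => (hbias t).1)
      ((integrable_const _).add (hΔi.const_mul _)) hpath).trans_eq ?_
    simp only [Pi.add_apply]
    rw [integral_add (integrable_const _) (hΔi.const_mul _), integral_const, probReal_univ,
      one_smul, integral_const_mul]
  rw [integral_finsetSum _ fun t _ => hint t]
  refine (Finset.sum_le_sum fun t _ => (hbias t).2).trans ?_
  rw [Finset.sum_add_distrib, Finset.sum_const, Finset.card_range, nsmul_eq_mul]
  have := mul_le_mul_of_nonneg_left hΔb (by positivity : 0 ≤ η / 2)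
  linarith

end

end ZeroOrder

end

theorem theorem1 {d : ℕ} (hd : 3 ≤ d)
    (p q : ℝ≥0∞) (hp : 1 ≤ p) (hq : 1 ≤ q)
    (R L : ℝ) (hR : 0 < R) (hL : 0 < L)
    -- the feasible set and the regularizer
    (Θ : Set (ZeroOrder.Vec d)) (hΘ_compact : IsCompact Θ) (hΘ_convex : Convex ℝ Θ)
    (V : ZeroOrder.Vec d → ℝ) (hV_lsc : LowerSemicontinuousOn V Θ)
    (hV_convex : ZeroOrder.OneStronglyConvexOn p Θ V)
    (hV_range : ∀ x ∈ Θ, ∀ x' ∈ Θ, V x - V x' ≤ R ^ 2)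
    -- the losses
    (f : ℕ → ZeroOrder.Vec d → ℝ) (hf_convex : ∀ t, ConvexOn ℝ Set.univ (f t))
    (hf_lip : ∀ t x x', |f t x - f t x'| ≤ L * ZeroOrder.ellNorm q (x - x'))
    -- the random directions and the canceling noise
    {Ω : Type*} [MeasurableSpace Ω] (P : Measure Ω) [IsProbabilityMeasure P]
    (ζ : ℕ → Ω → ZeroOrder.Vec d) (hζ_meas : ∀ t, Measurable (ζ t))
    (hζ_unif : ∀ t, ZeroOrder.IsUniformOnEll1Sphere P (ζ t)) (hζ_indep : iIndepFun ζ P)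
    (ξ' ξ'' : ℕ → Ω → ℝ) (hξ : ∀ t, ∀ᵐ ω ∂P, ξ' t ω = ξ'' t ω)
    -- the horizon, the step size and the discretization parameter
    (T : ℕ) (hT : 1 ≤ T)
    (η : ℝ)
    (hη : η = (√6 + √12)⁻¹ * (R / L) *
      √((d : ℝ) ^ (-1 - 2 * ZeroOrder.invMinTwo q + 2 * ZeroOrder.invExp p) / T))
    (h : ℝ) (h_pos : 0 < h)
    (h_le : h ≤ 7 * R / (100 * ZeroOrder.biasConst q d * √(T : ℝ)) *
      (d : ℝ) ^ (1 / 2 + ZeroOrder.invMinTwo q - ZeroOrder.invExp p))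
    -- the iterates of the algorithm
    (x : ℕ → Ω → ZeroOrder.Vec d)
    (hx : ∀ t ω, x t ω = ZeroOrder.iterate Θ V (fun _ => η) (fun _ => h) f
      (fun s => ζ s ω) (fun s => ξ' s ω) (fun s => ξ'' s ω) t)
    -- the comparator
    (u : ZeroOrder.Vec d) (hu : u ∈ Θ) :
    Integrable (fun ω => ∑ t ∈ Finset.range T, (f t (x t ω) - f t u)) P ∧
      ∫ ω, ∑ t ∈ Finset.range T, (f t (x t ω) - f t u) ∂P ≤
        11.9 * R * L *
          √(T * (d : ℝ) ^ (1 + 2 * ZeroOrder.invMinTwo q - 2 * ZeroOrder.invExp p)) := by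
  have hT' : (0 : ℝ) < T := by exact_mod_cast hT
  have hd' : (0 : ℝ) < d := by exact_mod_cast (by omega : 0 < d)
  have η_pos : 0 < η := by rw [hη]; positivity
  obtain ⟨hint, hreg⟩ := ZeroOrder.regret_noiseFree hd hp hq hL hΘ_compact hV_lsc hV_convex
    hV_range hf_convex hf_lip hζ_meas hζ_unif hζ_indep T η_pos h_pos hu
  -- the noises cancel, so almost surely the iterates are those of the noise-free process
  have hae : (fun ω => ∑ t ∈ Finset.range T, (f t (x t ω) - f t u)) =ᵐ[P] fun ω =>
      ∑ t ∈ Finset.range T, (f t (ZeroOrder.primalPoint Θ V η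
        (ZeroOrder.noiseFreeDual Θ V η h f (fun s => ζ s ω) t)) - f t u) := by
    filter_upwards [ae_all_iff.2 hξ] with ω hω
    refine Finset.sum_congr rfl fun t _ => ?_
    rw [hx, ZeroOrder.iterate, ZeroOrder.dualVar_eq_noiseFreeDual hω]
  refine ⟨(integrable_finsetSum _ fun t _ => hint t).congr hae.symm, ?_⟩
  rw [integral_congr_ae hae]
  exact hreg.trans (ZeroOrder.regret_constants (by omega) hT hR hL
    (ZeroOrder.biasConst_pos hd hq) hη h_le)
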